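/- Let $k$ be an algebraically closed field of characteristic zero, and let $\pi\colon M\to S$ be a smooth morphism between schemes that are smooth and equidimensional over $k$. Let $T^*M$ be the cotangent bundle of $M$, $T^*(\pi)$ the relative cotangent bundle of $\pi$, and $p\colon T^*M\to T^*(\pi)$ the canonical surjective bundle map. A closed subset of one of these bundles is given its reduced scheme structure, and is called conic if it is stable under the $\mathbb{G}_m$-action scaling the fibers. For a smooth equidimensional scheme $X$ over an algebraically closed field, a closed subset of $T^*X$ is a Lagrangian if the canonical symplectic form vanishes on its smooth locus and all its irreducible components have dimension $\dim X$. A closed subset $\Lambda^{\mathrm{rel}}\subset T^*(\pi)$ is a relative Lagrangian if for every geometric point $s$ of $S$ the fiber $\Lambda^{\mathrm{rel}}_s=\Lambda^{\mathrm{rel}}\cap T^*(M_s)$, with its reduced structure, is a Lagrangian in $T^*(M_s)$, and all irreducible components of $\Lambda^{\mathrm{rel}}$ have dimension $\dim M$. The shadow of a closed subset of $T^*M$ or $T^*(\pi)$ is the set of images in $M$ of the generic points of its irreducible components. Let $\Lambda^{\mathrm{rel}}\subset T^*(\pi)$ be a closed conic relative Lagrangian. Then: 1. There exists a unique closed conic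 Lagrangian $\Lambda\subset T^*M$ such that $p(\Lambda)$ is contained in $\Lambda^{\mathrm{rel}}$ and dense in it, and every irreducible component of $\Lambda$ dominates an irreducible component of $\Lambda^{\mathrm{rel}}$. (It is called the lifting of $\Lambda^{\mathrm{rel}}$.) 2. For the lifting $\Lambda$, the map $p|_\Lambda\colon\Lambda\to\Lambda^{\mathrm{rel}}$ is an isomorphism over an open dense subset of $\Lambda^{\mathrm{rel}}$. 3. The shadows of $\Lambda^{\mathrm{rel}}$ and of $\Lambda$ are the same, and each point of the shadow maps to the generic point of an irreducible component of $S$. -/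

import Mathlib

universe u
open CategoryTheory Limits AlgebraicGeometry

namespace RelCotangent
noncomputable section

section Algebra

variable (A B A' B' : Type u) [CommRing A] [CommRing B] [CommRing A'] [CommRing B']
  [Algebra A B] [Algebra A' B'] [Algebra A A'] [Algebra B B'] [Algebra A B']
  [IsScalarTower A B B'] [IsScalarTower A A' B']

/-- The module of vector fields of `B` over `A`: the dual of the Kähler differentials. -/
abbrev VectorField : Type u := Module.Dual B (Ω[B⁄A])

lemma bijective_kaehler_map [Algebra.FormallyUnramified A A'] :
    Function.Bijective (KaehlerDifferential.map A A' B' B') := by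
  refine ⟨?_, KaehlerDifferential.map_surjective A A' B'⟩
  rw [injective_iff_map_eq_zero]
  intro x hx
  obtain ⟨y, rfl⟩ := (KaehlerDifferential.exact_mapBaseChange_map A A' B' x).mp hx
  rw [Subsingleton.elim y 0, map_zero]

lemma isBaseChange_kaehler [Algebra.FormallyEtale B B'] [Algebra.FormallyUnramified A A'] :
    IsBaseChange B' (KaehlerDifferential.map A A' B B') := by
  have h1 := KaehlerDifferential.isBaseChange_of_formallyEtale A B B'
  have h2 := IsBaseChange.ofEquiv
    (LinearEquiv.ofBijective _ (bijective_kaehler_map A A' B'))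
  have h3 := h1.comp h2
  have e : KaehlerDifferential.map A A' B B' = ((LinearEquiv.ofBijective _ (bijective_kaehler_map A A' B')).toLinearMap.restrictScalars B) ∘ₗ (KaehlerDifferential.map A A B B') := by
    apply LinearMap.ext_on (KaehlerDifferential.span_range_derivation A B)
    rintro _ ⟨b, rfl⟩
    simp
  rw [e]
  exact h3

/-- Restriction of vector fields along a localisation (more generally, along `B → B'` formally
étale and `A → A'` formally unramified): it is characterised by `τ(v)(dω) = v(ω)`. -/
def VectorField.restrict [Algebra.FormallyEtale B B'] [Algebra.FormallyUnramified A A'] :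
    VectorField A B →ₗ[B] VectorField A' B' :=
  (isBaseChange_kaehler A B A' B').linearMapLeftRightHom (Algebra.linearMap B B')

@[simp]
lemma VectorField.restrict_map [Algebra.FormallyEtale B B'] [Algebra.FormallyUnramified A A']
    (v : VectorField A B) (ω : Ω[B⁄A]) :
    VectorField.restrict A B A' B' v (KaehlerDifferential.map A A' B B' ω) =
      algebraMap B B' (v ω) :=
  IsBaseChange.linearMapLeftRightHom_comp_apply _ _ _ _

lemma VectorField.eq_restrict [Algebra.FormallyEtale B B'] [Algebra.FormallyUnramified A A']
    (v : VectorField A B) (v' : VectorField A' B')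
    (h : ∀ b : B, v' (KaehlerDifferential.D A' B' (algebraMap B B' b)) =
      algebraMap B B' (v (KaehlerDifferential.D A B b))) :
    v' = VectorField.restrict A B A' B' v := by
  apply (isBaseChange_kaehler A B A' B').algHom_ext
  intro x
  rw [VectorField.restrict_map]
  have : (v'.restrictScalars B) ∘ₗ (KaehlerDifferential.map A A' B B') =
      (Algebra.linearMap B B') ∘ₗ v := by
    apply LinearMap.ext_on (KaehlerDifferential.span_range_derivation A B)
    rintro _ ⟨b, rfl⟩
    simpa using h b
  exact LinearMap.congr_fun this x

lemma VectorField.isBaseChange_restrict [Algebra.Etale B B']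
    [Algebra.FormallyUnramified A A'] [Algebra.FinitePresentation A B] :
    IsBaseChange B' (VectorField.restrict A B A' B') := by
  have hΩ := isBaseChange_kaehler A B A' B'
  have h := Module.FinitePresentation.isBaseChange_map B (Ω[B⁄A]) B B'
  refine .of_equiv (h.equiv ≪≫ₗ LinearEquiv.congrLeft _ B' hΩ.equiv ≪≫ₗ
    LinearEquiv.congrRight (IsBaseChange.linearMap B B').equiv) ?_
  intro v
  apply hΩ.algHom_ext
  intro x
  rw [VectorField.restrict_map]
  simp only [LinearEquiv.trans_apply, IsBaseChange.equiv_tmul, one_smul]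
  change (IsBaseChange.linearMap B B').equiv (LinearMap.baseChange B' v (hΩ.equiv.symm _)) = _
  simp [IsBaseChange.equiv_symm_apply, IsBaseChange.equiv_tmul]

/-- The coordinate ring of the relative cotangent bundle of `Spec B` over `Spec A`: the symmetric
algebra on the module of vector fields. -/
abbrev CotangentRing : Type u := SymmetricAlgebra B (VectorField A B)

def CotangentRing.restrict [Algebra.FormallyEtale B B'] [Algebra.FormallyUnramified A A'] :
    CotangentRing A B →+* CotangentRing A' B' :=
  (SymmetricAlgebra.lift (((SymmetricAlgebra.ι B' (VectorField A' B')).restrictScalars B) ∘ₗ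
    VectorField.restrict A B A' B')).toRingHom

@[simp]
lemma CotangentRing.restrict_algebraMap [Algebra.FormallyEtale B B']
    [Algebra.FormallyUnramified A A'] (b : B) :
    CotangentRing.restrict A B A' B' (algebraMap B _ b) =
      algebraMap B' _ (algebraMap B B' b) := by
  rw [← IsScalarTower.algebraMap_apply]
  exact AlgHom.commutes _ b

@[simp]
lemma CotangentRing.restrict_ι [Algebra.FormallyEtale B B']
    [Algebra.FormallyUnramified A A'] (v : VectorField A B) :
    CotangentRing.restrict A B A' B' (SymmetricAlgebra.ι _ _ v) =
      SymmetricAlgebra.ι _ _ (VectorField.restrict A B A' B' v) := by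
  simp [CotangentRing.restrict]

lemma CotangentRing.ringHom_ext {R : Type*} [CommRing R] {f g : CotangentRing A B →+* R}
    (h₁ : ∀ b, f (algebraMap B _ b) = g (algebraMap B _ b))
    (h₂ : ∀ v, f (SymmetricAlgebra.ι _ _ v) = g (SymmetricAlgebra.ι _ _ v)) : f = g := by
  refine RingHom.ext fun x ↦ ?_
  induction x using SymmetricAlgebra.induction with
  | algebraMap r => exact h₁ r
  | ι x => exact h₂ x
  | mul a b ha hb => rw [map_mul, map_mul, ha, hb]
  | add a b ha hb => rw [map_add, map_add, ha, hb]

lemma CotangentRing.exists_desc [Algebra.Etale B B']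
    [Algebra.FormallyUnramified A A'] [Algebra.FinitePresentation A B]
    {R : Type u} [CommRing R] (f : B' →+* R) (g : CotangentRing A B →+* R)
    (hfg : ∀ b, f (algebraMap B B' b) = g (algebraMap B _ b)) :
    ∃ h : CotangentRing A' B' →+* R, (∀ b, h (algebraMap B' _ b) = f b) ∧
      ∀ x, h (CotangentRing.restrict A B A' B' x) = g x := by
  let _ : Algebra B' R := f.toAlgebra
  let _ : Algebra B R := (f.comp (algebraMap B B')).toAlgebra
  have : IsScalarTower B B' R := .of_algebraMap_eq' rfl
  have hT := VectorField.isBaseChange_restrict A B A' B'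
  let ψ : VectorField A B →ₗ[B] R :=
    { toFun := fun v ↦ g (SymmetricAlgebra.ι _ _ v)
      map_add' := by simp
      map_smul' := fun b v ↦ by
        rw [map_smul, Algebra.smul_def, map_mul, ← hfg, Algebra.smul_def]
        rfl }
  let h : CotangentRing A' B' →ₐ[B'] R := SymmetricAlgebra.lift (hT.lift ψ)
  have h₁ : ∀ b, h.toRingHom (algebraMap B' _ b) = f b := fun b ↦ h.commutes b
  refine ⟨h.toRingHom, h₁, fun x ↦ ?_⟩
  refine DFunLike.congr_fun
    (CotangentRing.ringHom_ext A B (f := h.toRingHom.comp (CotangentRing.restrict A B A' B'))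
      (g := g) (fun b ↦ ?_) fun v ↦ ?_) x
  · rw [RingHom.comp_apply, CotangentRing.restrict_algebraMap, h₁, hfg]
  · rw [RingHom.comp_apply, CotangentRing.restrict_ι]
    exact (SymmetricAlgebra.lift_ι_apply _ _).trans (hT.lift_eq ψ v)

lemma CotangentRing.ringHom_ext' [Algebra.Etale B B']
    [Algebra.FormallyUnramified A A'] [Algebra.FinitePresentation A B]
    {R : Type u} [CommRing R] {f g : CotangentRing A' B' →+* R}
    (h₁ : ∀ b, f (algebraMap B' _ b) = g (algebraMap B' _ b))
    (h₂ : ∀ x, f (CotangentRing.restrict A B A' B' x) = g (CotangentRing.restrict A B A' B' x)) :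
    f = g := by
  refine CotangentRing.ringHom_ext A' B' h₁ fun v ↦ ?_
  induction v using (VectorField.isBaseChange_restrict A B A' B').inductionOn with
  | zero => simp
  | tmul v => simpa using h₂ (SymmetricAlgebra.ι _ _ v)
  | smul b v hv => rw [map_smul, Algebra.smul_def, map_mul, map_mul, h₁, hv]
  | add v w hv hw => rw [map_add, map_add, map_add, hv, hw]

/-- Cotangent coordinate rings are compatible with localisation. -/
lemma CotangentRing.isPushout [Algebra.Etale B B']
    [Algebra.FormallyUnramified A A'] [Algebra.FinitePresentation A B] :
    IsPushout (CommRingCat.ofHom (algebraMap B B'))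
      (CommRingCat.ofHom (algebraMap B (CotangentRing A B)))
      (CommRingCat.ofHom (algebraMap B' (CotangentRing A' B')))
      (CommRingCat.ofHom (CotangentRing.restrict A B A' B')) := by
  have H (s : PushoutCocone (CommRingCat.ofHom (algebraMap B B'))
      (CommRingCat.ofHom (algebraMap B (CotangentRing A B)))) :=
    CotangentRing.exists_desc A B A' B' s.inl.hom s.inr.hom
      (fun b ↦ DFunLike.congr_fun (congrArg CommRingCat.Hom.hom s.condition) b)
  choose d hd₁ hd₂ using H
  refine ⟨⟨by ext b; simp⟩, ⟨PushoutCocone.IsColimit.mk _ (fun s ↦ CommRingCat.ofHom (d s))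
    (fun s ↦ ?_) (fun s ↦ ?_) (fun s m h₁ h₂ ↦ ?_)⟩⟩
  · ext b
    exact hd₁ s b
  · ext x
    exact hd₂ s x
  · ext1
    refine CotangentRing.ringHom_ext' A B A' B' (fun b ↦ ?_) (fun x ↦ ?_)
    · exact (DFunLike.congr_fun (congrArg CommRingCat.Hom.hom h₁) b).trans (hd₁ s b).symm
    · exact (DFunLike.congr_fun (congrArg CommRingCat.Hom.hom h₂) x).trans (hd₂ s x).symm

/-- Vector fields of `B` over `A`, regarded as vector fields over a ring `R` below `A`. -/
def VectorField.ofTower (R A B : Type u) [CommRing R] [CommRing A] [CommRing B] [Algebra R A]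
    [Algebra A B] [Algebra R B] [IsScalarTower R A B] : VectorField A B →ₗ[B] VectorField R B :=
  (KaehlerDifferential.map R A B B).dualMap

/-- The map of coordinate rings `Sym (T_{B/A}) → Sym (T_{B/R})`. -/
def CotangentRing.ofTower (R A B : Type u) [CommRing R] [CommRing A] [CommRing B] [Algebra R A]
    [Algebra A B] [Algebra R B] [IsScalarTower R A B] : CotangentRing A B →+* CotangentRing R B :=
  (SymmetricAlgebra.lift (SymmetricAlgebra.ι B (VectorField R B) ∘ₗ
    VectorField.ofTower R A B)).toRingHom

lemma CotangentRing.ofTower_algebraMap (R A B : Type u) [CommRing R] [CommRing A] [CommRing B]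
    [Algebra R A] [Algebra A B] [Algebra R B] [IsScalarTower R A B] (b : B) :
    CotangentRing.ofTower R A B (algebraMap B _ b) = algebraMap B _ b :=
  AlgHom.commutes _ b

lemma CotangentRing.ofTower_ι (R A B : Type u) [CommRing R] [CommRing A] [CommRing B]
    [Algebra R A] [Algebra A B] [Algebra R B] [IsScalarTower R A B] (v : VectorField A B) :
    CotangentRing.ofTower R A B (SymmetricAlgebra.ι _ _ v) =
      SymmetricAlgebra.ι _ _ (VectorField.ofTower R A B v) :=
  SymmetricAlgebra.lift_ι_apply _ _

end Algebra

section Charts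

variable {X Y : Scheme.{u}} (f : X ⟶ Y)

/-- A chart of `f : X ⟶ Y`: affine opens `V ⊆ X` and `U ⊆ Y` with `f(V) ⊆ U`. -/
structure Chart where
  V : X.Opens
  isAffineOpen_V : IsAffineOpen V
  U : Y.Opens
  isAffineOpen_U : IsAffineOpen U
  le : V ≤ f ⁻¹ᵁ U

namespace Chart

variable {f}

instance : PartialOrder (Chart f) where
  le i j := i.V ≤ j.V ∧ i.U ≤ j.U
  le_refl _ := ⟨le_rfl, le_rfl⟩
  le_trans _ _ _ h₁ h₂ := ⟨h₁.1.trans h₂.1, h₁.2.trans h₂.2⟩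
  le_antisymm := by
    rintro ⟨V, hV, U, hU, h⟩ ⟨V', hV', U', hU', h'⟩ h₁ h₂
    obtain rfl : V = V' := le_antisymm h₁.1 h₂.1
    obtain rfl : U = U' := le_antisymm h₁.2 h₂.2
    rfl

lemma le_def {i j : Chart f} : i ≤ j ↔ i.V ≤ j.V ∧ i.U ≤ j.U := Iff.rfl

/-- The coordinate ring of the base of a chart. -/
abbrev A (i : Chart f) : Type u := Γ(Y, i.U)

/-- The coordinate ring of the source of a chart. -/
abbrev B (i : Chart f) : Type u := Γ(X, i.V)

instance (i : Chart f) : Algebra i.A i.B := (f.appLE i.U i.V i.le).hom.toAlgebra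

/-- The ring of functions on the relative cotangent bundle over a chart. -/
abbrev ring (i : Chart f) : Type u := CotangentRing i.A i.B

abbrev resA {i j : Chart f} (h : i ≤ j) : j.A →+* i.A := (Y.presheaf.map (homOfLE h.2).op).hom

abbrev resB {i j : Chart f} (h : i ≤ j) : j.B →+* i.B := (X.presheaf.map (homOfLE h.1).op).hom

lemma resB_algebraMap {i j : Chart f} (h : i ≤ j) :
    (resB h).comp (algebraMap j.A j.B) = (algebraMap i.A i.B).comp (resA h) := by
  ext a
  have h₁ := f.appLE_map j.le (homOfLE h.1).op
  have h₂ := f.map_appLE i.le (homOfLE h.2).op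
  exact DFunLike.congr_fun (congrArg CommRingCat.Hom.hom (h₁.trans h₂.symm)) a

lemma etale_presheaf_map {Z : Scheme.{u}} {U V : Z.Opens} (hU : IsAffineOpen U)
    (hV : IsAffineOpen V) (h : V ≤ U) : (Z.presheaf.map (homOfLE h).op).hom.Etale := by
  have := (𝟙 Z : Z ⟶ Z).etale_appLE hU hV h
  have e : (𝟙 Z : Z ⟶ Z).appLE U V (show V ≤ 𝟙 Z ⁻¹ᵁ U from h) =
      Z.presheaf.map (homOfLE h).op := by
    rw [Scheme.Hom.appLE, Scheme.Hom.id_app]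
    exact Category.id_comp _
  rwa [e] at this

/-- Restriction of the functions on the cotangent bundle to a smaller chart. -/
def restrict {i j : Chart f} (h : i ≤ j) : j.ring →+* i.ring :=
  letI := (resA h).toAlgebra
  letI := (resB h).toAlgebra
  letI := ((resB h).comp (algebraMap j.A j.B)).toAlgebra
  haveI : IsScalarTower j.A j.B i.B := .of_algebraMap_eq' rfl
  haveI : IsScalarTower j.A i.A i.B := .of_algebraMap_eq' (resB_algebraMap h)
  haveI : Algebra.Etale j.A i.A := etale_presheaf_map j.isAffineOpen_U i.isAffineOpen_U h.2
  haveI : Algebra.Etale j.B i.B := etale_presheaf_map j.isAffineOpen_V i.isAffineOpen_V h.1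
  CotangentRing.restrict j.A j.B i.A i.B

/-- Restriction of relative vector fields to a smaller chart. -/
def restrictVF {i j : Chart f} (h : i ≤ j) (v : VectorField j.A j.B) : VectorField i.A i.B :=
  letI := (resA h).toAlgebra
  letI := (resB h).toAlgebra
  letI := ((resB h).comp (algebraMap j.A j.B)).toAlgebra
  haveI : IsScalarTower j.A j.B i.B := .of_algebraMap_eq' rfl
  haveI : IsScalarTower j.A i.A i.B := .of_algebraMap_eq' (resB_algebraMap h)
  haveI : Algebra.Etale j.A i.A := etale_presheaf_map j.isAffineOpen_U i.isAffineOpen_U h.2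
  haveI : Algebra.Etale j.B i.B := etale_presheaf_map j.isAffineOpen_V i.isAffineOpen_V h.1
  VectorField.restrict j.A j.B i.A i.B v

lemma restrict_algebraMap {i j : Chart f} (h : i ≤ j) (b : j.B) :
    restrict h (algebraMap j.B j.ring b) = algebraMap i.B i.ring (resB h b) := by
  let _ := (resA h).toAlgebra
  let _ := (resB h).toAlgebra
  let _ := ((resB h).comp (algebraMap j.A j.B)).toAlgebra
  have : IsScalarTower j.A j.B i.B := .of_algebraMap_eq' rfl
  have : IsScalarTower j.A i.A i.B := .of_algebraMap_eq' (resB_algebraMap h)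
  have : Algebra.Etale j.A i.A := etale_presheaf_map j.isAffineOpen_U i.isAffineOpen_U h.2
  have : Algebra.Etale j.B i.B := etale_presheaf_map j.isAffineOpen_V i.isAffineOpen_V h.1
  exact CotangentRing.restrict_algebraMap j.A j.B i.A i.B b

lemma restrict_ι {i j : Chart f} (h : i ≤ j) (v : VectorField j.A j.B) :
    restrict h (SymmetricAlgebra.ι j.B _ v) = SymmetricAlgebra.ι i.B _ (restrictVF h v) := by
  let _ := (resA h).toAlgebra
  let _ := (resB h).toAlgebra
  let _ := ((resB h).comp (algebraMap j.A j.B)).toAlgebra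
  have : IsScalarTower j.A j.B i.B := .of_algebraMap_eq' rfl
  have : IsScalarTower j.A i.A i.B := .of_algebraMap_eq' (resB_algebraMap h)
  have : Algebra.Etale j.A i.A := etale_presheaf_map j.isAffineOpen_U i.isAffineOpen_U h.2
  have : Algebra.Etale j.B i.B := etale_presheaf_map j.isAffineOpen_V i.isAffineOpen_V h.1
  exact CotangentRing.restrict_ι j.A j.B i.A i.B v

/-- The restriction `v'` of a vector field `v` is the unique one with `v'(b|_V) = v(b)|_V`. -/
lemma eq_restrictVF_iff {i j : Chart f} (h : i ≤ j) (v : VectorField j.A j.B)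
    (v' : VectorField i.A i.B) : v' = restrictVF h v ↔ ∀ b : j.B,
      v' (KaehlerDifferential.D i.A i.B (resB h b)) =
        resB h (v (KaehlerDifferential.D j.A j.B b)) := by
  let _ := (resA h).toAlgebra
  let _ := (resB h).toAlgebra
  let _ := ((resB h).comp (algebraMap j.A j.B)).toAlgebra
  have : IsScalarTower j.A j.B i.B := .of_algebraMap_eq' rfl
  have : IsScalarTower j.A i.A i.B := .of_algebraMap_eq' (resB_algebraMap h)
  have : Algebra.Etale j.A i.A := etale_presheaf_map j.isAffineOpen_U i.isAffineOpen_U h.2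
  have : Algebra.Etale j.B i.B := etale_presheaf_map j.isAffineOpen_V i.isAffineOpen_V h.1
  refine ⟨?_, VectorField.eq_restrict j.A j.B i.A i.B v v'⟩
  rintro rfl b
  have := VectorField.restrict_map j.A j.B i.A i.B v (KaehlerDifferential.D j.A j.B b)
  rw [KaehlerDifferential.map_D] at this
  exact this

lemma isPushout_restrict [Smooth f] {i j : Chart f} (h : i ≤ j) :
    IsPushout (X.presheaf.map (homOfLE h.1).op)
      (CommRingCat.ofHom (algebraMap j.B j.ring)) (CommRingCat.ofHom (algebraMap i.B i.ring))
      (CommRingCat.ofHom (restrict h)) := by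
  let _ := (resA h).toAlgebra
  let _ := (resB h).toAlgebra
  let _ := ((resB h).comp (algebraMap j.A j.B)).toAlgebra
  have : IsScalarTower j.A j.B i.B := .of_algebraMap_eq' rfl
  have : IsScalarTower j.A i.A i.B := .of_algebraMap_eq' (resB_algebraMap h)
  have : Algebra.Etale j.A i.A := etale_presheaf_map j.isAffineOpen_U i.isAffineOpen_U h.2
  have : Algebra.Etale j.B i.B := etale_presheaf_map j.isAffineOpen_V i.isAffineOpen_V h.1
  have : Algebra.Smooth j.A j.B := f.smooth_appLE j.isAffineOpen_U j.isAffineOpen_V j.le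
  exact CotangentRing.isPushout j.A j.B i.A i.B

lemma resB_self (i : Chart f) (b : i.B) : resB (le_refl i) b = b :=
  DFunLike.congr_fun (congrArg CommRingCat.Hom.hom (X.presheaf.map_id (.op i.V))) b

lemma resB_resB {i j l : Chart f} (h : i ≤ j) (h' : j ≤ l) (b : l.B) :
    resB h (resB h' b) = resB (h.trans h') b :=
  (DFunLike.congr_fun (congrArg CommRingCat.Hom.hom
    (X.presheaf.map_comp (homOfLE h'.1).op (homOfLE h.1).op)) b).symm

lemma restrict_self (i : Chart f) : restrict (le_refl i) = RingHom.id _ := by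
  refine CotangentRing.ringHom_ext _ _ (fun b ↦ ?_) (fun v ↦ ?_)
  · rw [restrict_algebraMap, resB_self, RingHom.id_apply]
  · rw [restrict_ι, RingHom.id_apply]
    congr 1
    refine ((eq_restrictVF_iff (le_refl i) v v).mpr fun b ↦ ?_).symm
    rw [resB_self, resB_self]

lemma restrict_comp_restrict {i j l : Chart f} (h : i ≤ j) (h' : j ≤ l) :
    (restrict h).comp (restrict h') = restrict (h.trans h') := by
  refine CotangentRing.ringHom_ext _ _ (fun b ↦ ?_) (fun v ↦ ?_)
  · rw [RingHom.comp_apply, restrict_algebraMap, restrict_algebraMap, restrict_algebraMap,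
      resB_resB]
  · rw [RingHom.comp_apply, restrict_ι, restrict_ι, restrict_ι]
    congr 1
    refine (eq_restrictVF_iff (h.trans h') v _).mpr fun b ↦ ?_
    rw [← resB_resB h h', (eq_restrictVF_iff h (restrictVF h' v) _).mp rfl,
      (eq_restrictVF_iff h' v _).mp rfl, resB_resB]

lemma exists_le_of_mem {i j : Chart f} {a : X} (hi : a ∈ i.V) (hj : a ∈ j.V) :
    ∃ l : Chart f, l ≤ i ∧ l ≤ j ∧ a ∈ l.V := by
  obtain ⟨_, ⟨U, hU : IsAffineOpen U, rfl⟩, hxU, hUU⟩ :=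
    Y.isBasis_affineOpens.exists_subset_of_mem_open
      (show f a ∈ ((i.U ⊓ j.U : Y.Opens) : Set Y) from ⟨i.le hi, j.le hj⟩) (i.U ⊓ j.U).2
  obtain ⟨_, ⟨V, hV : IsAffineOpen V, rfl⟩, hxV, hVV⟩ :=
    X.isBasis_affineOpens.exists_subset_of_mem_open
      (show a ∈ ((i.V ⊓ j.V ⊓ f ⁻¹ᵁ U : X.Opens) : Set X) from ⟨⟨hi, hj⟩, hxU⟩)
      (i.V ⊓ j.V ⊓ f ⁻¹ᵁ U).2
  exact ⟨⟨V, hV, U, hU, fun y hy ↦ (hVV hy).2⟩,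
    ⟨fun y hy ↦ (hVV hy).1.1, fun y hy ↦ (hUU hy).1⟩,
    ⟨fun y hy ↦ (hVV hy).1.2, fun y hy ↦ (hUU hy).2⟩, hxV⟩

variable (f) in
/-- The open cover of `X` by the sources of all charts. -/
abbrev cover : X.OpenCover where
  I₀ := Chart f
  X i := Spec Γ(X, i.V)
  f i := i.isAffineOpen_V.fromSpec
  mem₀ := by
    rw [Scheme.presieve₀_mem_precoverage_iff]
    refine ⟨fun x ↦ ?_, fun i ↦ inferInstance⟩
    obtain ⟨_, ⟨U, hU, rfl⟩, hxU, -⟩ :=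
      Y.isBasis_affineOpens.exists_subset_of_mem_open (Set.mem_univ (f x)) isOpen_univ
    obtain ⟨_, ⟨V, hV, rfl⟩, hxV, hVU⟩ :=
      X.isBasis_affineOpens.exists_subset_of_mem_open hxU (f ⁻¹ᵁ U).2
    refine ⟨⟨V, hV, U, hU, hVU⟩, ?_⟩
    rw [IsAffineOpen.range_fromSpec]
    exact hxV

instance : (cover f).LocallyDirected where
  trans {i j} h := Spec.map (X.presheaf.map (homOfLE (leOfHom h).1).op)
  trans_id i := by
    exact (congrArg Spec.map (X.presheaf.map_id _)).trans (Spec.map_id _)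
  trans_comp {i j l} h h' := by
    rw [← Spec.map_comp, ← X.presheaf.map_comp]
    rfl
  w {i j} h := IsAffineOpen.map_fromSpec _ _ _
  directed {i j} x := by
    have hi : (pullback.fst ((cover f).f i) ((cover f).f j) ≫ (cover f).f i) x ∈ Chart.V i := by
      rw [← SetLike.mem_coe, ← IsAffineOpen.range_fromSpec i.isAffineOpen_V]
      exact ⟨pullback.fst ((cover f).f i) ((cover f).f j) x, rfl⟩
    have hj : (pullback.fst ((cover f).f i) ((cover f).f j) ≫ (cover f).f i) x ∈ Chart.V j := by
      rw [← SetLike.mem_coe, ← IsAffineOpen.range_fromSpec j.isAffineOpen_V, pullback.condition]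
      exact ⟨pullback.snd ((cover f).f i) ((cover f).f j) x, rfl⟩
    generalize ha : (pullback.fst ((cover f).f i) ((cover f).f j) ≫ (cover f).f i) x = a at hi hj
    obtain ⟨l, hli, hlj, hl⟩ := exists_le_of_mem hi hj
    obtain ⟨y, hy⟩ : a ∈ Set.range l.isAffineOpen_V.fromSpec := by
      rw [IsAffineOpen.range_fromSpec]; exact hl
    refine ⟨l, homOfLE hli, homOfLE hlj, y, ?_⟩
    apply (pullback.fst ((cover f).f i) ((cover f).f j) ≫ (cover f).f i).isOpenEmbedding.injective
    rw [ha, ← hy, ← Scheme.Hom.comp_apply, pullback.lift_fst_assoc]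
    exact congrArg (fun g : Spec Γ(X, l.V) ⟶ X ↦ g y) (IsAffineOpen.map_fromSpec _ _ _)
  property_trans {i j} h := by
    have : IsOpenImmersion (Spec.map (X.presheaf.map (homOfLE (leOfHom h).1).op) ≫
        (Chart.isAffineOpen_V j).fromSpec) := by
      rw [IsAffineOpen.map_fromSpec _ (Chart.isAffineOpen_V i)]
      infer_instance
    exact IsOpenImmersion.of_comp _ (Chart.isAffineOpen_V j).fromSpec

variable (f) in
/-- The gluing data of the relative spectrum of `Sym (T_{X/Y})` over `X`: over a chart it is
the spectrum of the symmetric algebra on the relative vector fields. -/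
def glueData [Smooth f] : (cover f).RelativeGluingData where
  functor :=
    { obj := fun i ↦ Spec (.of (Chart.ring i))
      map := fun {i j} h ↦ Spec.map (CommRingCat.ofHom (restrict (leOfHom h)))
      map_id := fun i ↦ by
        rw [← Spec.map_id]
        exact congrArg (fun g ↦ Spec.map (CommRingCat.ofHom g)) (restrict_self i)
      map_comp := fun {i j l} h h' ↦ by
        rw [← Spec.map_comp, ← CommRingCat.ofHom_comp, restrict_comp_restrict] }
  natTrans :=
    { app := fun i ↦ Spec.map (CommRingCat.ofHom (algebraMap (Chart.B i) (Chart.ring i)))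
      naturality := fun i j h ↦
        (isPullback_SpecMap_of_isPushout _ _ _ _ (isPushout_restrict (leOfHom h))).w.symm }
  equifibered := fun i j h ↦
    (isPullback_SpecMap_of_isPushout _ _ _ _ (isPushout_restrict (leOfHom h))).flip

end Chart

variable [Smooth f]

instance : Quiver.IsThin (Chart.cover f).I₀ := inferInstanceAs (Quiver.IsThin (Chart f))

instance : Small.{u} (Chart.cover f).I₀ := inferInstanceAs (Small.{u} (Chart f))

instance : ((Chart.glueData f).functor ⋙ Scheme.forget).IsLocallyDirected :=
  Scheme.Cover.RelativeGluingData.instIsLocallyDirectedI₀CompFunctorForgetOfIsThin ..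

/-- The total space of the relative cotangent bundle `T^*(f)` of a smooth morphism `f : X ⟶ Y`. -/
def cotangent : Scheme.{u} := (Chart.glueData f).glued

/-- The bundle projection `T^*(f) ⟶ X`. -/
def cotangentToBase : cotangent f ⟶ X := (Chart.glueData f).toBase

/-- The cotangent bundle over a chart, as an open subscheme of the cotangent bundle. -/
def cotangentChart (i : Chart f) : Spec (.of i.ring) ⟶ cotangent f :=
  (Chart.glueData f).cover.f i

lemma cotangentChart_toBase (i : Chart f) : cotangentChart f i ≫ cotangentToBase f =
    Spec.map (CommRingCat.ofHom (algebraMap i.B i.ring)) ≫ i.isAffineOpen_V.fromSpec :=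
  (Chart.glueData f).ι_toBase i

instance (i : Chart f) : IsOpenImmersion (cotangentChart f i) :=
  (Chart.glueData f).cover.map_prop i

lemma map_restrict_cotangentChart {i j : Chart f} (h : i ≤ j) :
    Spec.map (CommRingCat.ofHom (Chart.restrict h)) ≫ cotangentChart f j = cotangentChart f i :=
  colimit.w (Chart.glueData f).functor (homOfLE h)

lemma range_cotangentChart (i : Chart f) :
    Set.range (cotangentChart f i) = cotangentToBase f ⁻¹' i.V := by
  have := (Chart.glueData f).preimage_toBase_eq_range_ι i
  rw [IsAffineOpen.range_fromSpec] at this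
  exact this.symm

end Charts

section Projection

variable {X Y Z : Scheme.{u}} (f : X ⟶ Y) (g : Y ⟶ Z) [IsAffine Z]

namespace Chart

variable {f}

/-- A chart of `f : X ⟶ Y`, regarded as a chart of `X ⟶ Y ⟶ Z` with `Z` affine. -/
@[simps]
def comp (i : Chart f) : Chart (f ≫ g) where
  V := i.V
  isAffineOpen_V := i.isAffineOpen_V
  U := ⊤
  isAffineOpen_U := isAffineOpen_top Z
  le := le_top

lemma comp_mono {i j : Chart f} (h : i ≤ j) : i.comp g ≤ j.comp g := ⟨h.1, le_rfl⟩

/-- The map on functions `Sym (T_{X/Y}) → Sym (T_{X/Z})` over a chart, induced by the inclusion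
of vector fields. -/
def proj (i : Chart f) : i.ring →+* (i.comp g).ring :=
  letI : Algebra Γ(Z, ⊤) i.A := (g.appLE ⊤ i.U le_top).hom.toAlgebra
  letI : Algebra Γ(Z, ⊤) i.B := inferInstanceAs (Algebra (i.comp g).A (i.comp g).B)
  haveI : IsScalarTower Γ(Z, ⊤) i.A i.B := .of_algebraMap_eq' (congrArg CommRingCat.Hom.hom
    (Scheme.Hom.appLE_comp_appLE f g ⊤ i.U i.V le_top i.le).symm)
  CotangentRing.ofTower Γ(Z, ⊤) i.A i.B

lemma proj_algebraMap (i : Chart f) (b : i.B) :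
    i.proj g (algebraMap i.B i.ring b) = algebraMap (i.comp g).B (i.comp g).ring b := by
  let _ : Algebra Γ(Z, ⊤) i.A := (g.appLE ⊤ i.U le_top).hom.toAlgebra
  let _ : Algebra Γ(Z, ⊤) i.B := inferInstanceAs (Algebra (i.comp g).A (i.comp g).B)
  have : IsScalarTower Γ(Z, ⊤) i.A i.B := .of_algebraMap_eq' (congrArg CommRingCat.Hom.hom
    (Scheme.Hom.appLE_comp_appLE f g ⊤ i.U i.V le_top i.le).symm)
  exact CotangentRing.ofTower_algebraMap Γ(Z, ⊤) i.A i.B b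

lemma exists_proj_ι (i : Chart f) (v : VectorField i.A i.B) :
    ∃ w : VectorField (i.comp g).A (i.comp g).B,
      i.proj g (SymmetricAlgebra.ι _ _ v) = SymmetricAlgebra.ι _ _ w ∧
      ∀ b : i.B, w (KaehlerDifferential.D (i.comp g).A (i.comp g).B b) =
        v (KaehlerDifferential.D i.A i.B b) := by
  let _ : Algebra Γ(Z, ⊤) i.A := (g.appLE ⊤ i.U le_top).hom.toAlgebra
  let _ : Algebra Γ(Z, ⊤) i.B := inferInstanceAs (Algebra (i.comp g).A (i.comp g).B)
  have : IsScalarTower Γ(Z, ⊤) i.A i.B := .of_algebraMap_eq' (congrArg CommRingCat.Hom.hom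
    (Scheme.Hom.appLE_comp_appLE f g ⊤ i.U i.V le_top i.le).symm)
  refine ⟨VectorField.ofTower Γ(Z, ⊤) i.A i.B v,
    CotangentRing.ofTower_ι Γ(Z, ⊤) i.A i.B v, fun b ↦ ?_⟩
  exact congrArg v (KaehlerDifferential.map_D Γ(Z, ⊤) i.A i.B i.B b)

lemma restrict_comp_proj {i j : Chart f} (h : i ≤ j) :
    (restrict (comp_mono g h)).comp (j.proj g) = (i.proj g).comp (restrict h) := by
  refine CotangentRing.ringHom_ext _ _ (fun b ↦ ?_) (fun v ↦ ?_)
  · rw [RingHom.comp_apply, RingHom.comp_apply, proj_algebraMap, restrict_algebraMap h]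
    exact (restrict_algebraMap (comp_mono g h) b).trans (proj_algebraMap g i _).symm
  · rw [RingHom.comp_apply, RingHom.comp_apply, restrict_ι]
    obtain ⟨w, hw, hw'⟩ := exists_proj_ι g j v
    obtain ⟨w₂, hw₂, hw₂'⟩ := exists_proj_ι g i (restrictVF h v)
    rw [hw, hw₂, restrict_ι]
    congr 1
    refine ((eq_restrictVF_iff (comp_mono g h) w w₂).mpr fun b ↦ ?_).symm
    exact (hw₂' _).trans (((eq_restrictVF_iff h v _).mp rfl b).trans
      (congrArg (resB h) (hw' b).symm))

end Chart

variable [Smooth f] [Smooth (f ≫ g)]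

/-- The open cover of `T^*(f ≫ g)` by its restrictions to the charts of `f`. -/
abbrev projCover : (cotangent (f ≫ g)).OpenCover where
  I₀ := Chart f
  X i := Spec (.of (i.comp g).ring)
  f i := cotangentChart (f ≫ g) (i.comp g)
  mem₀ := by
    rw [Scheme.presieve₀_mem_precoverage_iff]
    refine ⟨fun x ↦ ?_, fun i ↦ inferInstance⟩
    obtain ⟨i, y, hy⟩ := (Chart.cover f).exists_eq (cotangentToBase (f ≫ g) x)
    refine ⟨i, ?_⟩
    rw [range_cotangentChart]
    have : cotangentToBase (f ≫ g) x ∈ Set.range i.isAffineOpen_V.fromSpec := ⟨y, hy⟩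
    rwa [IsAffineOpen.range_fromSpec] at this

instance : (projCover f g).LocallyDirected where
  trans {i j} h := Spec.map (CommRingCat.ofHom (Chart.restrict (Chart.comp_mono g (leOfHom h))))
  trans_id i := by
    rw [← Spec.map_id]
    exact congrArg (fun g ↦ Spec.map (CommRingCat.ofHom g)) (Chart.restrict_self (i.comp g))
  trans_comp {i j l} h h' := by
    rw [← Spec.map_comp, ← CommRingCat.ofHom_comp, Chart.restrict_comp_restrict]
  w {i j} h := map_restrict_cotangentChart (f ≫ g) (Chart.comp_mono g (leOfHom h))
  directed {i j} x := by
    have hi : (pullback.fst ((projCover f g).f i) ((projCover f g).f j) ≫ (projCover f g).f i) x ∈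
        Set.range (cotangentChart (f ≫ g) (Chart.comp g i)) :=
      ⟨pullback.fst ((projCover f g).f i) ((projCover f g).f j) x, rfl⟩
    have hj : (pullback.fst ((projCover f g).f i) ((projCover f g).f j) ≫ (projCover f g).f i) x ∈
        Set.range (cotangentChart (f ≫ g) (Chart.comp g j)) := by
      rw [pullback.condition]
      exact ⟨pullback.snd ((projCover f g).f i) ((projCover f g).f j) x, rfl⟩
    generalize ha : (pullback.fst ((projCover f g).f i) ((projCover f g).f j) ≫
      (projCover f g).f i) x = a at hi hj
    rw [range_cotangentChart] at hi hj
    obtain ⟨l, hli, hlj, hl⟩ := Chart.exists_le_of_mem (i := i) (j := j) hi hj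
    obtain ⟨y, hy⟩ : a ∈ Set.range (cotangentChart (f ≫ g) (l.comp g)) := by
      rw [range_cotangentChart]; exact hl
    refine ⟨l, homOfLE hli, homOfLE hlj, y, ?_⟩
    apply (pullback.fst ((projCover f g).f i) ((projCover f g).f j) ≫
      (projCover f g).f i).isOpenEmbedding.injective
    rw [ha, ← hy, ← Scheme.Hom.comp_apply, pullback.lift_fst_assoc]
    exact congrArg (fun h : Spec (.of (l.comp g).ring) ⟶ cotangent (f ≫ g) ↦ h y)
      (map_restrict_cotangentChart (f ≫ g) (Chart.comp_mono g hli))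
  property_trans {i j} h := by
    have : IsOpenImmersion (Spec.map (CommRingCat.ofHom
        (Chart.restrict (Chart.comp_mono g (leOfHom h)))) ≫
        cotangentChart (f ≫ g) (j.comp g)) := by
      rw [map_restrict_cotangentChart]
      infer_instance
    exact IsOpenImmersion.of_comp _ (cotangentChart (f ≫ g) (j.comp g))

lemma trans_proj_cotangentChart {i j : (projCover f g).I₀} (h : i ⟶ j) :
    (projCover f g).trans h ≫ Spec.map (CommRingCat.ofHom (Chart.proj g j)) ≫ cotangentChart f j =
      Spec.map (CommRingCat.ofHom (Chart.proj g i)) ≫ cotangentChart f i := by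
  rw [← map_restrict_cotangentChart f (leOfHom h), ← Spec.map_comp_assoc,
    ← CommRingCat.ofHom_comp, ← Chart.restrict_comp_proj, CommRingCat.ofHom_comp,
    Spec.map_comp_assoc]
  rfl

/-- The bundle map `p : T^*(f ≫ g) ⟶ T^*(f)`, for `f : X ⟶ Y` and `g : Y ⟶ Z` with `Z` affine,
restricting covectors to the tangent directions relative to `Y`: over charts it is the spectrum of
`Sym (T_{X/Y}) → Sym (T_{X/Z})`. -/
def cotangentProj : cotangent (f ≫ g) ⟶ cotangent f :=
  (projCover f g).glueMorphismsOfLocallyDirected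
    (fun i ↦ Spec.map (CommRingCat.ofHom (Chart.proj g i)) ≫ cotangentChart f i)
    (trans_proj_cotangentChart f g)

lemma cotangentChart_proj (i : Chart f) :
    cotangentChart (f ≫ g) (i.comp g) ≫ cotangentProj f g =
      Spec.map (CommRingCat.ofHom (i.proj g)) ≫ cotangentChart f i :=
  (projCover f g).map_glueMorphismsOfLocallyDirected _ (trans_proj_cotangentChart f g) i

end Projection

section Conic

variable {X Y : Scheme.{u}} {f : X ⟶ Y}

open LaurentPolynomial in
/-- The coaction `Sym (T) → Sym (T)[t, t⁻¹]`, `v ↦ t v`, of the action of `𝔾ₘ` scaling the fibres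
of the cotangent bundle over a chart. -/
def Chart.scaling (i : Chart f) : i.ring →+* i.ring[T;T⁻¹] :=
  (SymmetricAlgebra.lift (LinearMap.mulRight i.B (T 1 : i.ring[T;T⁻¹]) ∘ₗ
    (Algebra.linearMap i.ring i.ring[T;T⁻¹]).restrictScalars i.B ∘ₗ
      SymmetricAlgebra.ι i.B (VectorField i.A i.B))).toRingHom

open LaurentPolynomial in
lemma Chart.scaling_ι (i : Chart f) (v : VectorField i.A i.B) :
    i.scaling (SymmetricAlgebra.ι _ _ v) = C (SymmetricAlgebra.ι _ _ v) * T 1 :=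
  SymmetricAlgebra.lift_ι_apply _ _

open LaurentPolynomial in
lemma Chart.scaling_algebraMap (i : Chart f) (b : i.B) :
    i.scaling (algebraMap _ _ b) = C (algebraMap _ _ b) :=
  AlgHom.commutes _ b

variable [Smooth f]

/-- A closed subset of the relative cotangent bundle is conic if it is stable under the action of
`𝔾ₘ` scaling the fibres: its inverse images under the action map and under the projection
`𝔾ₘ × T^*(f) ⟶ T^*(f)` agree (the charts of `T^*(f)` are stable under the action). -/
def IsConic (Z : TopologicalSpace.Closeds (cotangent f)) : Prop :=
  ∀ i : Chart f,
    (Spec.map (CommRingCat.ofHom i.scaling) ≫ cotangentChart f i) ⁻¹' (Z : Set (cotangent f)) =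
      (Spec.map (CommRingCat.ofHom LaurentPolynomial.C) ≫ cotangentChart f i) ⁻¹'
        (Z : Set (cotangent f))

end Conic

section Closed

/-- The irreducible components of a subset of a topological space. -/
def components {T : Type*} [TopologicalSpace T] (Z : Set T) : Set (Set T) :=
  {C | Maximal (fun C' ↦ IsIrreducible C' ∧ C' ⊆ Z) C}

/-- A closed subset of a scheme with its reduced induced scheme structure. -/
abbrev reduced {W : Scheme.{u}} (Z : TopologicalSpace.Closeds W) : Scheme.{u} :=
  (Scheme.IdealSheafData.vanishingIdeal Z).subscheme

/-- The closed immersion of a closed subset with its reduced structure. -/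
abbrev reducedι {W : Scheme.{u}} (Z : TopologicalSpace.Closeds W) : reduced Z ⟶ W :=
  (Scheme.IdealSheafData.vanishingIdeal Z).subschemeι

/-- The morphism `w` is smooth in a neighbourhood of the point `x`. -/
def IsSmoothPoint {W T : Scheme.{u}} (w : W ⟶ T) (x : W) : Prop :=
  ∃ U : W.Opens, x ∈ U ∧ Smooth (U.ι ≫ w)

end Closed

section Symplectic

variable {X Y : Scheme.{u}} {f : X ⟶ Y}

/-- Coordinates `x₁, …, xₙ` of `X` relative to `Y` on a chart: functions whose differentials form
a basis of the module of relative differentials. -/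
structure Chart.Coordinates (i : Chart f) (n : ℕ) where
  x : Fin n → i.B
  basis : Module.Basis (Fin n) i.B (Ω[i.B⁄i.A])
  basis_apply (j : Fin n) : basis j = KaehlerDifferential.D i.A i.B (x j)

namespace Chart.Coordinates

variable {i : Chart f} {n : ℕ} (c : i.Coordinates n)

/-- The coordinate `xⱼ`, as a function on the cotangent bundle over the chart. -/
def position (j : Fin n) : i.ring := algebraMap i.B i.ring (c.x j)

/-- The momentum `ξⱼ`, i.e. the coordinate vector field `∂/∂xⱼ` regarded as a function on the
cotangent bundle over the chart. -/
def momentum (j : Fin n) : i.ring := SymmetricAlgebra.ι i.B _ (c.basis.coord j)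

/-- The value of the canonical symplectic form `ω = ∑ⱼ dξⱼ ∧ dxⱼ` on two tangent vectors of the
cotangent bundle at a `K`-point, given as `K[ε]`-points. -/
def symplecticForm {K : Type u} [Field K] (φ₁ φ₂ : i.ring →+* DualNumber K) : K :=
  ∑ j, ((φ₁ (c.momentum j)).snd * (φ₂ (c.position j)).snd -
    (φ₂ (c.momentum j)).snd * (φ₁ (c.position j)).snd)

end Chart.Coordinates

/-- The tangent vectors, at a `K`-point, of a scheme `w : W ⟶ Spec K` over `K`: the morphisms
`Spec K[ε] ⟶ W` over `K`. -/
structure TangentVector {K : Type u} [Field K] {W : Scheme.{u}} (w : W ⟶ Spec (.of K)) where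
  hom : Spec (.of (DualNumber K)) ⟶ W
  hom_comp : hom ≫ w = Spec.map (CommRingCat.ofHom (algebraMap K (DualNumber K)))

/-- The `K`-point at which a tangent vector is attached. -/
def TangentVector.point {K : Type u} [Field K] {W : Scheme.{u}} {w : W ⟶ Spec (.of K)}
    (v : TangentVector w) : Spec (.of K) ⟶ W :=
  Spec.map (CommRingCat.ofHom (TrivSqZeroExt.fstHom K K K).toRingHom) ≫ v.hom

variable (f) [Smooth f]

/-- Let `w : W ⟶ Spec K` be a scheme locally of finite type over an algebraically closed field `K`,
with a morphism `h : W ⟶ T^*(f)` lying over a geometric point `Spec K ⟶ Y`. The pullback to `W` of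
the canonical (relative) symplectic form vanishes on the smooth locus of `W` over `K`: it vanishes
on all pairs of tangent vectors of `W` at smooth `K`-points. -/
def SymplecticFormVanishes {K : Type u} [Field K] {W : Scheme.{u}} (w : W ⟶ Spec (.of K))
    (h : W ⟶ cotangent f) : Prop :=
  ∀ v₁ v₂ : TangentVector w, v₁.point = v₂.point →
    (∀ t, IsSmoothPoint w (v₁.point t)) →
    ∀ (i : Chart f) (n : ℕ) (c : i.Coordinates n) (φ₁ φ₂ : i.ring →+* DualNumber K),
      Spec.map (CommRingCat.ofHom φ₁) ≫ cotangentChart f i = v₁.hom ≫ h →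
      Spec.map (CommRingCat.ofHom φ₂) ≫ cotangentChart f i = v₂.hom ≫ h →
      c.symplecticForm φ₁ φ₂ = 0

end Symplectic

section Lagrangian

/-- A closed subset `Z` of the cotangent bundle `T^*X` of a smooth scheme `f : X ⟶ Spec K` over an
algebraically closed field, with its reduced structure, is Lagrangian: the canonical symplectic
form vanishes on its smooth locus and it is equidimensional of the dimension of `X`. -/
structure IsLagrangian {K : Type u} [Field K] {X : Scheme.{u}} (f : X ⟶ Spec (.of K)) [Smooth f]
    (Z : TopologicalSpace.Closeds (cotangent f)) : Prop where
  isotropic : SymplecticFormVanishes f (reducedι Z ≫ cotangentToBase f ≫ f) (reducedι Z)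
  dim_eq : ∀ C ∈ components (Z : Set (cotangent f)), topologicalKrullDim C = topologicalKrullDim X

variable {X Y : Scheme.{u}} (f : X ⟶ Y) [Smooth f]

section Fibre

variable {K : Type u} [Field K] (s : Spec (.of K) ⟶ Y)

/-- The fibre of `T^*(f)` over a geometric point `s` of `Y`; this is the cotangent bundle of the
geometric fibre `X_s` of `f`, and its symplectic form is induced from the relative symplectic form
of `T^*(f)`. -/
abbrev cotangentFibre : Scheme.{u} := pullback (cotangentToBase f ≫ f) s

/-- The fibre `Z_s = Z ∩ T^*(X_s)` of a closed subset of `T^*(f)` over a geometric point `s`. -/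
def fibre (Z : TopologicalSpace.Closeds (cotangent f)) :
    TopologicalSpace.Closeds (cotangentFibre f s) :=
  Z.preimage (pullback.fst (cotangentToBase f ≫ f) s).continuous

/-- The fibre `Z_s`, with its reduced structure, is a Lagrangian in `T^*(X_s)`. -/
structure IsFibreLagrangian (Z : TopologicalSpace.Closeds (cotangent f)) : Prop where
  isotropic : SymplecticFormVanishes f
    (reducedι (fibre f s Z) ≫ pullback.snd (cotangentToBase f ≫ f) s)
    (reducedι (fibre f s Z) ≫ pullback.fst (cotangentToBase f ≫ f) s)
  dim_eq : ∀ C ∈ components (fibre f s Z : Set (cotangentFibre f s)),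
    topologicalKrullDim C = topologicalKrullDim (pullback f s : Scheme.{u})

end Fibre

/-- A closed subset `Z` of `T^*(f)`, with its reduced structure, is a relative Lagrangian: its
fibres over all geometric points of `Y` are Lagrangian, and it is equidimensional of the dimension
of `X`. -/
structure IsRelativeLagrangian (Z : TopologicalSpace.Closeds (cotangent f)) : Prop where
  fibre_isLagrangian : ∀ (K : Type u) [Field K] [IsAlgClosed K] (s : Spec (.of K) ⟶ Y),
    IsFibreLagrangian f s Z
  dim_eq : ∀ C ∈ components (Z : Set (cotangent f)), topologicalKrullDim C = topologicalKrullDim X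

/-- The shadow of a closed subset of `T^*(f)`: the images in `X` of the generic points of its
irreducible components. -/
def shadow (Z : TopologicalSpace.Closeds (cotangent f)) : Set X :=
  {x | ∃ C ∈ components (Z : Set (cotangent f)), ∃ η, IsGenericPoint η C ∧ cotangentToBase f η = x}

end Lagrangian

section Lifting

variable {k : Type u} [Field k] {M S : Scheme.{u}} (π : M ⟶ S) (σ : S ⟶ Spec (.of k))
  [Smooth π] [Smooth σ]

/-- `L ⊆ T^*M` is a lifting of `Lrel ⊆ T^*(π)`, with `p : T^*M ⟶ T^*(π)` the projection: `L` is a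
closed conic Lagrangian, `p(L)` is contained and dense in `Lrel`, and every irreducible component
of `L` dominates an irreducible component of `Lrel`. -/
structure IsLifting (Lrel : TopologicalSpace.Closeds (cotangent π))
    (L : TopologicalSpace.Closeds (cotangent (π ≫ σ))) : Prop where
  isConic : IsConic L
  isLagrangian : IsLagrangian (π ≫ σ) L
  image_subset : cotangentProj π σ '' (L : Set (cotangent (π ≫ σ))) ⊆ Lrel
  dense : (Lrel : Set (cotangent π)) ⊆
    closure (cotangentProj π σ '' (L : Set (cotangent (π ≫ σ))))
  dominates : ∀ C ∈ components (L : Set (cotangent (π ≫ σ))),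
    closure (cotangentProj π σ '' C) ∈ components (Lrel : Set (cotangent π))

/-- The projection `p` restricts to a morphism `L ⟶ Lrel` (of reduced schemes) which is an
isomorphism over a dense open subset of `Lrel`. -/
def IsIsoOverDenseOpen (Lrel : TopologicalSpace.Closeds (cotangent π))
    (L : TopologicalSpace.Closeds (cotangent (π ≫ σ))) : Prop :=
  ∃ r : reduced L ⟶ reduced Lrel, r ≫ reducedι Lrel = reducedι L ≫ cotangentProj π σ ∧
    ∃ U : (reduced Lrel).Opens, Dense (U : Set (reduced Lrel)) ∧ IsIso (r ∣_ U)

end Lifting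

end

end RelCotangent

/-! Everything is read off at the generic points of irreducible components, and differential forms
are evaluated on derivations of residue fields. Let η be a generic point of Λ^rel with image t in S,
let x_j be coordinates of M over S with momenta ξ_j, and let y_i be coordinates of S over k.

Contracting the symplectic form with the direction of scaling gives the Liouville form λ = ∑ ξ_j
dx_j. Hence λ vanishes at the generic points of a conic isotropic subset (`IsConic.isNull`).
Isotropy is given only at smooth closed points, of Λ or of the geometric fibres of Λ^rel. It is
carried to generic points by generic smoothness and the Nullstellensatz
(`symplectic_eq_zero_of_isSmoothPoint`, `IsRelativeLagrangian.isIsotropic`).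

A κ(η)-valued point of T^*M over η is a covector ∑ ξ_j dx_j + ∑ z_i dy_i; call it null if it
vanishes on all derivations of κ(η) over k. Null lifts exist: λ vanishes on the derivations killing
all y_i, so on derivations over k it is a combination of the dy_i (`exists_lift_liouville`). They
are unique if derivations dual to the y_i exist on κ(η) (`eq_of_liouville`, `eq_of_isNull`). This
follows from a dimension count: the component has dimension m and the components of the fibres have
dimension m - d, so t has transcendence degree at least d = dim S (`le_ptDim_of_mem_maxPts`). The
same count makes t a generic point of S.

The lifting Λ is the closure of the null lifts, which are exactly its generic points
(`maxPts_lifting`). It is isotropic because ω = dλ (`symplecticFormVanishes_of_isNull`), it has the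
right dimension because the residue fields are those of Λ^rel, and it is conic because a rescaled
null lift is again a null lift (`ker_le_ker_scale_of_isNull`). The generic points of any other
lifting are null and lie over generic points of Λ^rel, so they are the same points
(`IsLifting.eq_lifting`). Finally, equality of residue fields at generic points spreads out to an
isomorphism over a dense open subset (`exists_isIso_morphismRestrict`). -/

namespace RelCotangent

/-! ### Derivations of fields of characteristic zero. -/

noncomputable section

section Derivations

/-- The derivation of `S` attached to a ring homomorphism `S → S[ε]` lifting a ring map. -/
def derivationOfDualNumber {S : Type*} [CommRing S] (f : S →+* DualNumber S)
    (hf : ∀ s, (f s).fst = s) : Derivation ℤ S S :=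
  Derivation.mk' (AddMonoidHom.toIntLinearMap
    { toFun := fun s ↦ (f s).snd
      map_zero' := by simp
      map_add' := by simp }) fun a b ↦ by
    simp [hf, mul_comm]

/-- Derivations extend along formally smooth algebras. -/
lemma exists_derivation_extension {R S : Type*} [CommRing R] [CommRing S] [Algebra R S]
    [Algebra.FormallySmooth R S] (D : Derivation ℤ R S) :
    ∃ D' : Derivation ℤ S S, ∀ r, D' (algebraMap R S r) = D r := by
  -- The derivation D is encoded as r ↦ r + ε D r, which makes S[ε] an R-algebra. An R-algebra
  -- section of S[ε] → S, whose kernel has square zero, is then the same as an extension of D.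
  let ψ : R →+* DualNumber S :=
    { toFun := fun r ↦ TrivSqZeroExt.inl (algebraMap R S r) + TrivSqZeroExt.inr (D r)
      map_one' := by simp
      map_zero' := by simp
      map_add' := fun x y ↦ by
        rw [map_add, map_add, TrivSqZeroExt.inl_add, TrivSqZeroExt.inr_add, add_add_add_comm]
      map_mul' := fun x y ↦ by
        rw [map_mul, D.leibniz, Algebra.smul_def, Algebra.smul_def]
        refine TrivSqZeroExt.ext ?_ ?_
        · simp
        · simp [mul_comm] }
  let _ : Algebra R (DualNumber S) := ψ.toAlgebra
  let g : DualNumber S →ₐ[R] S :=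
    { (TrivSqZeroExt.fstHom S S S).toRingHom with
      commutes' := fun r ↦ by
        change (ψ r).fst = _
        simp [ψ] }
  have hg : Function.Surjective g := fun s ↦ ⟨TrivSqZeroExt.inl s, rfl⟩
  have hk : IsNilpotent (RingHom.ker (g : DualNumber S →+* S)) := by
    refine ⟨2, ?_⟩
    rw [Ideal.zero_eq_bot, eq_bot_iff, sq (RingHom.ker (g : DualNumber S →+* S)), Ideal.mul_le]
    intro x hx y hy
    have hx' : x.fst = 0 := hx
    have hy' : y.fst = 0 := hy
    rw [Ideal.mem_bot]
    ext <;> simp [hx', hy']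
  let l := Algebra.FormallySmooth.liftOfSurjective (AlgHom.id R S) g hg hk
  have hl (s : S) : (l s).fst = s :=
    Algebra.FormallySmooth.liftOfSurjective_apply (AlgHom.id R S) g hg hk s
  refine ⟨derivationOfDualNumber l.toRingHom hl, fun r ↦ ?_⟩
  have := l.commutes r
  change (l (algebraMap R S r)).snd = D r
  rw [this]
  change (ψ r).snd = _
  simp [ψ]

/-- A purely transcendental extension followed by an algebraic one; the latter is separable in
characteristic zero. -/
lemma formallySmooth_of_charZero (F F' : Type*) [Field F] [Field F'] [CharZero F] [Algebra F F'] :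
    Algebra.FormallySmooth F F' := by
  obtain ⟨ι, v, hv⟩ := exists_isTranscendenceBasis' F F'
  have := hv.isAlgebraic_field
  have : Algebra.IsSeparable (IntermediateField.adjoin F (Set.range v)) F' := inferInstance
  exact .of_algebraicIndependent_of_isSeparable hv.1

/-- Derivations extend along field extensions in characteristic zero. -/
lemma exists_derivation_extension_field {F F' : Type*} [Field F] [Field F'] [CharZero F]
    (j : F →+* F') (D : Derivation ℤ F F) :
    ∃ D' : Derivation ℤ F' F', ∀ x, D' (j x) = j (D x) := by
  let _ := j.toAlgebra
  have := formallySmooth_of_charZero F F'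
  let D₁ : Derivation ℤ F F' := (Algebra.linearMap F F').compDer D
  exact exists_derivation_extension D₁

/-- Differentiating p(x) = 0 for the minimal polynomial p gives p'(x) D x = 0, and p'(x) ≠ 0 by
separability. -/
lemma derivation_eq_zero_of_isAlgebraic {K F : Type*} [Field K] [Field F] [CharZero K] [Algebra K F]
    (D : Derivation ℤ F F) (hD : ∀ a : K, D (algebraMap K F a) = 0) {x : F}
    (hx : IsAlgebraic K x) : D x = 0 := by
  let D' : Derivation K F F :=
    { toLinearMap := 
        { toFun := D, map_add' := by simp, map_smul' := fun a x ↦ by simp [Algebra.smul_def, hD] }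
      map_one_eq_zero' := by simp
      leibniz' := by simp }
  have hs : (minpoly K x).Separable := (minpoly.irreducible hx.isIntegral).separable
  have h := D'.map_aeval (minpoly K x) x
  rw [minpoly.aeval, map_zero] at h
  have h0 := hs.aeval_derivative_ne_zero (minpoly.aeval K x)
  have h1 : D' x = 0 := by simpa [h0] using h.symm
  exact h1

lemma derivation_sum_apply {R A M : Type*} [CommRing R] [CommRing A] [Algebra R A]
    [AddCommGroup M] [Module A M] [Module R M] {ι : Type*} (s : Finset ι)
    (D : ι → Derivation R A M) (a : A) : (∑ i ∈ s, D i) a = ∑ i ∈ s, D i a := by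
  have := congrFun (map_sum Derivation.coeFnAddMonoidHom D s) a
  rwa [Finset.sum_apply] at this

/-- The partial derivative ∂/∂X_i of the polynomial ring extends along K[X] → Frac K[X] → F, both
steps being formally smooth. -/
lemma exists_derivation_of_algebraicIndependent {K F : Type*} [Field K] [Field F] [CharZero K]
    [Algebra K F] {ι : Type*} [DecidableEq ι] {v : ι → F} (hv : AlgebraicIndependent K v) (i : ι) :
    ∃ D : Derivation ℤ F F, (∀ a, D (algebraMap K F a) = 0) ∧
      ∀ j, D (v j) = if j = i then 1 else 0 := by
  let R := MvPolynomial ι K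
  let _ : Algebra R F := (MvPolynomial.aeval v).toAlgebra
  have : FaithfulSMul R F := (faithfulSMul_iff_algebraMap_injective R F).mpr hv
  let _ := FractionRing.liftAlgebra R F
  have : CharZero (FractionRing R) :=
    charZero_of_injective_algebraMap (IsFractionRing.injective R (FractionRing R))
  have := formallySmooth_of_charZero (FractionRing R) F
  have : Algebra.FormallySmooth R (FractionRing R) := .of_isLocalization (nonZeroDivisors R)
  have : Algebra.FormallySmooth R F := .comp R (FractionRing R) F
  obtain ⟨D, hD⟩ := exists_derivation_extension (R := R) (S := F)
    ((Algebra.linearMap R F).compDer ((MvPolynomial.pderiv i).restrictScalars ℤ))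
  have hD (r : R) : D (algebraMap R F r) = algebraMap R F (MvPolynomial.pderiv i r) := hD r
  have e (p : R) : algebraMap R F p = MvPolynomial.aeval v p := rfl
  refine ⟨D, fun a ↦ ?_, fun j ↦ ?_⟩
  · have := hD (MvPolynomial.C a)
    rw [e, MvPolynomial.aeval_C] at this
    rw [this]
    have h : MvPolynomial.pderiv i (MvPolynomial.C a : R) = 0 := MvPolynomial.pderiv_C
    rw [h, map_zero]
  · have := hD (MvPolynomial.X j)
    rw [e, MvPolynomial.aeval_X] at this
    rw [this, show MvPolynomial.pderiv i (MvPolynomial.X j : R) = _ from MvPolynomial.pderiv_X i j,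
      Pi.single_apply]
    split_ifs <;> simp_all

/-- The hypothesis `hy` says that the dy_i span the differentials of F over K. A linear relation
between the rows is a combination of the D_i killing every y_j, hence zero; its value at v_i is the
i-th coefficient. -/
lemma linearIndependent_derivation {K F : Type*} [Field K] [Field F]
    [Algebra K F] {d : ℕ} (y : Fin d → F)
    (hy : ∀ D : Derivation ℤ F F, (∀ a, D (algebraMap K F a) = 0) → (∀ i, D (y i) = 0) → D = 0)
    {ι : Type*} [DecidableEq ι] {v : ι → F}
    (D : ι → Derivation ℤ F F) (hD : ∀ i a, D i (algebraMap K F a) = 0)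
    (hDv : ∀ i j, D i (v j) = if j = i then 1 else 0) :
    LinearIndependent F fun i ↦ (fun j ↦ D i (y j) : Fin d → F) := by
  rw [linearIndependent_iff']
  intro s g hg i hi
  have h0 : ∑ l ∈ s, g l • D l = 0 := by
    refine hy _ (fun a ↦ ?_) fun j ↦ ?_
    · simp [derivation_sum_apply, hD]
    · simpa [derivation_sum_apply] using congrFun hg j
  have := DFunLike.congr_fun h0 (v i)
  simpa [derivation_sum_apply, hDv, hi] using this

/-- The derivations dual to a transcendence basis have linearly independent rows of values in F^d.
-/
lemma trdeg_le_of_derivation {K F : Type*} [Field K] [Field F] [CharZero K]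
    [Algebra K F] {d : ℕ} (y : Fin d → F)
    (hy : ∀ D : Derivation ℤ F F, (∀ a, D (algebraMap K F a) = 0) → (∀ i, D (y i) = 0) → D = 0) : Algebra.trdeg K F ≤ d := by
  classical
  obtain ⟨s, hs⟩ := exists_isTranscendenceBasis K F
  choose D hD hDv using fun i ↦ exists_derivation_of_algebraicIndependent hs.1 i
  have := (linearIndependent_derivation y hy D hD hDv).cardinal_le_rank
  rw [← hs.cardinalMk_eq_trdeg]
  simpa using this

/-- The bound `hd` forces a transcendence basis to have exactly d elements. The values of its dual
derivations on the y_j then form a square matrix with independent rows, and the inverse matrix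
recombines them into derivations dual to y. -/
lemma exists_dual_derivation {K F : Type*} [Field K] [Field F] [CharZero K]
    [Algebra K F] {d : ℕ} (y : Fin d → F)
    (hy : ∀ D : Derivation ℤ F F, (∀ a, D (algebraMap K F a) = 0) → (∀ i, D (y i) = 0) → D = 0)
    (hd : (d : Cardinal) ≤ Algebra.trdeg K F) :
    ∃ D : Fin d → Derivation ℤ F F, (∀ i a, D i (algebraMap K F a) = 0) ∧
      ∀ i j, D i (y j) = if i = j then 1 else 0 := by
  classical
  obtain ⟨s, hs⟩ := exists_isTranscendenceBasis K F
  have hc : Cardinal.mk s = d :=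
    le_antisymm (hs.cardinalMk_eq_trdeg.trans_le (trdeg_le_of_derivation y hy))
      (hd.trans_eq hs.cardinalMk_eq_trdeg.symm)
  have e : Fin d ≃ s := by
    have : Finite s := Cardinal.lt_aleph0_iff_finite.mp (hc ▸ Cardinal.natCast_lt_aleph0)
    refine (Finite.equivFinOfCardEq ?_).symm
    rw [Nat.card, hc, Cardinal.toNat_natCast]
  choose D hD hDv using fun i ↦
    exists_derivation_of_algebraicIndependent (hs.1.comp e e.injective) i
  have hu := linearIndependent_derivation y hy D hD hDv
  let A : Matrix (Fin d) (Fin d) F := .of fun i j ↦ D i (y j)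
  have hA : IsUnit A := Matrix.linearIndependent_rows_iff_isUnit.mp hu
  have hA' := Matrix.nonsing_inv_mul A ((Matrix.isUnit_iff_isUnit_det A).mp hA)
  refine ⟨fun i ↦ ∑ l, A⁻¹ i l • D l, fun i a ↦ by simp [derivation_sum_apply, hD], fun i j ↦ ?_⟩
  have := congrFun (congrFun hA' i) j
  rw [Matrix.mul_apply, Matrix.one_apply] at this
  simpa [derivation_sum_apply, A] using this


end Derivations

end

/-! ### Derivations, nilpotents and minimal primes. -/

noncomputable section

/-- Differentiating b^(n+1) (Db)^m = 0 and multiplying by Db trades one power of b for two powers of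
Db, since n + 1 is invertible. Starting from b^N = 0 this ends with (Db)^(2N) = 0. -/
lemma isNilpotent_derivation {k B : Type*} [Field k] [CharZero k] [CommRing B] [Algebra k B]
    (D : Derivation ℤ B B) {b : B} (hb : IsNilpotent b) : IsNilpotent (D b) := by
  have key (n m : ℕ) (h : b ^ (n + 1) * D b ^ m = 0) : b ^ n * D b ^ (m + 2) = 0 := by
    have h1 := congrArg (fun z ↦ D z * D b) h
    simp only [D.leibniz, D.leibniz_pow, smul_eq_mul, nsmul_eq_mul, map_zero, zero_mul] at h1
    have h2 : ((n + 1 : ℕ) : B) * (b ^ n * D b ^ (m + 2)) = 0 := by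
      cases m with
      | zero => simp at h1 ⊢; linear_combination h1
      | succ m =>
        simp only [Nat.add_sub_cancel] at h1
        linear_combination h1 - ((m + 1 : ℕ) : B) * D (D b) * h
    have hu : IsUnit ((n + 1 : ℕ) : B) := by
      rw [← map_natCast (algebraMap k B)]
      exact (IsUnit.mk0 _ (Nat.cast_ne_zero.mpr n.succ_ne_zero)).map _
    exact hu.mul_right_eq_zero.mp h2
  obtain ⟨N, hN⟩ := hb
  have (j n : ℕ) (hj : j + n = N) : b ^ n * D b ^ (2 * j) = 0 := by
    induction j generalizing n with
    | zero => simp [← hN, ← hj]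
    | succ j ih => exact key n (2 * j) (ih (n + 1) (by omega))
  exact ⟨2 * N, by simpa using this N 0 (by simp)⟩

/-- After localising at p, the elements of p are nilpotent. So s b is nilpotent for some s outside
p, D(s b) lies in p, and the Leibniz rule leaves s D b in p. -/
lemma derivation_mem_minimalPrimes {k B : Type*} [Field k] [CharZero k] [CommRing B] [Algebra k B]
    (D : Derivation ℤ B B) {p : Ideal B} (hp : p ∈ minimalPrimes B) {b : B} (hb : b ∈ p) :
    D b ∈ p := by
  have := hp.1.1
  obtain ⟨s, hs, hsb⟩ : ∃ s, s ∉ p ∧ IsNilpotent (s * b) := by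
    have h := IsLocalization.AtPrime.radical_map_of_mem_minimalPrimes (Localization.AtPrime p) p ⊥ hp
    have hb' := Ideal.mem_map_of_mem (algebraMap B (Localization.AtPrime p)) hb
    rw [← h] at hb'
    obtain ⟨n, hn⟩ := hb'
    rw [Ideal.map_bot, Ideal.mem_bot, ← map_pow] at hn
    obtain ⟨s, hs⟩ := (IsLocalization.map_eq_zero_iff p.primeCompl _ _).mp hn
    refine ⟨s, s.2, n + 1, ?_⟩
    rw [mul_pow, pow_succ, pow_succ b]
    linear_combination (s : B) ^ n * b * hs
  have h1 : D (s * b) ∈ p := by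
    obtain ⟨n, hn⟩ := isNilpotent_derivation (k := k) D hsb
    exact this.mem_of_pow_mem n (hn ▸ p.zero_mem)
  rw [D.leibniz, smul_eq_mul, smul_eq_mul] at h1
  have h2 := (p.add_mem_iff_left (p.mul_mem_right (D s) hb)).mp h1
  exact (this.mem_or_mem h2).resolve_left hs

lemma derivation_eq_zero_of_isTranscendenceBasis {K F : Type*} [Field K] [Field F] [CharZero K]
    [Algebra K F] {ι : Type*} {v : ι → F} (hv : IsTranscendenceBasis K v) (D : Derivation ℤ F F)
    (hD : ∀ a : K, D (algebraMap K F a) = 0) (hDv : ∀ i, D (v i) = 0) : D = 0 := by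
  have h (a : IntermediateField.adjoin K (Set.range v)) : D (algebraMap _ F a) = 0 := by
    obtain ⟨a, ha⟩ := a
    change D a = 0
    induction ha using IntermediateField.adjoin_induction with
    | mem x hx => obtain ⟨i, rfl⟩ := hx; exact hDv i
    | algebraMap x => exact hD x
    | add x y _ _ hx hy => rw [map_add, hx, hy, add_zero]
    | inv x _ hx => rw [D.leibniz_inv, hx, smul_zero]
    | mul x y _ _ hx hy => rw [D.leibniz, hx, hy, smul_zero, smul_zero, add_zero]
  have := hv.isAlgebraic_field
  ext x
  exact derivation_eq_zero_of_isAlgebraic D h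
    (Algebra.IsAlgebraic.isAlgebraic (R := IntermediateField.adjoin K (Set.range v)) x)

/-- A derivation over K is determined by its values on a transcendence basis, so the m independent
D_i give m independent vectors indexed by that basis. -/
lemma le_trdeg_of_derivation {K F : Type*} [Field K] [Field F] [CharZero K] [Algebra K F] {m : ℕ}
    (x : Fin m → F) (D : Fin m → Derivation ℤ F F) (hD : ∀ i a, D i (algebraMap K F a) = 0)
    (hDx : ∀ i j, D i (x j) = if i = j then 1 else 0) : m ≤ Algebra.trdeg K F := by
  obtain ⟨s, hs⟩ := exists_isTranscendenceBasis K F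
  by_contra! hlt
  have : LinearIndependent F fun i ↦ (fun j : s ↦ D i j) := by
    rw [linearIndependent_iff']
    intro t g hg i hi
    have h0 : ∑ l ∈ t, g l • D l = 0 := by
      refine derivation_eq_zero_of_isTranscendenceBasis hs _ (fun a ↦ ?_) fun j ↦ ?_
      · simp [derivation_sum_apply, hD]
      · simpa [derivation_sum_apply] using congrFun hg j
    have := DFunLike.congr_fun h0 (x i)
    simpa [derivation_sum_apply, hDx, hi] using this
  rw [← hs.cardinalMk_eq_trdeg] at hlt
  have : Fintype s := (Cardinal.lt_aleph0_iff_fintype.mp (hlt.trans Cardinal.natCast_lt_aleph0)).some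
  have h := LinearIndependent.fintype_card_le_finrank ‹LinearIndependent F _›
  simp only [Module.finrank_fintype_fun_eq_card, Fintype.card_fin] at h
  rw [Cardinal.mk_fintype] at hlt
  exact absurd (Nat.cast_lt.mp hlt) (not_lt.mpr h)

lemma formallySmooth_of_injective {R F : Type*} [CommRing R] [IsDomain R] [Field F] [CharZero F]
    [Algebra R F] [FaithfulSMul R F] : Algebra.FormallySmooth R F := by
  let _ := FractionRing.liftAlgebra R F
  have : CharZero (FractionRing R) := (algebraMap (FractionRing R) F).charZero
  have := formallySmooth_of_charZero (FractionRing R) F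
  have : Algebra.FormallySmooth R (FractionRing R) := .of_isLocalization (nonZeroDivisors R)
  exact .comp R (FractionRing R) F

/-- By `hD` the derivation descends to the domain B / ker φ, and it extends to F because F is
formally smooth over this subring. -/
lemma exists_derivation_field {B F : Type*} [CommRing B] [Field F] [CharZero F] (φ : B →+* F)
    (D : Derivation ℤ B B) (hD : ∀ b, φ b = 0 → φ (D b) = 0) :
    ∃ D' : Derivation ℤ F F, ∀ b, D' (φ b) = φ (D b) := by
  have : (RingHom.ker φ).IsPrime := RingHom.ker_isPrime φ
  let _ : Algebra (B ⧸ RingHom.ker φ) F := (RingHom.kerLift φ).toAlgebra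
  have : FaithfulSMul (B ⧸ RingHom.ker φ) F :=
    (faithfulSMul_iff_algebraMap_injective _ F).mpr (RingHom.kerLift_injective φ)
  have := formallySmooth_of_injective (R := B ⧸ RingHom.ker φ) (F := F)
  let l : (B ⧸ RingHom.ker φ) →+ F := QuotientAddGroup.lift _ (φ.toAddMonoidHom.comp
    (D : B →ₗ[ℤ] B).toAddMonoidHom) fun b hb ↦ hD b hb
  let D₁ : Derivation ℤ (B ⧸ RingHom.ker φ) F := Derivation.mk' l.toIntLinearMap fun a b ↦ by
    obtain ⟨a, rfl⟩ := Ideal.Quotient.mk_surjective a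
    obtain ⟨b, rfl⟩ := Ideal.Quotient.mk_surjective b
    change φ (D (a * b)) = φ a * φ (D b) + φ b * φ (D a)
    simp
  obtain ⟨D', hD'⟩ := exists_derivation_extension D₁
  exact ⟨D', fun b ↦ hD' (Ideal.Quotient.mk _ b)⟩

/-- Coordinate vector fields preserve minimal primes, hence survive at the generic points of Spec B.
This bounds from below the dimension of every component of a smooth scheme. -/
lemma le_trdeg_of_minimalPrimes {k B F : Type*} [Field k] [CharZero k] [CommRing B] [Algebra k B]
    [Field F] [Algebra k F] (φ : B →ₐ[k] F) (hφ : RingHom.ker φ ∈ minimalPrimes B) {m : ℕ}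
    (x : Fin m → B) (D : Fin m → Derivation ℤ B B) (hD : ∀ i a, D i (algebraMap k B a) = 0)
    (hDx : ∀ i j, D i (x j) = if i = j then 1 else 0) : m ≤ Algebra.trdeg k F := by
  have : CharZero F := charZero_of_injective_algebraMap (algebraMap k F).injective
  choose D' hD' using fun i ↦ exists_derivation_field φ.toRingHom (D i)
    fun b hb ↦ derivation_mem_minimalPrimes (k := k) (D i) hφ hb
  refine le_trdeg_of_derivation (fun i ↦ φ (x i)) D' (fun i a ↦ ?_) fun i j ↦ ?_
  · rw [← φ.commutes]
    exact (hD' i _).trans (by simp [hD])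
  · refine (hD' i _).trans ?_
    rw [hDx]
    simp [apply_ite]

end

/-! ### Transcendence degrees of points and Krull dimension. -/

noncomputable section

open Algebra

section Trdeg

variable (K B : Type u) [Field K] [CommRing B] [IsDomain B] [Algebra K B] [Algebra.FiniteType K B]

/-- By Noether normalisation, B is integral over a polynomial ring in trdeg many variables, and
chains of primes lift by going up. -/
lemma trdeg_le_ringKrullDim : ((Cardinal.toENat (Algebra.trdeg K B) : ℕ∞) : WithBot ℕ∞) ≤
    ringKrullDim B := by
  obtain ⟨s, g, hg, hg'⟩ := exists_integral_inj_algHom_of_fg K B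
  let _ : Algebra (MvPolynomial (Fin s) K) B := g.toRingHom.toAlgebra
  have : IsScalarTower K (MvPolynomial (Fin s) K) B := .of_algebraMap_eq' g.comp_algebraMap.symm
  have : FaithfulSMul (MvPolynomial (Fin s) K) B :=
    (faithfulSMul_iff_algebraMap_injective _ B).mpr hg
  have : Algebra.IsIntegral (MvPolynomial (Fin s) K) B := ⟨hg'⟩
  have h1 := trdeg_add_eq K (MvPolynomial (Fin s) K) (A := B)
  rw [trdeg_eq_zero (R := MvPolynomial (Fin s) K), add_zero, MvPolynomial.trdeg_of_isDomain] at h1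
  rw [← h1]
  have h2 := MvPolynomial.ringKrullDim_of_isNoetherianRing (R := K) (ι := Fin s)
  rw [ringKrullDim_eq_zero_of_field, zero_add, Nat.card_fin] at h2
  refine Eq.trans_le (b := ringKrullDim (MvPolynomial (Fin s) K)) ?_ ?_
  · rw [h2]
    simp
  refine iSup_le fun l ↦ ?_
  obtain ⟨P, hP, hPl⟩ := Ideal.exists_ideal_over_prime_of_isIntegral_of_isDomain (S := B)
    l.head.asIdeal (by
      rw [(RingHom.injective_iff_ker_eq_bot (algebraMap (MvPolynomial (Fin s) K) B)).mp hg]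
      exact bot_le)
  have : P.LiesOver (RelSeries.head l).asIdeal := ⟨hPl.symm⟩
  obtain ⟨L, hL, -⟩ := Ideal.exists_ltSeries_of_hasGoingUp l P
  rw [← hL]
  exact Order.LTSeries.length_le_krullDim L

/-- If the degrees were equal, a lift v to B of a transcendence basis of B / q would be a
transcendence basis. A nonzero element of q would then divide a nonzero polynomial in v, giving an
algebraic relation modulo q. -/
lemma trdeg_quotient_lt (q : Ideal B) [q.IsPrime] (hq : q ≠ ⊥) :
    Algebra.trdeg K (B ⧸ q) < Algebra.trdeg K B := by
  have : FaithfulSMul K (B ⧸ q) :=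
    (faithfulSMul_iff_algebraMap_injective K (B ⧸ q)).mpr (algebraMap K (B ⧸ q)).injective
  obtain ⟨s, hs⟩ := exists_isTranscendenceBasis K (B ⧸ q)
  refine lt_of_le_of_ne (trdeg_le_of_surjective (Ideal.Quotient.mkₐ K q)
    Ideal.Quotient.mk_surjective) fun h ↦ ?_
  choose v hv using fun x : s ↦ Ideal.Quotient.mk_surjective (I := q) x.1
  have hvs : Ideal.Quotient.mkₐ K q ∘ v = Subtype.val := funext hv
  have hvi : AlgebraicIndependent K v :=
    AlgebraicIndependent.of_comp (Ideal.Quotient.mkₐ K q) (hvs ▸ hs.1)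
  have hfin : Finite s := by
    rw [← Cardinal.lt_aleph0_iff_finite, hs.cardinalMk_eq_trdeg, h]
    exact trdeg_lt_aleph0_of_finiteType
  have hvt : IsTranscendenceBasis K v := by
    refine hvi.isTranscendenceBasis_of_trdeg_le_of_finite ?_
    rw [← h, hs.cardinalMk_eq_trdeg]
  have := hvt.isAlgebraic
  obtain ⟨a, ha, ha0⟩ := q.ne_bot_iff.mp hq
  obtain ⟨⟨r, hr⟩, hr0, hra⟩ := (Algebra.IsAlgebraic.isAlgebraic
    (R := Algebra.adjoin K (Set.range v)) a).exists_nonzero_dvd (mem_nonZeroDivisors_of_ne_zero ha0)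
  rw [Algebra.adjoin_range_eq_range_aeval] at hr
  obtain ⟨p, rfl⟩ := hr
  have h0 : MvPolynomial.aeval v p ∈ q := q.mem_of_dvd hra ha
  have h1 : MvPolynomial.aeval (Subtype.val : s → B ⧸ q) p = 0 := by
    rw [← hvs]
    exact (MvPolynomial.comp_aeval_apply v (Ideal.Quotient.mkₐ K q) p).symm.trans
      (Ideal.Quotient.eq_zero_iff_mem.mpr h0)
  have h2 : p = 0 := hs.1 (h1.trans (map_zero _).symm)
  exact hr0 (Subtype.ext (by simp [h2]))

end Trdeg

/-- The transcendence degree of a field over a subfield given by a ring homomorphism. -/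
def trdegHom {K F : Type u} [Field K] [Field F] (f : K →+* F) : ℕ∞ :=
  letI := f.toAlgebra
  Cardinal.toENat (Algebra.trdeg K F)

lemma trdegHom_le {K F F' : Type u} [Field K] [Field F] [Field F'] (f : K →+* F) (g : F →+* F') :
    trdegHom f ≤ trdegHom (g.comp f) := by
  let _ := f.toAlgebra
  let _ := (g.comp f).toAlgebra
  let g' : F →ₐ[K] F' := { g with commutes' := fun _ ↦ rfl }
  exact Cardinal.toENat.monotone' (trdeg_le_of_injective g' g.injective)

lemma trdegHom_add {K F F' : Type u} [Field K] [Field F] [Field F'] (f : K →+* F) (g : F →+* F') :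
    trdegHom (g.comp f) = trdegHom f + trdegHom g := by
  let _ := f.toAlgebra
  let _ := g.toAlgebra
  let _ := (g.comp f).toAlgebra
  have : IsScalarTower K F F' := .of_algebraMap_eq' rfl
  rw [trdegHom, trdegHom, trdegHom, ← map_add]
  exact congrArg _ (trdeg_add_eq K F (A := F')).symm

/-- The image of a point with values in a field. -/
abbrev pt {X : Scheme.{u}} {F : Type u} [Field F] (q : Spec (.of F) ⟶ X) : X :=
  q (IsLocalRing.closedPoint F)

section Points

variable {X : Scheme.{u}} {F : Type u} [Field F]

lemma pt_comp {Y : Scheme.{u}} (q : Spec (.of F) ⟶ X) (f : X ⟶ Y) : pt (q ≫ f) = f (pt q) := rfl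

lemma eq_pt (q : Spec (.of F) ⟶ X) (t : Spec (.of F)) : q t = pt q :=
  congrArg q (Subsingleton.elim t _)

lemma pt_comp_map {F' : Type u} [Field F'] (q : Spec (.of F) ⟶ X) (α : F →+* F') :
    pt (Spec.map (CommRingCat.ofHom α) ≫ q) = pt q :=
  (pt_comp _ _).trans (eq_pt q _)

lemma pt_specMap {B : Type u} [CommRing B] (φ : B →+* F) :
    (pt (Spec.map (CommRingCat.ofHom φ))).asIdeal = RingHom.ker φ := by
  ext b
  change φ b ∈ IsLocalRing.maximalIdeal F ↔ _
  rw [IsLocalRing.maximalIdeal_eq_bot]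
  rfl

lemma exists_lift_of_mem_range {B : Type u} [CommRing B] (j : Spec (.of B) ⟶ X) [IsOpenImmersion j]
    (q : Spec (.of F) ⟶ X) (hq : pt q ∈ Set.range j) :
    ∃ φ : B →+* F, Spec.map (CommRingCat.ofHom φ) ≫ j = q := by
  have h : Set.range q ⊆ Set.range j := by
    rintro _ ⟨t, rfl⟩
    rwa [eq_pt]
  refine ⟨(Spec.preimage (IsOpenImmersion.lift j q h)).hom, ?_⟩
  rw [CommRingCat.ofHom_hom, Spec.map_preimage, IsOpenImmersion.lift_fac]

/-- The residue field of a point of a scheme, as a field. -/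
def κ (x : X) : Type u := X.residueField x

instance (x : X) : Field (κ x) := inferInstanceAs (Field (X.residueField x))

/-- The canonical point with values in the residue field. -/
def κpt (x : X) : Spec (.of (κ x)) ⟶ X := X.fromSpecResidueField x

lemma pt_κpt (x : X) : pt (κpt x) = x :=
  X.fromSpecResidueField_apply x _

/-- The residue field of a point is universal among fields with a point above it. -/
lemma exists_κ_desc (q : Spec (.of F) ⟶ X) {x : X} (hx : pt q = x) :
    ∃ α : κ x →+* F, Spec.map (CommRingCat.ofHom α) ≫ κpt x = q := by
  subst hx
  exact ⟨(X.descResidueField (Scheme.stalkClosedPointTo q)).hom,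
    Scheme.descResidueField_stalkClosedPointTo_fromSpecResidueField F X q⟩

/-- The transcendence degree of the residue field of a point of a scheme over a field. -/
def ptDim {K : Type u} [Field K] (w : X ⟶ Spec (.of K)) (x : X) : ℕ∞ :=
  trdegHom (Spec.preimage (κpt x ≫ w)).hom

variable {K : Type u} [Field K] (w : X ⟶ Spec (.of K))

lemma ptDim_le_trdegHom (q : Spec (.of F) ⟶ X) (f : K →+* F)
    (hf : q ≫ w = Spec.map (CommRingCat.ofHom f)) : ptDim w (pt q) ≤ trdegHom f := by
  obtain ⟨α, hα⟩ := exists_κ_desc q rfl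
  have : CommRingCat.ofHom f = Spec.preimage (κpt (pt q) ≫ w) ≫ CommRingCat.ofHom α := by
    apply Spec.map_injective
    rw [← hf, Spec.map_comp, Spec.map_preimage, ← Category.assoc, hα]
  have : f = α.comp (Spec.preimage (κpt (pt q) ≫ w)).hom := congrArg CommRingCat.Hom.hom this
  rw [this]
  exact trdegHom_le _ _

lemma trdegHom_algebraMap [Algebra K F] : trdegHom (algebraMap K F) =
    Cardinal.toENat (Algebra.trdeg K F) := by
  rw [trdegHom]
  congr 2

lemma comp_ptDim {Y : Scheme.{u}} (f : X ⟶ Y) (w : Y ⟶ Spec (.of K)) (x : X) :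
    ptDim w (f x) ≤ ptDim (f ≫ w) x := by
  have := ptDim_le_trdegHom w (κpt x ≫ f) (Spec.preimage (κpt x ≫ f ≫ w)).hom (by
    rw [CommRingCat.ofHom_hom, Spec.map_preimage, Category.assoc])
  rwa [pt_comp, pt_κpt] at this

/-- The residue field of the point and that of the prime p are compared only through the universal
property of points with values in fields, which yields one inequality in each direction. -/
lemma ptDim_chart {B : Type u} [CommRing B] [Algebra K B] (j : Spec (.of B) ⟶ X)
    [IsOpenImmersion j] (hj : j ≫ w = Spec.map (CommRingCat.ofHom (algebraMap K B)))
    (p : PrimeSpectrum B) :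
    ptDim w (j p) = Cardinal.toENat (Algebra.trdeg K (B ⧸ p.asIdeal)) := by
  apply le_antisymm
  · let q : Spec (.of p.asIdeal.ResidueField) ⟶ X :=
      Spec.map (CommRingCat.ofHom (algebraMap B p.asIdeal.ResidueField)) ≫ j
    have hq : pt q = j p := by
      rw [pt_comp]
      congr 1
      apply PrimeSpectrum.ext
      rw [pt_specMap, Ideal.ker_algebraMap_residueField]
    have h := ptDim_le_trdegHom w q (algebraMap K p.asIdeal.ResidueField) (by
      rw [Category.assoc, hj, ← Spec.map_comp, ← CommRingCat.ofHom_comp,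
        ← IsScalarTower.algebraMap_eq])
    have : FaithfulSMul K (B ⧸ p.asIdeal) :=
      (faithfulSMul_iff_algebraMap_injective K _).mpr (algebraMap K (B ⧸ p.asIdeal)).injective
    have : FaithfulSMul (B ⧸ p.asIdeal) p.asIdeal.ResidueField :=
      (faithfulSMul_iff_algebraMap_injective _ _).mpr (IsFractionRing.injective _ _)
    have : Algebra.IsAlgebraic (B ⧸ p.asIdeal) p.asIdeal.ResidueField :=
      IsLocalization.isAlgebraic _ (nonZeroDivisors (B ⧸ p.asIdeal))
    rwa [hq, trdegHom_algebraMap, ← trdeg_add_eq K (B ⧸ p.asIdeal),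
      trdeg_eq_zero (R := B ⧸ p.asIdeal), add_zero] at h
  · obtain ⟨φ, hφ⟩ := exists_lift_of_mem_range j (κpt (j p)) (by rw [pt_κpt]; exact ⟨p, rfl⟩)
    have hk : RingHom.ker φ = p.asIdeal := by
      rw [← pt_specMap]
      congr 1
      apply j.isOpenEmbedding.injective
      rw [← pt_comp, hφ, pt_κpt]
    let _ := (Spec.preimage (κpt (j p) ≫ w)).hom.toAlgebra
    have hc : CommRingCat.ofHom (algebraMap K B) ≫ CommRingCat.ofHom φ =
        Spec.preimage (κpt (j p) ≫ w) := by
      apply Spec.map_injective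
      rw [Spec.map_comp, Spec.map_preimage, ← hj, ← Category.assoc, hφ]
    let ψ : B ⧸ p.asIdeal →ₐ[K] κ (j p) :=
      { Ideal.Quotient.lift p.asIdeal φ fun a ha ↦ by rwa [← hk] at ha with
        commutes' := fun a ↦ DFunLike.congr_fun (congrArg CommRingCat.Hom.hom hc) a }
    refine Cardinal.toENat.monotone' (trdeg_le_of_injective ψ ?_)
    exact (injective_iff_map_eq_zero (Ideal.Quotient.lift p.asIdeal φ _)).mpr fun a ha ↦ by
      obtain ⟨a, rfl⟩ := Ideal.Quotient.mk_surjective a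
      exact Ideal.Quotient.eq_zero_iff_mem.mpr (hk ▸ ha : a ∈ p.asIdeal)

lemma exists_affine_chart (x : X) : ∃ (B : Type u) (_ : CommRing B) (_ : Algebra K B)
    (j : Spec (.of B) ⟶ X), IsOpenImmersion j ∧ x ∈ Set.range j ∧
    j ≫ w = Spec.map (CommRingCat.ofHom (algebraMap K B)) ∧
    (LocallyOfFiniteType w → Algebra.FiniteType K B) := by
  obtain ⟨i, y, hy⟩ := X.affineOpenCover.openCover.exists_eq x
  let j : Spec (X.affineOpenCover.X i) ⟶ X := X.affineOpenCover.f i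
  have hj : IsOpenImmersion j := X.affineOpenCover.map_prop i
  let a := Spec.preimage (j ≫ w)
  refine ⟨X.affineOpenCover.X i, inferInstance, a.hom.toAlgebra, j, hj, ⟨y, hy⟩,
    (Spec.map_preimage _).symm, fun h ↦ ?_⟩
  have h1 : LocallyOfFiniteType (j ≫ w) := inferInstance
  rw [← Spec.map_preimage (j ≫ w), HasRingHomProperty.Spec_iff (P := @LocallyOfFiniteType)] at h1
  exact h1

variable [LocallyOfFiniteType w]

lemma ptDim_lt_top (x : X) : ptDim w x < ⊤ := by
  obtain ⟨B, _, _, j, _, ⟨(p : PrimeSpectrum B), rfl⟩, hj, h⟩ := exists_affine_chart w x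
  have := h inferInstance
  rw [ptDim_chart w j hj, Cardinal.toENat_lt_top]
  exact trdeg_lt_aleph0_of_finiteType

/-- `ptDim` is thus a strictly monotone rank function for specialisation. This computes Krull
dimensions and recognises generic points. -/
lemma ptDim_lt_of_specializes {x y : X} (h : x ⤳ y) (hne : x ≠ y) : ptDim w y < ptDim w x := by
  obtain ⟨B, _, _, j, _, ⟨(p : PrimeSpectrum B), rfl⟩, hj, hB⟩ := exists_affine_chart w y
  have := hB inferInstance
  obtain ⟨(q : PrimeSpectrum B), rfl⟩ := h.mem_open j.isOpenEmbedding.isOpen_range ⟨p, rfl⟩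
  rw [ptDim_chart w j hj, ptDim_chart w j hj]
  have hle : q.asIdeal ≤ p.asIdeal := by
    have : q ⤳ p := j.isOpenEmbedding.isInducing.specializes_iff.mp h
    exact (PrimeSpectrum.le_iff_specializes q p).mpr this
  have hmap : (p.asIdeal.map (Ideal.Quotient.mk q.asIdeal)).IsPrime :=
    Ideal.isPrime_map_quotientMk_of_isPrime hle
  have hlt := trdeg_quotient_lt K (B ⧸ q.asIdeal) (p.asIdeal.map (Ideal.Quotient.mk q.asIdeal)) (by
    intro h0
    rw [Ideal.map_eq_bot_iff_le_ker, Ideal.mk_ker] at h0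
    exact hne (congrArg j (PrimeSpectrum.ext (le_antisymm hle h0))))
  rw [show Algebra.trdeg K ((B ⧸ q.asIdeal) ⧸ p.asIdeal.map (Ideal.Quotient.mk q.asIdeal)) =
    Algebra.trdeg K (B ⧸ p.asIdeal) from (DoubleQuot.quotQuotEquivQuotOfLEₐ K hle).trdeg_eq] at hlt
  exact Cardinal.toENat_strictMonoOn trdeg_lt_aleph0_of_finiteType.le
    trdeg_lt_aleph0_of_finiteType.le hlt

lemma ptDim_le_of_specializes {x y : X} (h : x ⤳ y) : ptDim w y ≤ ptDim w x := by
  by_cases hne : x = y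
  · rw [hne]
  · exact (ptDim_lt_of_specializes w h hne).le

lemma ptDim_le_topologicalKrullDim_closure (x : X) :
    (ptDim w x : WithBot ℕ∞) ≤ topologicalKrullDim (closure {x} : Set X) := by
  obtain ⟨B, _, _, j, _, ⟨(p : PrimeSpectrum B), rfl⟩, hj, hB⟩ := exists_affine_chart w x
  have := hB inferInstance
  rw [ptDim_chart w j hj]
  refine (trdeg_le_ringKrullDim K (B ⧸ p.asIdeal)).trans ?_
  rw [← PrimeSpectrum.topologicalKrullDim_eq_ringKrullDim]
  have h1 := (j.isOpenEmbedding.isInducing).comp (PrimeSpectrum.isClosedEmbedding_comap_of_surjective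
    _ (Ideal.Quotient.mk p.asIdeal) Ideal.Quotient.mk_surjective).isInducing
  refine Topology.IsInducing.topologicalKrullDim_le (f := Set.codRestrict _ _ fun q ↦ ?_)
    (h1.codRestrict _)
  rw [← specializes_iff_mem_closure]
  refine Specializes.map (PrimeSpectrum.le_iff_specializes _ _ |>.mp ?_) j.continuous
  intro a ha
  change Ideal.Quotient.mk p.asIdeal a ∈ q.asIdeal
  rw [Ideal.Quotient.eq_zero_iff_mem.mpr ha]
  exact q.asIdeal.zero_mem

lemma ptDim_le_topologicalKrullDim (x : X) :
    (ptDim w x : WithBot ℕ∞) ≤ topologicalKrullDim X :=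
  (ptDim_le_topologicalKrullDim_closure w x).trans
    (Topology.IsInducing.subtypeVal.topologicalKrullDim_le)

lemma topologicalKrullDim_le_of_ptDim {T : Set X} (hT : IsClosed T) (N : ℕ∞)
    (h : ∀ x ∈ T, ptDim w x ≤ N) : topologicalKrullDim T ≤ N := by
  have hirr (C : TopologicalSpace.IrreducibleCloseds T) :
      IsIrreducible ((fun x : T ↦ (x : X)) '' C.carrier) :=
    C.isIrreducible'.image _ continuous_subtype_val.continuousOn
  have hcl (C : TopologicalSpace.IrreducibleCloseds T) :
      IsClosed ((fun x : T ↦ (x : X)) '' C.carrier) :=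
    hT.isClosedMap_subtype_val _ C.isClosed'
  choose g hg using fun C ↦ QuasiSober.sober (hirr C) (hcl C)
  have hgT C : g C ∈ T := by
    obtain ⟨y, -, hy⟩ := (hg C).mem
    exact hy ▸ y.2
  -- Sending an irreducible closed subset to the transcendence degree of its generic point is
  -- strictly increasing with values in ℕ, so it bounds the length of chains.
  have hmono : StrictMono fun C ↦ (ptDim w (g C)).toNat := fun C C' hlt ↦ by
    have hsub : (fun x : T ↦ (x : X)) '' C.carrier ⊆ (fun x : T ↦ (x : X)) '' C'.carrier :=
      Set.image_mono hlt.le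
    have hs : g C' ⤳ g C := (hg C').specializes (hsub (hg C).mem)
    have hne : g C' ≠ g C := fun he ↦ by
      have h1 := (hg C').def
      rw [he, (hg C).def] at h1
      exact hlt.ne (TopologicalSpace.IrreducibleCloseds.ext
        (Set.image_injective.mpr Subtype.val_injective h1))
    have := ptDim_lt_of_specializes w hs hne
    exact by
      rwa [← ENat.natCast_toNat (ptDim_lt_top w (g C)).ne,
        ← ENat.natCast_toNat (ptDim_lt_top w (g C')).ne, Nat.cast_lt] at this
  refine iSup_le fun l ↦ ?_
  have h1 := LTSeries.head_add_length_le_nat (l.map _ hmono)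
  have h2 : l.length ≤ (ptDim w (g l.last)).toNat := by
    refine (Nat.le_add_left _ _).trans (h1.trans ?_)
    rw [LTSeries.last_map]
  have h3 : (l.length : ℕ∞) ≤ N := by
    refine le_trans ?_ (h _ (hgT l.last))
    rw [← ENat.natCast_toNat (ptDim_lt_top w (g l.last)).ne]
    exact_mod_cast h2
  exact_mod_cast h3

lemma topologicalKrullDim_closure (x : X) :
    topologicalKrullDim (closure {x} : Set X) = ptDim w x :=
  le_antisymm (topologicalKrullDim_le_of_ptDim w isClosed_closure _ fun _ hy ↦
    ptDim_le_of_specializes w (specializes_iff_mem_closure.mpr hy))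
    (ptDim_le_topologicalKrullDim_closure w x)

lemma topologicalKrullDim_le (N : ℕ∞) (h : ∀ x, ptDim w x ≤ N) : topologicalKrullDim X ≤ N :=
  (IsHomeomorph.topologicalKrullDim_eq _ (Homeomorph.Set.univ X).isHomeomorph).symm.trans_le
    (topologicalKrullDim_le_of_ptDim w isClosed_univ N fun x _ ↦ h x)

end Points

end

/-! ### Coordinates, and the Liouville and symplectic forms at points with values in a field. -/

noncomputable section

section Frames

open KaehlerDifferential

/-- Coordinates on `B` over `A`: functions `xⱼ` and vector fields `vⱼ` such that the `dxⱼ` form a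
basis of the Kähler differentials with dual basis `vⱼ`. -/
structure Frame (A B : Type u) [CommRing A] [CommRing B] [Algebra A B] (n : ℕ) where
  x : Fin n → B
  v : Fin n → VectorField A B
  dual (i j : Fin n) : v i (D A B (x j)) = if i = j then 1 else 0
  sum (ω : Ω[B⁄A]) : ω = ∑ j, v j ω • D A B (x j)

variable {A B : Type u} [CommRing A] [CommRing B] [Algebra A B] {F : Type u} [Field F]

/-- A `ℤ`-derivation vanishing on constants as a linear derivation. -/
def derivationOver (A : Type*) {B N : Type*} [CommRing A] [CommRing B] [Algebra A B]
    [AddCommGroup N] [Module B N] [Module A N] [IsScalarTower A B N] (δ : Derivation ℤ B N)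
    (h : ∀ a : A, δ (algebraMap A B a) = 0) : Derivation A B N where
  toFun := δ
  map_add' := by simp
  map_smul' a b := by simp [Algebra.smul_def, h]
  map_one_eq_zero' := by simp
  leibniz' := by simp

/-- δ ∘ ρ is a derivation over A and factors through the Kähler differentials. The factorisation is
stated as an additive, ρ-semilinear map so that no module structure on F has to be chosen. -/
lemma exists_differential (ρ : B →+* F) (δ : Derivation ℤ F F)
    (hδ : ∀ a : A, δ (ρ (algebraMap A B a)) = 0) :
    ∃ L : Ω[B⁄A] →+ F, (∀ b ω, L (b • ω) = ρ b * L ω) ∧ ∀ b, L (D A B b) = δ (ρ b) := by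
  let _ := ρ.toAlgebra
  let _ := (ρ.comp (algebraMap A B)).toAlgebra
  have : IsScalarTower A B F := .of_algebraMap_eq' rfl
  let δ₁ : Derivation ℤ B F := Derivation.mk' ((δ : F →ₗ[ℤ] F) ∘ₗ ρ.toAddMonoidHom.toIntLinearMap)
    fun a b ↦ by
      change δ (ρ (a * b)) = ρ a * δ (ρ b) + ρ b * δ (ρ a)
      simp
  let δ₂ : Derivation A B F := derivationOver A δ₁ hδ
  exact ⟨δ₂.liftKaehlerDifferential.toAddMonoidHom,
    fun b ω ↦ δ₂.liftKaehlerDifferential.map_smul b ω,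
    fun b ↦ δ₂.liftKaehlerDifferential_comp_D b⟩

variable {n : ℕ} (c : Frame A B n)

namespace Frame

lemma chain_rule (ρ : B →+* F) (δ : Derivation ℤ F F)
    (hδ : ∀ a : A, δ (ρ (algebraMap A B a)) = 0) (b : B) :
    δ (ρ b) = ∑ j, ρ (c.v j (D A B b)) * δ (ρ (c.x j)) := by
  obtain ⟨L, hL, hLD⟩ := exists_differential ρ δ hδ
  rw [← hLD, c.sum (D A B b), map_sum]
  simp only [hL, hLD]
  congr! with j
  exact c.sum _

lemma vectorField_eq (v : VectorField A B) : v = ∑ j, v (D A B (c.x j)) • c.v j := by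
  refine LinearMap.ext fun ω ↦ ?_
  conv_lhs => rw [c.sum ω]
  simp [mul_comm]

lemma ι_eq (φ : CotangentRing A B →+* F) (v : VectorField A B) :
    φ (SymmetricAlgebra.ι B _ v) = ∑ j, φ (algebraMap B _ (v (D A B (c.x j)))) *
      φ (SymmetricAlgebra.ι B _ (c.v j)) := by
  conv_lhs => rw [c.vectorField_eq v]
  simp [Algebra.smul_def]

/-- The value of the Liouville form `∑ ξⱼ dxⱼ` at a point of the cotangent bundle with values in a
field and a derivation of this field. -/
def liouville (φ : CotangentRing A B →+* F) (δ : Derivation ℤ F F) : F :=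
  ∑ j, φ (SymmetricAlgebra.ι B _ (c.v j)) * δ (φ (algebraMap B _ (c.x j)))

/-- The momenta transform by `ι_eq` and the differentials by `chain_rule`, with the same Jacobian.
Only derivations killing A see an invariant form, because the frames are relative to A. -/
lemma liouville_eq {n' : ℕ} (c' : Frame A B n') (φ : CotangentRing A B →+* F)
    (δ : Derivation ℤ F F) (hδ : ∀ a : A, δ (φ (algebraMap B _ (algebraMap A B a))) = 0) :
    c.liouville φ δ = c'.liouville φ δ := by
  have h1 (j : Fin n) := c'.chain_rule (φ.comp (algebraMap B _)) δ hδ (c.x j)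
  simp only [RingHom.comp_apply] at h1
  simp only [liouville, c.ι_eq φ (c'.v _), h1, Finset.mul_sum, Finset.sum_mul]
  rw [Finset.sum_comm]
  refine Finset.sum_congr rfl fun l _ ↦ Finset.sum_congr rfl fun j _ ↦ ?_
  ring

/-- The value `∑ dξⱼ ∧ dxⱼ` of the symplectic form on two derivations. -/
def symplectic (φ : CotangentRing A B →+* F) (δ₁ δ₂ : Derivation ℤ F F) : F :=
  ∑ j, (δ₁ (φ (SymmetricAlgebra.ι B _ (c.v j))) * δ₂ (φ (algebraMap B _ (c.x j))) -
    δ₂ (φ (SymmetricAlgebra.ι B _ (c.v j))) * δ₁ (φ (algebraMap B _ (c.x j))))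

/-- Cartan's formula for ω = dλ; it is what turns vanishing of λ into isotropy. -/
lemma symplectic_eq_liouville (φ : CotangentRing A B →+* F) (δ₁ δ₂ : Derivation ℤ F F) :
    c.symplectic φ δ₁ δ₂ = δ₁ (c.liouville φ δ₂) - δ₂ (c.liouville φ δ₁) -
      c.liouville φ ⁅δ₁, δ₂⁆ := by
  simp only [symplectic, liouville, map_sum, Derivation.leibniz, Derivation.commutator_apply,
    smul_eq_mul, ← Finset.sum_sub_distrib]
  refine Finset.sum_congr rfl fun j _ ↦ ?_
  ring

lemma liouville_comp {F' : Type u} [Field F'] (α : F →+* F') (φ : CotangentRing A B →+* F)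
    (δ : Derivation ℤ F F) (δ' : Derivation ℤ F' F') (h : ∀ x, δ' (α x) = α (δ x)) :
    c.liouville (α.comp φ) δ' = α (c.liouville φ δ) := by
  simp [liouville, h]

lemma symplectic_comp {F' : Type u} [Field F'] (α : F →+* F') (φ : CotangentRing A B →+* F)
    (δ₁ δ₂ : Derivation ℤ F F) (δ₁' δ₂' : Derivation ℤ F' F') (h₁ : ∀ x, δ₁' (α x) = α (δ₁ x))
    (h₂ : ∀ x, δ₂' (α x) = α (δ₂ x)) :
    c.symplectic (α.comp φ) δ₁' δ₂' = α (c.symplectic φ δ₁ δ₂) := by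
  simp [symplectic, h₁, h₂]

variable {A' B' : Type u} [CommRing A'] [CommRing B'] [Algebra A' B'] [Algebra A A']
  [Algebra B B'] [Algebra A B'] [IsScalarTower A B B'] [IsScalarTower A A' B']
  [Algebra.FormallyEtale B B'] [Algebra.FormallyUnramified A A']

variable (A' B') in
/-- Restriction of coordinates along a localisation. -/
def restrict : Frame A' B' n where
  x j := algebraMap B B' (c.x j)
  v j := VectorField.restrict A B A' B' (c.v j)
  dual i j := by
    rw [← KaehlerDifferential.map_D A A' B B', VectorField.restrict_map, c.dual]
    split_ifs <;> simp
  sum ω := by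
    let g : Ω[B'⁄A'] →ₗ[B'] Ω[B'⁄A'] := ∑ j, LinearMap.smulRight
      (VectorField.restrict A B A' B' (c.v j)) (D A' B' (algebraMap B B' (c.x j)))
    have : LinearMap.id = g := by
      apply (isBaseChange_kaehler A B A' B').algHom_ext
      intro ω
      simp only [LinearMap.id_apply, g, LinearMap.sum_apply, LinearMap.smulRight_apply,
        VectorField.restrict_map]
      conv_lhs => rw [c.sum ω]
      simp
    simpa [g] using LinearMap.congr_fun this ω

lemma restrict_liouville (φ : CotangentRing A' B' →+* F) (δ : Derivation ℤ F F) :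
    (c.restrict A' B').liouville φ δ =
      c.liouville (φ.comp (CotangentRing.restrict A B A' B')) δ := by
  simp [liouville, restrict]

end Frame

section BaseChange

variable {F' : Type u} [Field F'] (α : F →+* F')

/-- A derivation with values in an extension field, expressed through derivations of the field. -/
lemma exists_derivation_coeff (δ : Derivation ℤ F' F') :
    ∃ (I : Type u) (e : I → F') (d : I → Derivation ℤ F F),
      (∀ x, δ (α x) = 0 → ∀ i, d i x = 0) ∧
      ∀ s : Finset F, ∃ t : Finset I, ∀ x ∈ s, δ (α x) = ∑ i ∈ t, α (d i x) * e i := by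
  classical
  let _ := α.toAlgebra
  -- The coordinates of δ ∘ α in a basis of F' over F are derivations of F. The basis may be
  -- infinite, but finitely many elements of F involve only finitely many coordinates.
  let b := Module.Basis.ofVectorSpace F F'
  let δ₁ : Derivation ℤ F F' := Derivation.mk' ((δ : F' →ₗ[ℤ] F') ∘ₗ α.toAddMonoidHom.toIntLinearMap)
    fun x y ↦ by
      change δ (α (x * y)) = α x * δ (α y) + α y * δ (α x)
      simp
  have h1 (x) : δ (α x) = δ₁ x := rfl
  refine ⟨_, b, fun i ↦ (b.coord i).compDer δ₁, fun x hx i ↦ ?_, fun s ↦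
    ⟨s.biUnion fun x ↦ (b.repr (δ₁ x)).support, fun x hx ↦ ?_⟩⟩
  · change b.coord i (δ₁ x) = 0
    rw [← h1, hx, map_zero]
  · rw [h1]
    conv_lhs => rw [← b.linearCombination_repr (δ₁ x)]
    rw [Finsupp.linearCombination_apply, Finsupp.sum_of_support_subset (s :=
      s.biUnion fun x ↦ (b.repr (δ₁ x)).support) _
      (Finset.subset_biUnion_of_mem (fun x ↦ (b.repr (δ₁ x)).support) hx) _ (by simp)]
    refine Finset.sum_congr rfl fun i _ ↦ ?_
    rw [Algebra.smul_def]
    rfl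

/-- Derivations of F' need not map F to itself, but the Liouville form is linear in the derivation.
It therefore vanishes on δ as soon as it vanishes on all coefficients of δ, which are derivations of
F. -/
lemma Frame.liouville_comp_eq_zero (φ : CotangentRing A B →+* F)
    (h : ∀ δ : Derivation ℤ F F, (∀ a : A, δ (φ (algebraMap B _ (algebraMap A B a))) = 0) →
      c.liouville φ δ = 0) (δ : Derivation ℤ F' F')
    (hδ : ∀ a : A, δ (α (φ (algebraMap B _ (algebraMap A B a)))) = 0) :
    c.liouville (α.comp φ) δ = 0 := by
  classical
  obtain ⟨I, e, d, hd, hs⟩ := exists_derivation_coeff α δ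
  obtain ⟨t, ht⟩ := hs (Finset.univ.image fun j ↦ φ (algebraMap B _ (c.x j)))
  have h1 : c.liouville (α.comp φ) δ = ∑ i ∈ t, α (c.liouville φ (d i)) * e i := by
    simp only [liouville, RingHom.comp_apply, map_sum, map_mul, Finset.sum_mul]
    rw [Finset.sum_comm]
    refine Finset.sum_congr rfl fun j _ ↦ ?_
    rw [ht _ (Finset.mem_image_of_mem _ (Finset.mem_univ j)), Finset.mul_sum]
    simp only [mul_assoc]
  rw [h1]
  refine Finset.sum_eq_zero fun i _ ↦ ?_
  rw [h _ fun a ↦ hd _ (hδ a) i, map_zero, zero_mul]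

lemma Frame.symplectic_comp_eq_zero (φ : CotangentRing A B →+* F)
    (h : ∀ δ₁ δ₂ : Derivation ℤ F F, (∀ a : A, δ₁ (φ (algebraMap B _ (algebraMap A B a))) = 0) →
      (∀ a : A, δ₂ (φ (algebraMap B _ (algebraMap A B a))) = 0) → c.symplectic φ δ₁ δ₂ = 0)
    (δ₁ δ₂ : Derivation ℤ F' F')
    (hδ₁ : ∀ a : A, δ₁ (α (φ (algebraMap B _ (algebraMap A B a)))) = 0)
    (hδ₂ : ∀ a : A, δ₂ (α (φ (algebraMap B _ (algebraMap A B a)))) = 0) :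
    c.symplectic (α.comp φ) δ₁ δ₂ = 0 := by
  classical
  obtain ⟨I₁, e₁, d₁, hd₁, hs₁⟩ := exists_derivation_coeff α δ₁
  obtain ⟨I₂, e₂, d₂, hd₂, hs₂⟩ := exists_derivation_coeff α δ₂
  obtain ⟨t₁, ht₁⟩ := hs₁ ((Finset.univ.image fun j ↦ φ (algebraMap B _ (c.x j))) ∪
    Finset.univ.image fun j ↦ φ (SymmetricAlgebra.ι B _ (c.v j)))
  obtain ⟨t₂, ht₂⟩ := hs₂ ((Finset.univ.image fun j ↦ φ (algebraMap B _ (c.x j))) ∪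
    Finset.univ.image fun j ↦ φ (SymmetricAlgebra.ι B _ (c.v j)))
  have hx (j) : φ (algebraMap B _ (c.x j)) ∈
    (Finset.univ.image fun j ↦ φ (algebraMap B _ (c.x j))) ∪
    Finset.univ.image fun j ↦ φ (SymmetricAlgebra.ι B _ (c.v j)) :=
    Finset.mem_union_left _ (Finset.mem_image_of_mem _ (Finset.mem_univ j))
  have hv (j) : φ (SymmetricAlgebra.ι B _ (c.v j)) ∈
    (Finset.univ.image fun j ↦ φ (algebraMap B _ (c.x j))) ∪
    Finset.univ.image fun j ↦ φ (SymmetricAlgebra.ι B _ (c.v j)) :=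
    Finset.mem_union_right _ (Finset.mem_image_of_mem _ (Finset.mem_univ j))
  have h1 : c.symplectic (α.comp φ) δ₁ δ₂ =
      ∑ i ∈ t₁, ∑ l ∈ t₂, α (c.symplectic φ (d₁ i) (d₂ l)) * (e₁ i * e₂ l) := by
    simp only [symplectic, RingHom.comp_apply, map_sum, Finset.sum_mul]
    refine Eq.trans ?_ ((Finset.sum_congr rfl fun i _ ↦ Finset.sum_comm).trans Finset.sum_comm).symm
    refine Finset.sum_congr rfl fun j _ ↦ ?_
    rw [ht₁ _ (hx j), ht₁ _ (hv j), ht₂ _ (hx j), ht₂ _ (hv j), Finset.sum_mul_sum, mul_comm,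
      Finset.sum_mul_sum, ← Finset.sum_sub_distrib]
    refine Finset.sum_congr rfl fun i _ ↦ ?_
    rw [← Finset.sum_sub_distrib]
    refine Finset.sum_congr rfl fun l _ ↦ ?_
    rw [map_sub, map_mul, map_mul]
    ring
  rw [h1]
  refine Finset.sum_eq_zero fun i _ ↦ Finset.sum_eq_zero fun l _ ↦ ?_
  rw [h _ _ (fun a ↦ hd₁ _ (hδ₁ a) i) (fun a ↦ hd₂ _ (hδ₂ a) l), map_zero, zero_mul]

end BaseChange

/-! ### Null lifts of covectors along a tower R → A → B: existence and uniqueness. -/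

section Tower

variable {R : Type u} [CommRing R] [Algebra R A] [Algebra R B] [IsScalarTower R A B]
  {d N : ℕ}

/-- The derivations of a field vanishing on the image of a ring. -/
def derivationsKilling (ρ : R →+* F) : Submodule F (Derivation ℤ F F) where
  carrier := {δ | ∀ r, δ (ρ r) = 0}
  add_mem' h h' r := by simp [h r, h' r]
  zero_mem' r := rfl
  smul_mem' a δ h r := by simp [h r]

/-- Lifting the covector means choosing coefficients z_i of the dy_i. The relative Liouville form,
as a functional on derivations over R, vanishes wherever all dy_i vanish, hence is a combination of
the dy_i, and z is minus its coefficients. -/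
lemma exists_lift_liouville (cA : Frame R A d) (cR : Frame R B N) (φ : CotangentRing A B →+* F)
    (h : ∀ δ : Derivation ℤ F F, (∀ a : A, δ (φ (algebraMap B _ (algebraMap A B a))) = 0) →
      c.liouville φ δ = 0) :
    ∃ φ' : CotangentRing R B →+* F, φ'.comp (CotangentRing.ofTower R A B) = φ ∧
      ∀ δ : Derivation ℤ F F, (∀ r : R, δ (φ' (algebraMap B _ (algebraMap R B r))) = 0) →
        cR.liouville φ' δ = 0 := by
  let ρ : B →+* F := φ.comp (algebraMap B _)
  let V := derivationsKilling (ρ.comp (algebraMap R B))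
  let ev (x : F) : V →ₗ[F] F :=
    { toFun := fun δ ↦ δ.1 x, map_add' := fun _ _ ↦ rfl, map_smul' := fun _ _ ↦ rfl }
  let y (i : Fin d) : F := ρ (algebraMap A B (cA.x i))
  obtain ⟨z, hz⟩ : ∃ z : Fin d → F, ∀ δ : Derivation ℤ F F, (∀ r, δ (ρ (algebraMap R B r)) = 0) →
      c.liouville φ δ + ∑ i, z i * δ (y i) = 0 := by
    let θ : V →ₗ[F] F := ∑ j, φ (SymmetricAlgebra.ι B _ (c.v j)) • ev (φ (algebraMap B _ (c.x j)))
    have hθ (δ : V) : θ δ = c.liouville φ δ.1 := by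
      simp [θ, Frame.liouville, ev]
    have hmem : θ ∈ Submodule.span F (Set.range fun i ↦ ev (y i)) := by
      -- Linear algebra for finitely many functionals on a possibly infinite-dimensional space. A
      -- derivation killing every y_i kills all of A by the chain rule, so `h` applies to it.
      refine mem_span_of_iInf_ker_le_ker fun δ hδ ↦ ?_
      simp only [Submodule.mem_iInf, LinearMap.mem_ker] at hδ
      rw [LinearMap.mem_ker, hθ]
      refine h _ fun a ↦ ?_
      have := cA.chain_rule (ρ.comp (algebraMap A B)) δ.1 (fun r ↦ by
        rw [RingHom.comp_apply, ← IsScalarTower.algebraMap_apply]; exact δ.2 r) a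
      refine this.trans (Finset.sum_eq_zero fun i _ ↦ ?_)
      rw [show δ.1 ((ρ.comp (algebraMap A B)) (cA.x i)) = 0 from hδ i, mul_zero]
    obtain ⟨z, hz⟩ := (Submodule.mem_span_range_iff_exists_fun F).mp hmem
    refine ⟨fun i ↦ - z i, fun δ hδ ↦ ?_⟩
    have := LinearMap.congr_fun hz ⟨δ, hδ⟩
    rw [hθ] at this
    rw [← this]
    simp [ev]
  let _ : Algebra B F := ρ.toAlgebra
  -- Pairing of a vector field with the covector ∑ ξ_j dx_j + ∑ z_i dy_i.
  let L : VectorField R B →ₗ[B] F :=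
    { toFun := fun v ↦ ∑ j, ρ (v (D R B (c.x j))) * φ (SymmetricAlgebra.ι B _ (c.v j)) +
        ∑ i, ρ (v (D R B (algebraMap A B (cA.x i)))) * z i
      map_add' := fun v w ↦ by
        simp only [LinearMap.add_apply, map_add, add_mul, Finset.sum_add_distrib]
        ring
      map_smul' := fun b v ↦ by
        rw [Algebra.smul_def, mul_add, Finset.mul_sum, Finset.mul_sum]
        simp only [LinearMap.smul_apply, smul_eq_mul, map_mul, mul_assoc]
        rfl }
  let φ' : CotangentRing R B →ₐ[B] F := SymmetricAlgebra.lift L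
  have h1 (b : B) : φ' (algebraMap B _ b) = ρ b := φ'.commutes b
  have h2 (v) : φ' (SymmetricAlgebra.ι B _ v) =
      ∑ j, ρ (v (D R B (c.x j))) * φ (SymmetricAlgebra.ι B _ (c.v j)) +
        ∑ i, ρ (v (D R B (algebraMap A B (cA.x i)))) * z i := SymmetricAlgebra.lift_ι_apply _ _
  refine ⟨φ'.toRingHom, CotangentRing.ringHom_ext _ _ (fun b ↦ ?_) fun v ↦ ?_, fun δ hδ ↦ ?_⟩
  · rw [RingHom.comp_apply, CotangentRing.ofTower_algebraMap]
    exact h1 b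
  · rw [RingHom.comp_apply, CotangentRing.ofTower_ι]
    refine (h2 _).trans ?_
    rw [c.ι_eq φ v]
    have hv (b : B) : VectorField.ofTower R A B v (D R B b) = v (D A B b) :=
      congrArg v (KaehlerDifferential.map_D R A B B b)
    simp [hv, ρ]
  · have hδ' (r : R) : δ (ρ (algebraMap R B r)) = 0 := by rw [← h1]; exact hδ r
    rw [← hz δ hδ']
    simp only [Frame.liouville, y]
    have h3 (b : B) := cR.chain_rule ρ δ hδ' b
    change ∑ l, φ' (SymmetricAlgebra.ι B _ (cR.v l)) * δ (φ' (algebraMap B _ (cR.x l))) = _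
    simp only [h1, h2, add_mul, Finset.sum_add_distrib]
    congr 1
    · change _ = ∑ j, _ * δ (ρ (c.x j))
      simp only [h3 (c.x _), Finset.sum_mul, Finset.mul_sum]
      rw [Finset.sum_comm]
      refine Finset.sum_congr rfl fun l _ ↦ Finset.sum_congr rfl fun j _ ↦ ?_
      ring
    · simp only [h3 (algebraMap A B _), Finset.sum_mul, Finset.mul_sum]
      rw [Finset.sum_comm]
      refine Finset.sum_congr rfl fun l _ ↦ Finset.sum_congr rfl fun j _ ↦ ?_
      ring

/-- The difference ε of two lifts vanishes on vector fields relative to A, so it is a combination of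
the dy_i. Both lifts being null, evaluation on the derivation dual to y_m kills the m-th
coefficient. -/
lemma eq_of_liouville [Algebra.FormallySmooth A B] (cA : Frame R A d) (cR : Frame R B N)
    (φ₁ φ₂ : CotangentRing R B →+* F)
    (hb : ∀ b, φ₁ (algebraMap B _ b) = φ₂ (algebraMap B _ b))
    (h : φ₁.comp (CotangentRing.ofTower R A B) = φ₂.comp (CotangentRing.ofTower R A B))
    (h₁ : ∀ δ : Derivation ℤ F F, (∀ r : R, δ (φ₁ (algebraMap B _ (algebraMap R B r))) = 0) →
        cR.liouville φ₁ δ = 0)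
    (h₂ : ∀ δ : Derivation ℤ F F, (∀ r : R, δ (φ₂ (algebraMap B _ (algebraMap R B r))) = 0) →
        cR.liouville φ₂ δ = 0)
    (δ : Fin d → Derivation ℤ F F)
    (hδ : ∀ i (r : R), δ i (φ₁ (algebraMap B _ (algebraMap R B r))) = 0)
    (hδy : ∀ i j, δ i (φ₁ (algebraMap B _ (algebraMap A B (cA.x j)))) = if i = j then 1 else 0) :
    φ₁ = φ₂ := by
  let ρ : B →+* F := φ₁.comp (algebraMap B _)
  -- The coordinate fields ∂/∂y_i of A lift to B by formal smoothness; these lifts measure the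
  -- horizontal part of a vector field.
  have hext (i : Fin d) : ∃ ζ : VectorField R B, ∀ a : A,
      ζ (D R B (algebraMap A B a)) = algebraMap A B (cA.v i (D R A a)) := by
    let β : Derivation ℤ A B := (((Algebra.linearMap A B) ∘ₗ (cA.v i)).compDer
      (D R A)).restrictScalars ℤ
    obtain ⟨β', hβ'⟩ := exists_derivation_extension β
    have hβ'' (r : R) : β' (algebraMap R B r) = 0 := by
      rw [IsScalarTower.algebraMap_apply R A B, hβ']
      simp [β]
    exact ⟨(derivationOver R β' hβ'').liftKaehlerDifferential, fun a ↦
      ((derivationOver R β' hβ'').liftKaehlerDifferential_comp_D _).trans (hβ' a)⟩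
  choose ζ hζ using hext
  let ε (v : VectorField R B) : F :=
    φ₁ (SymmetricAlgebra.ι B _ v) - φ₂ (SymmetricAlgebra.ι B _ v)
  have ε_eq (v : VectorField R B) :
      ε v = ∑ i, ρ (v (D R B (algebraMap A B (cA.x i)))) * ε (ζ i) := by
    -- Removing the horizontal part leaves a field that kills A, i.e. a relative field, on which `h`
    -- makes both lifts agree.
    let w : VectorField R B := v - ∑ i, v (D R B (algebraMap A B (cA.x i))) • ζ i
    have hw (a : A) : w (D R B (algebraMap A B a)) = 0 := by
      have h1 : v (D R B (algebraMap A B a)) =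
          ∑ i, algebraMap A B (cA.v i (D R A a)) * v (D R B (algebraMap A B (cA.x i))) := by
        have := congrArg (fun ω ↦ v (KaehlerDifferential.map R R A B ω)) (cA.sum (D R A a))
        simpa [KaehlerDifferential.map_D, Algebra.smul_def] using this
      simp [w, h1, hζ, mul_comm]
    let w₀ : Derivation R B B := w.compDer (D R B)
    let w' : VectorField A B := (derivationOver A (w₀.restrictScalars ℤ) hw).liftKaehlerDifferential
    have hw' : VectorField.ofTower R A B w' = w := by
      apply LinearMap.ext_on (KaehlerDifferential.span_range_derivation R B)
      rintro _ ⟨b, rfl⟩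
      refine (congrArg w' (KaehlerDifferential.map_D R A B B b)).trans ?_
      exact (derivationOver A (w₀.restrictScalars ℤ) hw).liftKaehlerDifferential_comp_D b
    have h0 : ε w = 0 := by
      have := DFunLike.congr_fun h (SymmetricAlgebra.ι B _ w')
      rw [RingHom.comp_apply, RingHom.comp_apply, CotangentRing.ofTower_ι, hw'] at this
      exact sub_eq_zero.mpr this
    have hv : v = w + ∑ i, v (D R B (algebraMap A B (cA.x i))) • ζ i := by simp [w]
    have : ε v = ε w + ∑ i, ρ (v (D R B (algebraMap A B (cA.x i)))) * ε (ζ i) := by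
      conv_lhs => rw [hv]
      simp only [ε, map_add, map_sum, map_smul, Algebra.smul_def, map_mul, ← hb, ρ,
        RingHom.comp_apply, mul_sub, Finset.sum_sub_distrib]
      ring
    rw [this, h0, zero_add]
  have hζ0 (m : Fin d) : ε (ζ m) = 0 := by
    have h3 := (h₁ (δ m) (hδ m)).trans (h₂ (δ m) fun r ↦ by rw [← hb]; exact hδ m r).symm
    rw [Frame.liouville, Frame.liouville, ← sub_eq_zero, ← Finset.sum_sub_distrib] at h3
    have h4 (i : Fin d) : δ m (ρ (algebraMap A B (cA.x i))) = if m = i then 1 else 0 := hδy m i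
    have h5 : ∑ l, ε (cR.v l) * δ m (ρ (cR.x l)) = 0 := by
      rw [← h3]
      refine Finset.sum_congr rfl fun l _ ↦ ?_
      rw [← hb, ← sub_mul]
      rfl
    -- The difference of the two null conditions, rewritten by the chain rule in terms of the y_i
    -- alone; duality of δ m then isolates one term.
    have h6 : ∑ i, ε (ζ i) * δ m (ρ (algebraMap A B (cA.x i))) = 0 := by
      rw [← h5]
      simp only [ε_eq (cR.v _), cR.chain_rule ρ (δ m) (hδ m) (algebraMap A B _), Finset.mul_sum,
        Finset.sum_mul]
      rw [Finset.sum_comm]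
      refine Finset.sum_congr rfl fun l _ ↦ Finset.sum_congr rfl fun j _ ↦ ?_
      ring
    simpa [h4] using h6
  refine CotangentRing.ringHom_ext _ _ hb fun v ↦ sub_eq_zero.mp ?_
  change ε v = 0
  rw [ε_eq]
  simp [hζ0]

end Tower

end Frames

end

/-! ### Existence of coordinates on charts, also for towers. -/

noncomputable section

section Frames

open KaehlerDifferential

variable {A B : Type u} [CommRing A] [CommRing B] [Algebra A B]

lemma Frame.nonempty_of_fintype {I : Type*} [Fintype I] [DecidableEq I] (x : I → B)
    (v : I → VectorField A B) (dual : ∀ i j, v i (D A B (x j)) = if i = j then 1 else 0)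
    (sum : ∀ ω : Ω[B⁄A], ω = ∑ j, v j ω • D A B (x j)) :
    Nonempty (Frame A B (Fintype.card I)) := by
  let e := (Fintype.equivFin I).symm
  refine ⟨⟨x ∘ e, v ∘ e, fun i j ↦ by simp [dual], fun ω ↦ ?_⟩⟩
  conv_lhs => rw [sum ω]
  exact (Equiv.sum_comp e fun j ↦ v j ω • D A B (x j)).symm

/-- The basis of the Kähler differentials given by coordinates. -/
def Frame.basis {n : ℕ} (c : Frame A B n) : Module.Basis (Fin n) B (Ω[B⁄A]) :=
  .ofEquivFun
    { toFun := fun ω j ↦ c.v j ω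
      map_add' := fun _ _ ↦ by ext; simp
      map_smul' := fun _ _ ↦ by ext; simp
      invFun := fun b ↦ ∑ j, b j • D A B (c.x j)
      left_inv := fun ω ↦ (c.sum ω).symm
      right_inv := fun b ↦ by ext j; simp [c.dual] }

lemma Frame.basis_apply {n : ℕ} (c : Frame A B n) (j : Fin n) : c.basis j = D A B (c.x j) := by
  simp [Frame.basis, Module.Basis.coe_ofEquivFun, Pi.single_apply, ite_smul]

lemma Frame.basis_coord {n : ℕ} (c : Frame A B n) (j : Fin n) : c.basis.coord j = c.v j := by
  refine LinearMap.ext fun ω ↦ ?_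
  simp [Frame.basis]

lemma Frame.rank_eq [Nontrivial B] {n : ℕ} (c : Frame A B n) : Module.rank B (Ω[B⁄A]) = n := by
  rw [rank_eq_card_basis c.basis, Fintype.card_fin]

lemma Frame.exists_of_isStandardSmooth (A B : Type u) [CommRing A] [CommRing B] [Algebra A B]
    [Algebra.IsStandardSmooth A B] : ∃ n, Nonempty (Frame A B n) := by
  classical
  obtain ⟨-, I, b, hb⟩ := Algebra.IsStandardSmooth.iff_exists_basis_kaehlerDifferential.mp
    ‹Algebra.IsStandardSmooth A B›
  -- Over the zero ring the index set of a basis need not be finite; the empty frame serves there.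
  cases subsingleton_or_nontrivial B
  · have : Subsingleton (Ω[B⁄A]) := Module.subsingleton B _
    exact ⟨0, ⟨⟨Fin.elim0, Fin.elim0, fun i ↦ i.elim0, fun ω ↦ Subsingleton.elim _ _⟩⟩⟩
  have : Finite I := Module.Finite.finite_basis b
  let _ := Fintype.ofFinite I
  choose x hx using fun i ↦ hb (Set.mem_range_self i)
  refine ⟨_, Frame.nonempty_of_fintype x b.coord (fun i j ↦ ?_) fun ω ↦ ?_⟩
  · rw [hx, Module.Basis.coord_apply, Module.Basis.repr_self, Finsupp.single_apply]
    simp only [eq_comm]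
  · simp only [hx, Module.Basis.coord_apply]
    exact (b.sum_repr ω).symm

lemma exists_vectorField_extension {R : Type u} [CommRing R] [Algebra R A] [Algebra R B]
    [IsScalarTower R A B] [Algebra.FormallySmooth A B] (v : VectorField R A) :
    ∃ ζ : VectorField R B, ∀ a : A,
      ζ (D R B (algebraMap A B a)) = algebraMap A B (v (D R A a)) := by
  let β : Derivation ℤ A B := (((Algebra.linearMap A B) ∘ₗ v).compDer (D R A)).restrictScalars ℤ
  obtain ⟨β', hβ'⟩ := exists_derivation_extension β
  have hβ'' (r : R) : β' (algebraMap R B r) = 0 := by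
    rw [IsScalarTower.algebraMap_apply R A B, hβ']
    simp [β]
  exact ⟨(derivationOver R β' hβ'').liftKaehlerDifferential, fun a ↦
    ((derivationOver R β' hβ'').liftKaehlerDifferential_comp_D _).trans (hβ' a)⟩

/-- Relative coordinates together with coordinates of the base are coordinates of the total space.
That they span comes from exactness of B ⊗ Ω[A/R] → Ω[B/R] → Ω[B/A]. -/
lemma Frame.tower {R : Type u} [CommRing R] [Algebra R A] [Algebra R B] [IsScalarTower R A B]
    [Algebra.FormallySmooth A B] {n d : ℕ} (c : Frame A B n) (cA : Frame R A d) :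
    Nonempty (Frame R B (n + d)) := by
  choose ζ hζ using fun i ↦ exists_vectorField_extension (B := B) (cA.v i)
  let v (j : Fin n) : VectorField R B := VectorField.ofTower R A B (c.v j)
  have hv (j) (b : B) : v j (D R B b) = c.v j (D A B b) :=
    congrArg (c.v j) (KaehlerDifferential.map_D R A B B b)
  have hvA (j) (a : A) : v j (D R B (algebraMap A B a)) = 0 := by rw [hv]; simp
  -- The lifts of the ∂/∂y_i are corrected by vertical fields so as to kill the x_j, which makes the
  -- family dual to all coordinates.
  let ζ' (i : Fin d) : VectorField R B := ζ i - ∑ j, ζ i (D R B (c.x j)) • v j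
  have hζx (i j) : ζ' i (D R B (c.x j)) = 0 := by
    simp [ζ', hv, c.dual]
  have hζy (i j) : ζ' i (D R B (algebraMap A B (cA.x j))) = if i = j then 1 else 0 := by
    simp [ζ', hvA, hζ, cA.dual]
  have h := Frame.nonempty_of_fintype (A := R) (B := B) (I := Fin n ⊕ Fin d)
    (Sum.elim c.x (algebraMap A B ∘ cA.x)) (Sum.elim v ζ') ?_ fun ω ↦ ?_
  · simpa using h
  · rintro (i | i) (j | j)
    · simp [hv, c.dual]
    · simp [hvA]
    · simp [hζx]
    · simp [hζy]
  · let S : Submodule B (Ω[B⁄R]) := Submodule.span B (Set.range fun i ↦ D R B (algebraMap A B (cA.x i)))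
    have hS (ω : Ω[A⁄R]) : KaehlerDifferential.map R R A B ω ∈ S := by
      have := congrArg (KaehlerDifferential.map R R A B) (cA.sum ω)
      simp only [map_sum, map_smul, KaehlerDifferential.map_D] at this
      rw [this]
      refine Submodule.sum_mem _ fun i _ ↦ ?_
      rw [← algebraMap_smul B]
      exact Submodule.smul_mem _ _ (Submodule.subset_span ⟨i, rfl⟩)
    have hker : KaehlerDifferential.map R A B B (ω - ∑ j, v j ω • D R B (c.x j)) = 0 := by
      simp only [map_sub, map_sum, map_smul, KaehlerDifferential.map_D, sub_eq_zero]
      exact c.sum _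
    have hmem : ω - ∑ j, v j ω • D R B (c.x j) ∈ S := by
      obtain ⟨y, hy⟩ := (KaehlerDifferential.exact_mapBaseChange_map R A B _).mp hker
      rw [← hy]
      clear hy hker
      induction y using TensorProduct.induction_on with
      | zero => rw [map_zero]; exact S.zero_mem
      | tmul b ω =>
        rw [KaehlerDifferential.mapBaseChange_tmul]
        exact S.smul_mem _ (hS ω)
      | add y y' h h' => rw [map_add]; exact S.add_mem h h'
    obtain ⟨z, hz⟩ := (Submodule.mem_span_range_iff_exists_fun B).mp hmem
    have h1 (i) : z i = ζ' i ω := by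
      have := congrArg (ζ' i) hz
      simpa [hζx, hζy] using this
    rw [Fintype.sum_sum_type]
    simp only [Sum.elim_inl, Sum.elim_inr, Function.comp_apply]
    simp only [h1] at hz
    rw [hz]
    abel

end Frames

section ChartFrames

variable {X Y : Scheme.{u}} {f : X ⟶ Y} {F : Type u} [Field F]

namespace Chart

/-- Restriction of coordinates to a smaller chart. -/
lemma exists_restrictFrame {i j : Chart f} (h : i ≤ j) {n : ℕ} (c : Frame j.A j.B n) :
    ∃ c' : Frame i.A i.B n, (∀ l, c'.x l = resB h (c.x l)) ∧
      ∀ (φ : i.ring →+* F) (δ : Derivation ℤ F F),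
        c'.liouville φ δ = c.liouville (φ.comp (restrict h)) δ := by
  let _ := (resA h).toAlgebra
  let _ := (resB h).toAlgebra
  let _ := ((resB h).comp (algebraMap j.A j.B)).toAlgebra
  have : IsScalarTower j.A j.B i.B := .of_algebraMap_eq' rfl
  have : IsScalarTower j.A i.A i.B := .of_algebraMap_eq' (resB_algebraMap h)
  have : Algebra.Etale j.A i.A := etale_presheaf_map j.isAffineOpen_U i.isAffineOpen_U h.2
  have : Algebra.Etale j.B i.B := etale_presheaf_map j.isAffineOpen_V i.isAffineOpen_V h.1
  exact ⟨c.restrict i.A i.B, fun l ↦ rfl, fun φ δ ↦ c.restrict_liouville φ δ⟩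

/-- The derivation `δ` vanishes on the functions of the base of the chart. -/
def Kills {i : Chart f} (φ : i.ring →+* F) (δ : Derivation ℤ F F) : Prop :=
  ∀ a : i.A, δ (φ (algebraMap i.B _ (algebraMap i.A i.B a))) = 0

/-- Passing to the smaller base is the nontrivial direction: the restriction of base rings is étale,
so it has no differentials and a derivation killing the larger chart's functions kills the smaller
one's. -/
lemma kills_comp_restrict_iff {i j : Chart f} (h : i ≤ j) (φ : i.ring →+* F)
    (δ : Derivation ℤ F F) : Kills (φ.comp (restrict h)) δ ↔ Kills φ δ := by
  have hb (a : j.A) : (φ.comp (restrict h)) (algebraMap j.B _ (algebraMap j.A j.B a)) =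
      φ (algebraMap i.B _ (algebraMap i.A i.B (resA h a))) := by
    rw [RingHom.comp_apply, restrict_algebraMap]
    congr 2
    exact DFunLike.congr_fun (resB_algebraMap h) a
  refine ⟨fun hδ ↦ ?_, fun hδ a ↦ by rw [hb]; exact hδ _⟩
  let _ := (resA h).toAlgebra
  have : Algebra.Etale j.A i.A := etale_presheaf_map j.isAffineOpen_U i.isAffineOpen_U h.2
  let ρ : i.A →+* F := (φ.comp (algebraMap i.B _)).comp (algebraMap i.A i.B)
  obtain ⟨L, hL, hLD⟩ := exists_differential (A := j.A) ρ δ fun a ↦ by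
    exact (congrArg δ (hb a).symm).trans (hδ a)
  intro a
  have := hLD a
  rw [Subsingleton.elim (KaehlerDifferential.D j.A i.A a) 0, map_zero] at this
  exact this.symm

end Chart

variable [Smooth f]

lemma exists_chart_hom (q : Spec (.of F) ⟶ cotangent f) (i : Chart f)
    (hi : cotangentToBase f (pt q) ∈ i.V) :
    ∃ φ : i.ring →+* F, Spec.map (CommRingCat.ofHom φ) ≫ cotangentChart f i = q := by
  refine exists_lift_of_mem_range _ q ?_
  rw [range_cotangentChart]
  exact hi

lemma mem_V_of_chart_hom {q : Spec (.of F) ⟶ cotangent f} {i : Chart f} {φ : i.ring →+* F}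
    (h : Spec.map (CommRingCat.ofHom φ) ≫ cotangentChart f i = q) :
    cotangentToBase f (pt q) ∈ i.V := by
  have : pt q ∈ Set.range (cotangentChart f i) := ⟨_, (pt_comp _ _).symm.trans (by rw [h])⟩
  rwa [range_cotangentChart] at this

lemma eq_of_chart_hom {q : Spec (.of F) ⟶ cotangent f} {i : Chart f} {φ φ' : i.ring →+* F}
    (h : Spec.map (CommRingCat.ofHom φ) ≫ cotangentChart f i = q)
    (h' : Spec.map (CommRingCat.ofHom φ') ≫ cotangentChart f i = q) : φ = φ' := by
  rw [← h', cancel_mono] at h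
  exact congrArg CommRingCat.Hom.hom (Spec.map_injective h)

lemma chart_hom_restrict {q : Spec (.of F) ⟶ cotangent f} {i j : Chart f} (hij : i ≤ j)
    {φ : i.ring →+* F} {φ' : j.ring →+* F}
    (h : Spec.map (CommRingCat.ofHom φ) ≫ cotangentChart f i = q)
    (h' : Spec.map (CommRingCat.ofHom φ') ≫ cotangentChart f j = q) :
    φ' = φ.comp (Chart.restrict hij) := by
  refine eq_of_chart_hom h' ?_
  rw [CommRingCat.ofHom_comp, Spec.map_comp, Category.assoc, map_restrict_cotangentChart, h]

/-- The Liouville form vanishes at a point of the cotangent bundle with values in a field. -/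
def IsNull (q : Spec (.of F) ⟶ cotangent f) : Prop :=
  ∀ (i : Chart f) (n : ℕ) (c : Frame i.A i.B n) (φ : i.ring →+* F),
    Spec.map (CommRingCat.ofHom φ) ≫ cotangentChart f i = q →
    ∀ δ, Chart.Kills φ δ → c.liouville φ δ = 0

/-- The symplectic form vanishes at a point of the cotangent bundle with values in a field. -/
def IsIsotropic (q : Spec (.of F) ⟶ cotangent f) : Prop :=
  ∀ (i : Chart f) (n : ℕ) (c : Frame i.A i.B n) (φ : i.ring →+* F),
    Spec.map (CommRingCat.ofHom φ) ≫ cotangentChart f i = q →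
    ∀ δ₁ δ₂, Chart.Kills φ δ₁ → Chart.Kills φ δ₂ → c.symplectic φ δ₁ δ₂ = 0

lemma exists_common_chart {q : Spec (.of F) ⟶ cotangent f} {i j : Chart f} {φ : i.ring →+* F}
    {φ' : j.ring →+* F} (h : Spec.map (CommRingCat.ofHom φ) ≫ cotangentChart f i = q)
    (h' : Spec.map (CommRingCat.ofHom φ') ≫ cotangentChart f j = q) {n n' : ℕ}
    (c : Frame i.A i.B n) (c' : Frame j.A j.B n') :
    (∀ δ, Chart.Kills φ δ ↔ Chart.Kills φ' δ) ∧
      ∀ δ, Chart.Kills φ δ → c.liouville φ δ = c'.liouville φ' δ := by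
  obtain ⟨l, hl, hl', hx⟩ := Chart.exists_le_of_mem (mem_V_of_chart_hom h) (mem_V_of_chart_hom h')
  obtain ⟨ψ, hψ⟩ := exists_chart_hom q l hx
  obtain rfl := chart_hom_restrict hl hψ h
  obtain rfl := chart_hom_restrict hl' hψ h'
  obtain ⟨e, -, he⟩ := Chart.exists_restrictFrame (F := F) hl c
  obtain ⟨e', -, he'⟩ := Chart.exists_restrictFrame (F := F) hl' c'
  refine ⟨fun δ ↦ by rw [Chart.kills_comp_restrict_iff, Chart.kills_comp_restrict_iff],
    fun δ hδ ↦ ?_⟩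
  rw [← he, ← he']
  exact e.liouville_eq e' ψ δ ((Chart.kills_comp_restrict_iff hl ψ δ).mp hδ)

/-- Nullity is defined by quantifying over all charts and frames; by invariance of the Liouville
form a single one decides it. -/
lemma isNull_of_chart {q : Spec (.of F) ⟶ cotangent f} {i : Chart f} {φ : i.ring →+* F}
    (h : Spec.map (CommRingCat.ofHom φ) ≫ cotangentChart f i = q) {n : ℕ} (c : Frame i.A i.B n)
    (hc : ∀ δ, Chart.Kills φ δ → c.liouville φ δ = 0) : IsNull q := by
  intro j n' c' φ' h' δ hδ
  obtain ⟨h1, h2⟩ := exists_common_chart h h' c c'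
  rw [← h2 δ ((h1 δ).mpr hδ), hc δ ((h1 δ).mpr hδ)]

end ChartFrames

section ChartExistence

variable {X Y : Scheme.{u}}

/-- Relative coordinates of a smooth morphism exist locally on the source. -/
lemma exists_frame (f : X ⟶ Y) [Smooth f] (x : X) :
    ∃ (i : Chart f) (n : ℕ) (_ : Frame i.A i.B n), x ∈ i.V ∧ Algebra.IsStandardSmooth i.A i.B := by
  obtain ⟨i, hx, h⟩ : ∃ i : Chart f, x ∈ i.V ∧ Algebra.IsStandardSmooth i.A i.B := by
    obtain ⟨U, hU, V, hV, hx, e, h⟩ := Smooth.exists_isStandardSmooth f x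
    exact ⟨⟨V, hV, U, hU, e⟩, hx, h⟩
  obtain ⟨n, ⟨c⟩⟩ := Frame.exists_of_isStandardSmooth i.A i.B
  exact ⟨i, n, c, hx, h⟩

lemma Chart.nontrivial_B {f : X ⟶ Y} (i : Chart f) {x : X} (hx : x ∈ i.V) : Nontrivial i.B := by
  have : Nonempty i.V := ⟨⟨x, hx⟩⟩
  infer_instance

lemma exists_frame_of_relativeDimension (f : X ⟶ Y) {n : ℕ} (hf : SmoothOfRelativeDimension n f)
    (x : X) : ∃ (i : Chart f) (_ : Frame i.A i.B n), x ∈ i.V := by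
  obtain ⟨i, hx, h⟩ : ∃ i : Chart f, x ∈ i.V ∧
      Algebra.IsStandardSmoothOfRelativeDimension n i.A i.B := by
    obtain ⟨U, hU, V, hV, hx, e, h⟩ := hf.exists_isStandardSmoothOfRelativeDimension x
    exact ⟨⟨V, hV, U, hU, e⟩, hx, h⟩
  have : Algebra.IsStandardSmooth i.A i.B :=
    Algebra.IsStandardSmoothOfRelativeDimension.isStandardSmooth n
  have : Nontrivial i.B := i.nontrivial_B hx
  obtain ⟨n', ⟨c⟩⟩ := Frame.exists_of_isStandardSmooth i.A i.B
  have h1 := Algebra.IsStandardSmoothOfRelativeDimension.rank_kaehlerDifferential (R := i.A)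
    (S := i.B) n
  rw [c.rank_eq] at h1
  obtain rfl : n' = n := by exact_mod_cast h1
  exact ⟨i, c, hx⟩

lemma exists_chart_le (f : X ⟶ Y) (x : X) (V : X.Opens) (hx : x ∈ V) (U : Y.Opens) (hU : f x ∈ U) :
    ∃ i : Chart f, x ∈ i.V ∧ i.V ≤ V ∧ i.U ≤ U := by
  obtain ⟨_, ⟨U', hU', rfl⟩, hxU, hUU⟩ :=
    Y.isBasis_affineOpens.exists_subset_of_mem_open (show f x ∈ (U : Set Y) from hU) U.2
  obtain ⟨_, ⟨V', hV', rfl⟩, hxV, hVV⟩ :=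
    X.isBasis_affineOpens.exists_subset_of_mem_open
      (show x ∈ ((V ⊓ f ⁻¹ᵁ U' : X.Opens) : Set X) from ⟨hx, hxU⟩) (V ⊓ f ⁻¹ᵁ U').2
  exact ⟨⟨V', hV', U', hU', fun y hy ↦ (hVV hy).2⟩, hxV, fun y hy ↦ (hVV hy).1, hUU⟩

lemma Chart.restrictFrame {f : X ⟶ Y} {i j : Chart f} (h : i ≤ j) {n : ℕ} (c : Frame j.A j.B n) :
    Nonempty (Frame i.A i.B n) :=
  -- Only the frame is kept, so the field is irrelevant and any field of the universe will do.
  ⟨(Chart.exists_restrictFrame (F := ULift ℚ) h c).choose⟩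

/-- The chart of the base `g` of a tower `X ⟶ Y ⟶ Z` with `Z` affine below a chart of `X ⟶ Y`. -/
def Chart.base {Z : Scheme.{u}} [IsAffine Z] {f : X ⟶ Y} (i : Chart f) (g : Y ⟶ Z) : Chart g where
  V := i.U
  isAffineOpen_V := i.isAffineOpen_U
  U := ⊤
  isAffineOpen_U := isAffineOpen_top Z
  le := le_top

lemma Chart.tower_frame {Z : Scheme.{u}} [IsAffine Z] {f : X ⟶ Y} [Smooth f] (i : Chart f)
    (g : Y ⟶ Z) {n d : ℕ} (c : Frame i.A i.B n) (cA : Frame (i.base g).A (i.base g).B d) :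
    Nonempty (Frame (i.comp g).A (i.comp g).B (n + d)) := by
  let _ : Algebra Γ(Z, ⊤) i.A := (g.appLE ⊤ i.U le_top).hom.toAlgebra
  let _ : Algebra Γ(Z, ⊤) i.B := inferInstanceAs (Algebra (i.comp g).A (i.comp g).B)
  have : IsScalarTower Γ(Z, ⊤) i.A i.B := .of_algebraMap_eq' (congrArg CommRingCat.Hom.hom
    (Scheme.Hom.appLE_comp_appLE f g ⊤ i.U i.V le_top i.le).symm)
  have : Algebra.Smooth i.A i.B := f.smooth_appLE i.isAffineOpen_U i.isAffineOpen_V i.le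
  exact Frame.tower (R := Γ(Z, ⊤)) (A := i.A) (B := i.B) c cA

lemma opens_eq_top_of_mem {K : Type u} [Field K] {U : (Spec (.of K)).Opens} {x : Spec (.of K)}
    (h : x ∈ U) : U = ⊤ := by
  ext y
  simp [Subsingleton.elim y x, h]

section Tower

variable {K : Type u} [Field K] {π : X ⟶ Y} {σ : Y ⟶ Spec (.of K)} [Smooth π]

lemma exists_tower_frames_le {d : ℕ} (hd : SmoothOfRelativeDimension d σ) {x : X}
    {i : Chart π} {n : ℕ} (c : Frame i.A i.B n) (hx : x ∈ i.V) (V : X.Opens) (hxV : x ∈ V) :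
    ∃ (l : Chart π) (_ : Frame l.A l.B n) (_ : Frame (l.base σ).A (l.base σ).B d)
      (_ : Frame (l.comp σ).A (l.comp σ).B (n + d)), x ∈ l.V ∧ l ≤ i ∧ l.V ≤ V := by
  obtain ⟨j, cA, hj⟩ := exists_frame_of_relativeDimension σ hd (π x)
  obtain ⟨l, hxl, hlV, hlU⟩ := exists_chart_le π x (i.V ⊓ V) ⟨hx, hxV⟩ (i.U ⊓ j.V) ⟨i.le hx, hj⟩
  have hli : l ≤ i := ⟨hlV.trans inf_le_left, hlU.trans inf_le_left⟩
  -- A nonempty open subset of the spectrum of a field is everything, so the inclusion of bases is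
  -- automatic.
  have hlj : l.base σ ≤ j :=
    ⟨hlU.trans inf_le_right, (opens_eq_top_of_mem (j.le hj)).symm.le⟩
  obtain ⟨c'⟩ := Chart.restrictFrame hli c
  obtain ⟨cA'⟩ := Chart.restrictFrame hlj cA
  obtain ⟨cR⟩ := l.tower_frame σ c' cA'
  exact ⟨l, c', cA', cR, hxl, hli, hlV.trans inf_le_right⟩

/-- Simultaneous coordinates for a tower of smooth morphisms. -/
lemma exists_tower_frames {d : ℕ} (hd : SmoothOfRelativeDimension d σ) (x : X) (V : X.Opens)
    (hxV : x ∈ V) :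
    ∃ (l : Chart π) (n : ℕ) (_ : Frame l.A l.B n) (_ : Frame (l.base σ).A (l.base σ).B d)
      (_ : Frame (l.comp σ).A (l.comp σ).B (n + d)), x ∈ l.V ∧ l.V ≤ V := by
  obtain ⟨i, n, c, hx, -⟩ := exists_frame π x
  obtain ⟨l, c', cA, cR, hl, -, hV⟩ := exists_tower_frames_le hd c hx V hxV
  exact ⟨l, n, c', cA, cR, hl, hV⟩

/-- On a common chart the Kähler differentials over k have rank n + d by the tower frame and rank m
by hypothesis. -/
lemma relativeDimension_add_eq {m d : ℕ} (hm : SmoothOfRelativeDimension m (π ≫ σ))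
    (hd : SmoothOfRelativeDimension d σ) {x : X} {i : Chart π} {n : ℕ} (c : Frame i.A i.B n)
    (hx : x ∈ i.V) : n + d = m := by
  obtain ⟨j, cM, hj⟩ := exists_frame_of_relativeDimension (π ≫ σ) hm x
  obtain ⟨l, -, -, cR, hl, -, hV⟩ := exists_tower_frames_le hd c hx j.V hj
  have hlj : l.comp σ ≤ j := ⟨hV, (opens_eq_top_of_mem (j.le hj)).symm.le⟩
  obtain ⟨cM'⟩ := Chart.restrictFrame hlj cM
  have : Nontrivial (l.comp σ).B := l.nontrivial_B hl
  exact_mod_cast cR.rank_eq.symm.trans cM'.rank_eq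

/-- Every local relative dimension of π is m - d, so it is constant. The point `x` guarantees that M
is nonempty, without which d ≤ m could fail. -/
lemma exists_relativeDimension {m d : ℕ} (hm : SmoothOfRelativeDimension m (π ≫ σ))
    (hd : SmoothOfRelativeDimension d σ) (x : X) :
    ∃ n, n + d = m ∧ SmoothOfRelativeDimension n π := by
  obtain ⟨i, n, c, hx, -⟩ := exists_frame π x
  have hn := relativeDimension_add_eq hm hd c hx
  refine ⟨n, hn, ⟨fun y ↦ ?_⟩⟩
  obtain ⟨j, n', c', hy, h⟩ := exists_frame π y
  have hn' := relativeDimension_add_eq hm hd c' hy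
  obtain rfl : n' = n := by omega
  have : Nontrivial j.B := j.nontrivial_B hy
  have := (Algebra.IsStandardSmoothOfRelativeDimension.iff_of_isStandardSmooth (R := j.A)
    (S := j.B) n').mpr c'.rank_eq
  exact ⟨j.U, j.isAffineOpen_U, j.V, j.isAffineOpen_V, hy, j.le, this⟩

end Tower

end ChartExistence

end

/-! ### Residue fields, and dimensions of smooth schemes over a field. -/

noncomputable section

section ResidueField

variable {K B : Type u} [Field K] [CommRing B] [Algebra K B] (p : Ideal B) [p.IsPrime]

lemma trdeg_residueField : Algebra.trdeg K p.ResidueField = Algebra.trdeg K (B ⧸ p) := by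
  have : FaithfulSMul K (B ⧸ p) :=
    (faithfulSMul_iff_algebraMap_injective K _).mpr (algebraMap K (B ⧸ p)).injective
  have : FaithfulSMul (B ⧸ p) p.ResidueField :=
    (faithfulSMul_iff_algebraMap_injective _ _).mpr (IsFractionRing.injective _ _)
  have : Algebra.IsAlgebraic (B ⧸ p) p.ResidueField :=
    IsLocalization.isAlgebraic _ (nonZeroDivisors (B ⧸ p))
  rw [← trdeg_add_eq K (B ⧸ p), trdeg_eq_zero (R := B ⧸ p), add_zero]

lemma exists_eq_div_residueField (x : p.ResidueField) :
    ∃ a b, x = algebraMap B p.ResidueField a / algebraMap B p.ResidueField b := by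
  obtain ⟨a, b, -, rfl⟩ := IsFractionRing.div_surjective (A := B ⧸ p) x
  obtain ⟨a, rfl⟩ := Ideal.Quotient.mk_surjective a
  obtain ⟨b, rfl⟩ := Ideal.Quotient.mk_surjective b
  exact ⟨a, b, rfl⟩

lemma derivation_eq_zero_of_div {B F : Type*} [CommRing B] [Field F] (ρ : B →+* F)
    (hρ : ∀ x, ∃ a b, x = ρ a / ρ b) (δ : Derivation ℤ F F) (h : ∀ b, δ (ρ b) = 0) : δ = 0 := by
  ext x
  obtain ⟨a, b, rfl⟩ := hρ x
  rw [Derivation.leibniz_div, h, h]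
  simp

end ResidueField

section FieldBase

variable {X : Scheme.{u}} {K : Type u} [Field K]

lemma isIso_fromSpec_of_mem {U : (Spec (.of K)).Opens} (hU : IsAffineOpen U) {x : Spec (.of K)}
    (hx : x ∈ U) : IsIso hU.fromSpec := by
  have : Function.Surjective hU.fromSpec := by
    rw [← Set.range_eq_univ, hU.range_fromSpec, opens_eq_top_of_mem hx]
    rfl
  have : Epi hU.fromSpec.base := (TopCat.epi_iff_surjective _).mpr this
  exact IsOpenImmersion.isIso _

/-- Over a field, the ring of functions on the base of a nonempty chart is the field. -/
lemma Chart.exists_field_equiv {w : X ⟶ Spec (.of K)} (i : Chart w) {x : X} (hx : x ∈ i.V) :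
    ∃ e : K →+* i.A, Function.Surjective e ∧ i.isAffineOpen_U.fromSpec =
      Spec.map (CommRingCat.ofHom e) ∧ i.isAffineOpen_V.fromSpec ≫ w =
      Spec.map (CommRingCat.ofHom ((algebraMap i.A i.B).comp e)) := by
  have h := isIso_fromSpec_of_mem i.isAffineOpen_U (i.le hx)
  obtain ⟨e, he⟩ : ∃ e : CommRingCat.of K ⟶ Γ(Spec (.of K), i.U),
      Spec.map e = i.isAffineOpen_U.fromSpec := ⟨_, Spec.map_preimage _⟩
  rw [← he] at h
  have : IsIso e := by
    have : IsIso (Scheme.Spec.map e.op) := h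
    have : IsIso e.op := isIso_of_reflects_iso e.op Scheme.Spec
    exact isIso_of_op e
  refine ⟨e.hom, (ConcreteCategory.bijective_of_isIso e).2, he.symm, ?_⟩
  rw [← IsAffineOpen.SpecMap_appLE_fromSpec w i.isAffineOpen_U i.isAffineOpen_V i.le, ← he,
    ← Spec.map_comp]
  rfl

variable [CharZero K] {w : X ⟶ Spec (.of K)} {n : ℕ}

/-- By the chain rule a derivation of the residue field over K that kills the n coordinates is zero.
-/
lemma ptDim_le_of_smooth (hw : SmoothOfRelativeDimension n w) (x : X) :
    ptDim w x ≤ n := by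
  obtain ⟨i, c, hx⟩ := exists_frame_of_relativeDimension w hw x
  obtain ⟨e, he, -, hj⟩ := i.exists_field_equiv hx
  let _ : Algebra K i.B := ((algebraMap i.A i.B).comp e).toAlgebra
  obtain ⟨(p : PrimeSpectrum i.B), rfl⟩ : x ∈ Set.range i.isAffineOpen_V.fromSpec := by
    rwa [i.isAffineOpen_V.range_fromSpec]
  rw [ptDim_chart w _ hj, ← trdeg_residueField]
  let ρ := algebraMap i.B p.asIdeal.ResidueField
  have h2 : Algebra.trdeg K p.asIdeal.ResidueField ≤ n := by
    refine trdeg_le_of_derivation (fun j ↦ ρ (c.x j)) fun δ hδ hx ↦ ?_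
    have hρ (b : i.B) : δ (ρ b) = 0 := by
      rw [c.chain_rule ρ δ (fun a ↦ ?_) b]
      · exact Finset.sum_eq_zero fun j _ ↦ by rw [hx, mul_zero]
      · obtain ⟨a, rfl⟩ := he a
        exact hδ a
    exact derivation_eq_zero_of_div ρ (exists_eq_div_residueField p.asIdeal) δ hρ
  exact (Cardinal.toENat.monotone' h2).trans (by simp)

/-- The point y is given by a minimal prime below x: the coordinate vector fields preserve it and
stay dual to the coordinates in its residue field. -/
lemma exists_ptDim_ge_of_smooth (hw : SmoothOfRelativeDimension n w) (x : X) :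
    ∃ y, y ⤳ x ∧ n ≤ ptDim w y := by
  obtain ⟨i, c, hx⟩ := exists_frame_of_relativeDimension w hw x
  obtain ⟨e, he, -, hj⟩ := i.exists_field_equiv hx
  let _ : Algebra K i.B := ((algebraMap i.A i.B).comp e).toAlgebra
  obtain ⟨(p : PrimeSpectrum i.B), rfl⟩ : x ∈ Set.range i.isAffineOpen_V.fromSpec := by
    rwa [i.isAffineOpen_V.range_fromSpec]
  obtain ⟨q, hq, hqp⟩ := Ideal.exists_minimalPrimes_le (bot_le : ⊥ ≤ p.asIdeal)
  have : q.IsPrime := hq.1.1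
  refine ⟨i.isAffineOpen_V.fromSpec (⟨q, this⟩ : PrimeSpectrum i.B), Specializes.map
    ((PrimeSpectrum.le_iff_specializes (⟨q, this⟩ : PrimeSpectrum i.B) p).mp hqp)
    (Scheme.Hom.continuous _), ?_⟩
  have h1 : (n : Cardinal) ≤ Algebra.trdeg K q.ResidueField := by
    refine le_trdeg_of_minimalPrimes (Algebra.ofId i.B q.ResidueField |>.restrictScalars K)
      (by
        have : RingHom.ker ((Algebra.ofId i.B q.ResidueField).restrictScalars K) = q :=
          Ideal.ker_algebraMap_residueField q
        rw [this]
        exact hq) c.x (fun j ↦ ((c.v j).compDer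
        (KaehlerDifferential.D i.A i.B)).restrictScalars ℤ) (fun j a ↦ ?_) fun j l ↦ ?_
    · change c.v j (KaehlerDifferential.D i.A i.B (algebraMap i.A i.B (e a))) = 0
      simp
    · exact c.dual j l
  rw [ptDim_chart w _ hj, ← trdeg_residueField]
  exact (by simp : (n : ℕ∞) ≤ _).trans (Cardinal.toENat.monotone' h1)

lemma topologicalKrullDim_le_of_smooth [LocallyOfFiniteType w]
    (hw : SmoothOfRelativeDimension n w) : topologicalKrullDim X ≤ n :=
  topologicalKrullDim_le w n (ptDim_le_of_smooth hw)

lemma le_topologicalKrullDim_of_smooth [LocallyOfFiniteType w]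
    (hw : SmoothOfRelativeDimension n w) (x : X) : n ≤ topologicalKrullDim X := by
  obtain ⟨y, -, hy⟩ := exists_ptDim_ge_of_smooth hw x
  exact le_trans (by exact_mod_cast hy) (ptDim_le_topologicalKrullDim w y)


end FieldBase

end

/-! ### Irreducible components through their generic points; local finiteness. -/

noncomputable section

section Topology

variable {T : Type*} [TopologicalSpace T]

/-- The points of a subset which are maximal under generization. -/
def maxPts (Z : Set T) : Set T := {η | η ∈ Z ∧ ∀ y ∈ Z, y ⤳ η → y = η}

lemma exists_maximal_generization [QuasiSober T] [T0Space T] (z : T) :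
    ∃ η, η ⤳ z ∧ ∀ y, y ⤳ η → y = η := by
  obtain ⟨t, ht, hzt, hmax⟩ := exists_preirreducible {z} isPreirreducible_singleton
  have hzt : z ∈ t := hzt rfl
  have hc : IsClosed t := by
    rw [← closure_eq_iff_isClosed]
    exact hmax _ ht.closure subset_closure
  obtain ⟨g, hg⟩ := QuasiSober.sober ⟨⟨z, hzt⟩, ht⟩ hc
  refine ⟨g, hg.specializes hzt, fun y hy ↦ ?_⟩
  have h1 : t ⊆ closure {y} := by
    rw [← hg.def]
    exact closure_minimal (Set.singleton_subset_iff.mpr hy.mem_closure) isClosed_closure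
  have h2 := hmax _ isIrreducible_singleton.closure.isPreirreducible h1
  exact (show IsGenericPoint y t from h2).eq hg

lemma exists_maxPts_specializes [QuasiSober T] [T0Space T] {Z : Set T} (hZ : IsClosed Z) {z : T}
    (hz : z ∈ Z) : ∃ η ∈ maxPts Z, η ⤳ z := by
  have : QuasiSober Z := hZ.isClosedEmbedding_subtypeVal.quasiSober
  obtain ⟨η, h1, h2⟩ := exists_maximal_generization (⟨z, hz⟩ : Z)
  refine ⟨η, ⟨η.2, fun y hy hyη ↦ ?_⟩, Topology.IsInducing.subtypeVal.specializes_iff.mpr h1⟩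
  exact congrArg Subtype.val
    (h2 ⟨y, hy⟩ (Topology.IsInducing.subtypeVal.specializes_iff.mp hyη))

/-- From here on components are handled through the points of `maxPts`. -/
lemma mem_components_iff [QuasiSober T] [T0Space T] {Z : Set T} (hZ : IsClosed Z) (C : Set T) :
    C ∈ components Z ↔ ∃ η ∈ maxPts Z, C = closure {η} := by
  constructor
  · intro (hC : Maximal (fun C' ↦ IsIrreducible C' ∧ C' ⊆ Z) C)
    have hc : IsClosed C := by
      rw [← closure_eq_iff_isClosed]
      exact (hC.eq_of_subset ⟨hC.prop.1.closure, closure_minimal hC.prop.2 hZ⟩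
        subset_closure).symm
    obtain ⟨g, hg⟩ := QuasiSober.sober hC.prop.1 hc
    refine ⟨g, ⟨hC.prop.2 hg.mem, fun y hy hyg ↦ ?_⟩, hg.def.symm⟩
    have h1 : C ⊆ closure {y} := by
      rw [← hg.def]
      exact closure_minimal (Set.singleton_subset_iff.mpr hyg.mem_closure) isClosed_closure
    have h2 := hC.eq_of_subset ⟨isIrreducible_singleton.closure,
      closure_minimal (Set.singleton_subset_iff.mpr hy) hZ⟩ h1
    exact (show IsGenericPoint y C from h2.symm).eq hg
  · rintro ⟨η, hη, rfl⟩
    refine ⟨⟨isIrreducible_singleton.closure,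
      closure_minimal (Set.singleton_subset_iff.mpr hη.1) hZ⟩, fun C' hC' hle ↦ ?_⟩
    obtain ⟨g, hg⟩ := QuasiSober.sober hC'.1.closure isClosed_closure
    have h1 : g ⤳ η := hg.specializes (subset_closure (hle (subset_closure rfl)))
    have h2 := hη.2 g (closure_minimal hC'.2 hZ hg.mem) h1
    subst h2
    rw [hg.def]
    exact subset_closure

lemma closure_maxPts [QuasiSober T] [T0Space T] {Z : Set T} (hZ : IsClosed Z) :
    closure (maxPts Z) = Z := by
  refine (closure_minimal (fun _ h ↦ h.1) hZ).antisymm fun z hz ↦ ?_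
  obtain ⟨η, hη, h⟩ := exists_maxPts_specializes hZ hz
  exact h.mem_closed isClosed_closure (subset_closure hη)

/-- Near x the set E is finite, and the closure of a finite set is the union of the closures of its
points. For infinite E the conclusion would fail in general. -/
lemma exists_specializes_of_mem_closure {E W : Set T} (hW : IsOpen W) (hE : (W ∩ E).Finite) {x : T}
    (hxW : x ∈ W) (hx : x ∈ closure E) : ∃ η ∈ E, η ⤳ x := by
  have h1 := hW.inter_closure ⟨hxW, hx⟩
  rw [← Set.biUnion_of_singleton (W ∩ E), hE.closure_biUnion] at h1
  simp only [Set.mem_iUnion] at h1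
  obtain ⟨η, hη, h⟩ := h1
  exact ⟨η, hη.2, specializes_iff_mem_closure.mpr h⟩

end Topology

/-- In the chart such points are minimal primes over an ideal of a noetherian ring. -/
lemma finite_maxPts_inter_range {X : Scheme.{u}} {B : Type u} [CommRing B] [IsNoetherianRing B]
    (j : Spec (.of B) ⟶ X) [IsOpenImmersion j] {Z : Set X} (hZ : IsClosed Z) :
    (Set.range j ∩ maxPts Z).Finite := by
  let Z' : Set (PrimeSpectrum B) := j ⁻¹' Z
  have hZ' : IsClosed Z' := hZ.preimage j.continuous
  obtain ⟨I, hI⟩ := (PrimeSpectrum.isClosed_iff_zeroLocus_ideal Z').mp hZ'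
  have hf : {p : PrimeSpectrum B | p.asIdeal ∈ I.minimalPrimes}.Finite :=
    (I.finite_minimalPrimes_of_isNoetherianRing B).preimage
      (fun _ _ _ _ h ↦ PrimeSpectrum.ext h)
  refine (hf.image j).subset ?_
  rintro _ ⟨⟨(p : PrimeSpectrum B), rfl⟩, hp⟩
  have hIp : I ≤ p.asIdeal := by
    have : p ∈ Z' := hp.1
    rwa [hI] at this
  obtain ⟨q, hq, hqp⟩ := Ideal.exists_minimalPrimes_le hIp
  let q' : PrimeSpectrum B := ⟨q, hq.1.1⟩
  have hq' : q' ∈ Z' := by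
    rw [hI]
    exact hq.1.2
  have h1 : q' ⤳ p := (PrimeSpectrum.le_iff_specializes q' p).mp hqp
  have h2 := j.isOpenEmbedding.injective (hp.2 _ hq' (h1.map j.continuous))
  refine ⟨p, ?_, rfl⟩
  change p.asIdeal ∈ I.minimalPrimes
  rw [← show q' = p from h2]
  exact hq

section FiniteType

lemma finiteType_symmetricAlgebra (B M : Type*) [CommRing B] [AddCommGroup M] [Module B M]
    [Module.Finite B M] : Algebra.FiniteType B (SymmetricAlgebra B M) := by
  classical
  obtain ⟨s, hs⟩ := Module.Finite.fg_top (R := B) (M := M)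
  refine ⟨⟨s.image (SymmetricAlgebra.ι B M), ?_⟩⟩
  rw [eq_top_iff]
  rintro x -
  induction x using SymmetricAlgebra.induction with
  | algebraMap r => exact Subalgebra.algebraMap_mem _ r
  | ι x =>
    have : x ∈ Submodule.span B (s : Set M) := hs ▸ Submodule.mem_top
    induction this using Submodule.span_induction with
    | mem x hx => exact Algebra.subset_adjoin (by simpa using ⟨x, hx, rfl⟩)
    | zero => rw [map_zero]; exact Subalgebra.zero_mem _
    | add x y _ _ hx hy => rw [map_add]; exact Subalgebra.add_mem _ hx hy
    | smul b x _ hx => rw [map_smul]; exact Subalgebra.smul_mem _ hx b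
  | mul a b ha hb => exact Subalgebra.mul_mem _ ha hb
  | add a b ha hb => exact Subalgebra.add_mem _ ha hb

variable {X Y : Scheme.{u}} (f : X ⟶ Y) [Smooth f]

lemma Chart.finiteType_ring {f : X ⟶ Y} [Smooth f] (i : Chart f) :
    Algebra.FiniteType i.B i.ring := by
  have : Algebra.Smooth i.A i.B := f.smooth_appLE i.isAffineOpen_U i.isAffineOpen_V i.le
  exact finiteType_symmetricAlgebra _ _

instance : LocallyOfFiniteType (cotangentToBase f) := by
  have : IsZariskiLocalAtSource @LocallyOfFiniteType.{u} :=
    HasRingHomProperty.instIsZariskiLocalAtSource (Q := RingHom.FiniteType)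
  refine (IsZariskiLocalAtSource.iff_of_openCover (P := @LocallyOfFiniteType)
    (Chart.glueData f).cover).mpr ?_
  intro (i : Chart f)
  change LocallyOfFiniteType (cotangentChart f i ≫ cotangentToBase f)
  have h1 : LocallyOfFiniteType (Spec.map (CommRingCat.ofHom (algebraMap i.B i.ring))) := by
    rw [HasRingHomProperty.Spec_iff (P := @LocallyOfFiniteType)]
    have := i.finiteType_ring
    exact (RingHom.finiteType_algebraMap).mpr this
  rw [cotangentChart_toBase]
  infer_instance

lemma isNoetherianRing_chart [IsLocallyNoetherian X] (i : Chart f) : IsNoetherianRing i.ring := by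
  have := i.finiteType_ring
  have : IsNoetherianRing i.B := IsLocallyNoetherian.component_noetherian ⟨i.V, i.isAffineOpen_V⟩
  exact Algebra.FiniteType.isNoetherianRing i.B i.ring

end FiniteType

end

/-! ### Geometric fibres and the dimension count. -/

noncomputable section

section ChartHom

variable {X Y : Scheme.{u}} {f : X ⟶ Y} [Smooth f] {F : Type u} [CommRing F]
  {q : Spec (.of F) ⟶ cotangent f} {i : Chart f} {φ : i.ring →+* F}

lemma chart_hom_toBase (h : Spec.map (CommRingCat.ofHom φ) ≫ cotangentChart f i = q) :
    q ≫ cotangentToBase f =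
      Spec.map (CommRingCat.ofHom (φ.comp (algebraMap i.B i.ring))) ≫ i.isAffineOpen_V.fromSpec := by
  rw [← h, Category.assoc, cotangentChart_toBase, CommRingCat.ofHom_comp, Spec.map_comp,
    Category.assoc]

lemma chart_hom_toBase_comp (h : Spec.map (CommRingCat.ofHom φ) ≫ cotangentChart f i = q) :
    q ≫ cotangentToBase f ≫ f =
      Spec.map (CommRingCat.ofHom ((φ.comp (algebraMap i.B i.ring)).comp (algebraMap i.A i.B))) ≫
        i.isAffineOpen_U.fromSpec := by
  rw [← Category.assoc, chart_hom_toBase h, Category.assoc,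
    ← IsAffineOpen.SpecMap_appLE_fromSpec f i.isAffineOpen_U i.isAffineOpen_V i.le,
    CommRingCat.ofHom_comp _ (φ.comp (algebraMap i.B i.ring)), Spec.map_comp, Category.assoc]
  rfl

end ChartHom

section GeometricPoints

variable {X Y : Scheme.{u}}

instance (x : X) : Mono (κpt x) := inferInstanceAs (Mono (X.fromSpecResidueField x))

/-- The geometric point with values in the algebraic closure of the residue field. -/
def geometricPt (x : X) : Spec (.of (AlgebraicClosure (κ x))) ⟶ X :=
  Spec.map (CommRingCat.ofHom (algebraMap (κ x) (AlgebraicClosure (κ x)))) ≫ κpt x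

lemma pt_geometricPt (x : X) : pt (geometricPt x) = x := by
  rw [geometricPt, pt_comp_map, pt_κpt]

variable {f : X ⟶ Y} [Smooth f] {Z : TopologicalSpace.Closeds (cotangent f)}

/-- Points of `Z` maximal under generization come from such points of geometric fibres. -/
lemma exists_maxPts_fibre {η : cotangent f} (hη : η ∈ maxPts (Z : Set (cotangent f))) {t : Y}
    (ht : f (cotangentToBase f η) = t) :
    ∃ w ∈ maxPts (fibre f (geometricPt t) Z : Set (cotangentFibre f (geometricPt t))),
      pullback.fst (cotangentToBase f ≫ f) (geometricPt t) w = η := by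
  obtain ⟨z, hz, -⟩ := Scheme.Pullback.exists_preimage_pullback (f := cotangentToBase f ≫ f)
    (g := geometricPt t) η (IsLocalRing.closedPoint _) (by
      rw [show geometricPt t _ = pt (geometricPt t) from rfl, pt_geometricPt]
      exact ht)
  have hzZ : z ∈ (fibre f (geometricPt t) Z : Set (cotangentFibre f (geometricPt t))) := by
    change pullback.fst (cotangentToBase f ≫ f) (geometricPt t) z ∈ Z
    rw [hz]
    exact hη.1
  -- A generic point w of the fibre above z maps to a generisation of η inside Z, which is η itself
  -- by maximality.
  obtain ⟨w, hw, hwz⟩ := exists_maxPts_specializes (fibre f (geometricPt t) Z).isClosed hzZ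
  refine ⟨w, hw, hη.2 _ hw.1 ?_⟩
  rw [← hz]
  exact hwz.map (Scheme.Hom.continuous _)

/-- Residue fields at a point of a geometric fibre. -/
lemma exists_residueField_square {η : cotangent f} {t : Y} (ht : f (cotangentToBase f η) = t)
    {w : cotangentFibre f (geometricPt t)}
    (hw : pullback.fst (cotangentToBase f ≫ f) (geometricPt t) w = η) :
    ∃ (b : κ t →+* κ η) (g : κ η →+* κ w) (h : AlgebraicClosure (κ t) →+* κ w),
      g.comp b = h.comp (algebraMap _ _) ∧
      Spec.map (CommRingCat.ofHom b) ≫ κpt t = κpt η ≫ cotangentToBase f ≫ f ∧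
      Spec.map (CommRingCat.ofHom g) ≫ κpt η = κpt w ≫ pullback.fst _ _ ∧
      Spec.map (CommRingCat.ofHom h) = κpt w ≫ pullback.snd _ _ := by
  obtain ⟨b, hb⟩ := exists_κ_desc (κpt η ≫ cotangentToBase f ≫ f) (x := t) (by
    rw [pt_comp, pt_κpt]; exact ht)
  obtain ⟨g, hg⟩ := exists_κ_desc (κpt w ≫ pullback.fst (cotangentToBase f ≫ f) (geometricPt t))
    (x := η) (by rw [pt_comp, pt_κpt]; exact hw)
  obtain ⟨h, hh⟩ : ∃ h : CommRingCat.of (AlgebraicClosure (κ t)) ⟶ CommRingCat.of (κ w), 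
      Spec.map h = κpt w ≫ pullback.snd (cotangentToBase f ≫ f) (geometricPt t) :=
    ⟨_, Spec.map_preimage _⟩
  refine ⟨b, g, h.hom, ?_, hb, hg, hh⟩
  have : CommRingCat.ofHom b ≫ CommRingCat.ofHom g =
      CommRingCat.ofHom (algebraMap (κ t) (AlgebraicClosure (κ t))) ≫ h := by
    apply Spec.map_injective
    rw [← cancel_mono (κpt t), Spec.map_comp, Spec.map_comp, Category.assoc, Category.assoc, hb,
      ← Category.assoc, hg, hh, Category.assoc, pullback.condition, Category.assoc]
    rfl
  exact congrArg CommRingCat.Hom.hom this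

end GeometricPoints

section Dimension

variable {k : Type u} [Field k] [CharZero k] {M S : Scheme.{u}}
    {π : M ⟶ S} {σ : S ⟶ Spec (.of k)} [Smooth π] [Smooth σ] {m d : ℕ}

lemma charZero_κ {X : Scheme.{u}} (w : X ⟶ Spec (.of k)) (x : X) : CharZero (κ x) :=
  charZero_of_injective_ringHom (f := (show k →+* κ x from (Spec.preimage (κpt x ≫ w)).hom))
    (RingHom.injective _)

lemma ptDim_eq_trdegHom {X : Scheme.{u}} {K : Type u} [Field K] (w : X ⟶ Spec (.of K)) (x : X)
    {f : K →+* κ x} (hf : Spec.map (CommRingCat.ofHom f) = κpt x ≫ w) : ptDim w x = trdegHom f := by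
  rw [ptDim, ← hf, Spec.preimage_map]
  rfl

lemma trdegHom_algebraicClosure (E : Type u) [Field E] :
    trdegHom (algebraMap E (AlgebraicClosure E)) = 0 := by
  rw [trdegHom_algebraMap, trdeg_eq_zero, map_zero]

/-- With t the image of η: m ≤ trdeg κ(η)/k = trdeg κ(t)/k + trdeg κ(η)/κ(t). The last term is at
most the dimension of a component of the geometric fibre over t, that is n = m - d. -/
lemma le_ptDim_of_mem_maxPts (hM : SmoothOfRelativeDimension m (π ≫ σ))
    (hS : SmoothOfRelativeDimension d σ) {Lrel : TopologicalSpace.Closeds (cotangent π)}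
    (hlag : IsRelativeLagrangian π Lrel) {η : cotangent π}
    (hη : η ∈ maxPts (Lrel : Set (cotangent π))) : d ≤ ptDim σ (π (cotangentToBase π η)) := by
  obtain ⟨t, ht⟩ : ∃ t, π (cotangentToBase π η) = t := ⟨_, rfl⟩
  obtain ⟨n, hnd, hn⟩ := exists_relativeDimension hM hS (cotangentToBase π η)
  obtain ⟨w, hw, hwη⟩ := exists_maxPts_fibre hη ht
  obtain ⟨b, g, h, hcomm, hb, hg, hh⟩ := exists_residueField_square ht hwη
  rw [ht]
  have : CharZero (κ t) := charZero_κ σ t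
  have : CharZero (AlgebraicClosure (κ t)) :=
    charZero_of_injective_algebraMap (algebraMap (κ t) _).injective
  -- the dimension of the component of the fibre
  have h1 : ptDim (pullback.snd (cotangentToBase π ≫ π) (geometricPt t)) w ≤ n := by
    have h2 := (hlag.fibre_isLagrangian _ (geometricPt t)).dim_eq (closure {w})
      ((mem_components_iff (fibre π (geometricPt t) Lrel).isClosed _).mpr ⟨w, hw, rfl⟩)
    rw [topologicalKrullDim_closure (pullback.snd (cotangentToBase π ≫ π) (geometricPt t))] at h2
    have h3 : SmoothOfRelativeDimension n (pullback.snd π (geometricPt t)) :=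
      (smoothOfRelativeDimension_isStableUnderBaseChange n).of_isPullback
        (IsPullback.of_hasPullback π (geometricPt t)) hn
    have h4 := topologicalKrullDim_le_of_smooth h3
    rw [← h2] at h4
    exact_mod_cast h4
  -- the dimension of the component
  have h5 : m ≤ ptDim (cotangentToBase π ≫ π ≫ σ) η := by
    have h2 := hlag.dim_eq (closure {η}) ((mem_components_iff Lrel.isClosed _).mpr ⟨η, hη, rfl⟩)
    rw [topologicalKrullDim_closure (cotangentToBase π ≫ π ≫ σ)] at h2
    have h4 := le_topologicalKrullDim_of_smooth hM (cotangentToBase π η)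
    rw [← h2] at h4
    exact_mod_cast h4
  obtain ⟨a, ha⟩ : ∃ a : CommRingCat.of k ⟶ CommRingCat.of (κ t), Spec.map a = κpt t ≫ σ :=
    ⟨_, Spec.map_preimage _⟩
  have h6 : ptDim σ t = trdegHom a.hom := ptDim_eq_trdegHom σ t ha
  have h7 : ptDim (cotangentToBase π ≫ π ≫ σ) η = trdegHom (b.comp a.hom) := by
    refine ptDim_eq_trdegHom _ η ?_
    rw [CommRingCat.ofHom_comp, Spec.map_comp, CommRingCat.ofHom_hom, ha, ← Category.assoc, hb]
    simp only [Category.assoc]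
  have h8 := ptDim_eq_trdegHom _ w hh
  -- Both degrees are compared with that of κ(w) over κ(t); passing to the algebraic closure of κ(t)
  -- costs nothing.
  have h9 : trdegHom b ≤ trdegHom h := by
    refine (trdegHom_le b g).trans_eq ?_
    rw [hcomm, trdegHom_add, trdegHom_algebraicClosure, zero_add]
  rw [h7, trdegHom_add, ← h6] at h5
  rw [h8] at h1
  have h10 : (m : ℕ∞) ≤ ptDim σ t + n := h5.trans (add_le_add_right (h9.trans h1) _)
  rw [← hnd, Nat.cast_add, add_comm] at h10
  exact (ENat.add_le_add_iff_right (ENat.natCast_ne_top n)).mp h10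

/-- The image in S already has transcendence degree at least d, the maximum possible on S, while a
proper generisation would have a larger one. -/
lemma closure_mem_irreducibleComponents (hM : SmoothOfRelativeDimension m (π ≫ σ))
    (hS : SmoothOfRelativeDimension d σ) {Lrel : TopologicalSpace.Closeds (cotangent π)}
    (hlag : IsRelativeLagrangian π Lrel) {η : cotangent π}
    (hη : η ∈ maxPts (Lrel : Set (cotangent π))) :
    closure {π (cotangentToBase π η)} ∈ irreducibleComponents S := by
  have h1 : closure {π (cotangentToBase π η)} ∈ components (Set.univ : Set S) := by
    refine (mem_components_iff isClosed_univ _).mpr ⟨_, ⟨trivial, fun y _ hy ↦ ?_⟩, rfl⟩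
    by_contra hne
    have h2 := ptDim_lt_of_specializes σ hy hne
    have h3 := le_ptDim_of_mem_maxPts hM hS hlag hη
    exact absurd (h3.trans_lt h2) (not_lt.mpr (ptDim_le_of_smooth hS y))
  simpa [components, irreducibleComponents] using h1

/-- Derivations dual to coordinates of the base. -/
lemma exists_dual_derivation_of_mem_maxPts (hM : SmoothOfRelativeDimension m (π ≫ σ))
    (hS : SmoothOfRelativeDimension d σ) {Lrel : TopologicalSpace.Closeds (cotangent π)}
    (hlag : IsRelativeLagrangian π Lrel) {η : cotangent π}
    (hη : η ∈ maxPts (Lrel : Set (cotangent π))) {F : Type u} [Field F]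
    (q : Spec (.of F) ⟶ cotangent π) (hq : pt q = η) {i : Chart π} (φ : i.ring →+* F)
    (hφ : Spec.map (CommRingCat.ofHom φ) ≫ cotangentChart π i = q)
    (cA : Frame (i.base σ).A (i.base σ).B d) :
    ∃ δ : Fin d → Derivation ℤ F F,
      (∀ l (r : (i.comp σ).A), δ l (φ (algebraMap i.B i.ring
        (algebraMap (i.comp σ).A (i.comp σ).B r))) = 0) ∧
      ∀ l j, δ l (φ (algebraMap i.B i.ring (algebraMap i.A i.B (cA.x j)))) =
        if l = j then 1 else 0 := by
  obtain ⟨e, he, -, hj⟩ := (i.base σ).exists_field_equiv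
    (show π (cotangentToBase π (pt q)) ∈ i.U from i.le (mem_V_of_chart_hom hφ))
  let _ : Algebra k (i.base σ).B := ((algebraMap (i.base σ).A (i.base σ).B).comp e).toAlgebra
  let ρ : (i.base σ).B →+* F := (φ.comp (algebraMap i.B i.ring)).comp (algebraMap i.A i.B)
  have hprime : (RingHom.ker ρ).IsPrime := RingHom.ker_isPrime ρ
  let p : PrimeSpectrum (i.base σ).B := ⟨RingHom.ker ρ, hprime⟩
  have : p.asIdeal.IsPrime := hprime
  have hp : (i.base σ).isAffineOpen_V.fromSpec p = π (cotangentToBase π η) := by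
    have h1 := congrArg pt (chart_hom_toBase_comp hφ)
    rw [pt_comp, pt_comp, hq] at h1
    refine Eq.trans ?_ h1.symm
    exact congrArg _ (PrimeSpectrum.ext (pt_specMap ρ).symm)
  have hd := le_ptDim_of_mem_maxPts hM hS hlag hη
  rw [← hp, ptDim_chart σ _ hj, ← trdeg_residueField] at hd
  have hd' : (d : Cardinal) ≤ Algebra.trdeg k p.asIdeal.ResidueField := by simpa using hd
  -- Dual derivations are first found on the residue field of the image in S, where the y_i control
  -- all derivations and the degree is at least d. They are then extended to F.
  obtain ⟨δ, hδk, hδ⟩ := exists_dual_derivation (K := k) 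
    (fun j ↦ algebraMap (i.base σ).B p.asIdeal.ResidueField (cA.x j)) (fun D hD hDy ↦ by
      refine derivation_eq_zero_of_div _ (exists_eq_div_residueField p.asIdeal) D fun b ↦ ?_
      rw [cA.chain_rule (algebraMap (i.base σ).B p.asIdeal.ResidueField) D (fun a ↦ ?_) b]
      · exact Finset.sum_eq_zero fun j _ ↦ by rw [hDy, mul_zero]
      · obtain ⟨a, rfl⟩ := he a
        exact hD a) hd'
  have : CharZero p.asIdeal.ResidueField :=
    charZero_of_injective_algebraMap (algebraMap k p.asIdeal.ResidueField).injective
  have hu : p.asIdeal.primeCompl ≤ (IsUnit.submonoid F).comap ρ := fun b hb ↦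
    (isUnit_iff_ne_zero.mpr hb : IsUnit (ρ b))
  let γ : p.asIdeal.ResidueField →+* F := Ideal.ResidueField.lift p.asIdeal ρ le_rfl hu
  have hγ (b) : γ (algebraMap _ _ b) = ρ b := Ideal.ResidueField.lift_algebraMap _ _ _ _ _
  choose δ' hδ' using fun l ↦ exists_derivation_extension_field γ (δ l)
  refine ⟨δ', fun l r ↦ ?_, fun l j ↦ ?_⟩
  · obtain ⟨a, rfl⟩ := he r
    have h1 : φ (algebraMap i.B i.ring (algebraMap (i.comp σ).A (i.comp σ).B (e a))) =
        ρ (algebraMap (i.base σ).A (i.base σ).B (e a)) := by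
      refine congrArg (φ.comp (algebraMap i.B i.ring)) ?_
      exact (DFunLike.congr_fun (congrArg CommRingCat.Hom.hom
        (Scheme.Hom.appLE_comp_appLE π σ ⊤ i.U i.V le_top i.le)) (e a)).symm
    rw [h1, ← hγ, hδ']
    rw [show algebraMap (i.base σ).B p.asIdeal.ResidueField
      (algebraMap (i.base σ).A (i.base σ).B (e a)) = algebraMap k _ a from rfl, hδk, map_zero]
  · change δ' l (ρ (cA.x j)) = _
    rw [← hγ, hδ', hδ, apply_ite γ, map_one, map_zero]

end Dimension

end

/-! ### Reduced structures, generic smoothness, and isotropy at all smooth points. -/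

noncomputable section

section Reduced

variable {W : Scheme.{u}} (Z : TopologicalSpace.Closeds W)

instance : IsReduced (reduced Z) := by
  let I := Scheme.IdealSheafData.vanishingIdeal Z
  have h (U : W.affineOpens) : _root_.IsReduced (Γ(W, U) ⧸ I.ideal U) := by
    rw [← Ideal.isRadical_iff_quotient_reduced]
    intro a ha
    obtain ⟨n, hn⟩ := ha
    rw [Scheme.IdealSheafData.vanishingIdeal_ideal] at hn ⊢
    rw [PrimeSpectrum.mem_vanishingIdeal] at hn ⊢
    exact fun x hx ↦ x.2.mem_of_pow_mem n (hn x hx)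
  have h' (U : I.subschemeCover.openCover.I₀) : IsReduced (I.subschemeCover.openCover.X U) :=
    have := h U
    inferInstanceAs (IsReduced (Spec (.of (Γ(W, U.1) ⧸ I.ideal U))))
  exact @IsReduced.of_openCover (reduced Z) I.subschemeCover.openCover h'

lemma range_reducedι : Set.range (reducedι Z) = Z := by
  rw [Scheme.IdealSheafData.range_subschemeι, Scheme.IdealSheafData.coe_support_vanishingIdeal]

lemma exists_reduced_maxPt {z : W} (hz : z ∈ maxPts (Z : Set W)) :
    ∃ z' : reduced Z, reducedι Z z' = z ∧ z' ∈ maxPts (Set.univ : Set (reduced Z)) := by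
  obtain ⟨z', rfl⟩ : z ∈ Set.range (reducedι Z) := by rw [range_reducedι]; exact hz.1
  refine ⟨z', rfl, trivial, fun y _ hy ↦ (reducedι Z).isClosedEmbedding.injective ?_⟩
  exact hz.2 _ (by rw [← range_reducedι]; exact ⟨y, rfl⟩) (hy.map (Scheme.Hom.continuous _))

end Reduced

/-- The generic points lying in U are dense and locally finite, so one of them specialises to x;
maximality of x makes them equal. -/
lemma mem_of_dense_of_mem_maxPts {X : Scheme.{u}} [IsLocallyNoetherian X] {U : Set X}
    (hU : IsOpen U) (hd : Dense U) {x : X} (hx : x ∈ maxPts (Set.univ : Set X)) : x ∈ U := by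
  obtain ⟨V, hV, hxV⟩ : ∃ V : X.Opens, IsAffineOpen V ∧ x ∈ V := by
    obtain ⟨_, ⟨V, hV, rfl⟩, hxV, -⟩ :=
      X.isBasis_affineOpens.exists_subset_of_mem_open (Set.mem_univ x) isOpen_univ
    exact ⟨V, hV, hxV⟩
  have : IsNoetherianRing Γ(X, V) := IsLocallyNoetherian.component_noetherian ⟨V, hV⟩
  have hf := finite_maxPts_inter_range hV.fromSpec (Z := (Set.univ : Set X)) isClosed_univ
  rw [hV.range_fromSpec] at hf
  have h1 : U ⊆ closure (maxPts (Set.univ : Set X) ∩ U) := fun y hy ↦ by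
    obtain ⟨η, hη, hηy⟩ := exists_maxPts_specializes isClosed_univ (Set.mem_univ y)
    exact hηy.mem_closed isClosed_closure (subset_closure ⟨hη, hηy.mem_open hU hy⟩)
  have h2 : x ∈ closure (maxPts (Set.univ : Set X) ∩ U) :=
    closure_minimal h1 isClosed_closure (hd x)
  obtain ⟨η, hη, hηx⟩ := exists_specializes_of_mem_closure V.2
    (hf.subset (Set.inter_subset_inter_right _ Set.inter_subset_left)) hxV h2
  rw [← hx.2 η trivial hηx]
  exact hη.2

/-- The smooth locus of a reduced scheme over a perfect field is open and dense. -/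
lemma isSmoothPoint_of_mem_maxPts {K : Type u} [Field K] [PerfectField K] {W : Scheme.{u}}
    [IsReduced W] (w : W ⟶ Spec (.of K)) [LocallyOfFinitePresentation w] {x : W}
    (hx : x ∈ maxPts (Set.univ : Set W)) : IsSmoothPoint w x := by
  have := LocallyOfFiniteType.isLocallyNoetherian w
  refine ⟨w.smoothLocus, mem_of_dense_of_mem_maxPts w.smoothLocus.2
    w.dense_smoothLocus_of_perfectField hx, ?_⟩
  rw [← Scheme.Hom.smoothLocus_eq_top_iff, ← Scheme.Hom.preimage_smoothLocus_eq]
  ext y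
  simp

section DualNumbers

variable {B S : Type*} [CommRing B] [CommRing S]

/-- The ring homomorphism to the dual numbers given by a ring homomorphism and a derivation. -/
def dualNumberHom (ψ : B →+* S) (D : Derivation ℤ B B) : B →+* DualNumber S where
  toFun b := TrivSqZeroExt.inl (ψ b) + TrivSqZeroExt.inr (ψ (D b))
  map_one' := by simp
  map_zero' := by simp
  map_add' x y := by
    rw [map_add, map_add, map_add, TrivSqZeroExt.inl_add, TrivSqZeroExt.inr_add, add_add_add_comm]
  map_mul' x y := by
    refine TrivSqZeroExt.ext ?_ ?_
    · simp
    · simp [mul_comm]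

lemma snd_dualNumberHom (ψ : B →+* S) (D : Derivation ℤ B B) (b : B) :
    (dualNumberHom ψ D b).snd = ψ (D b) := by
  simp [dualNumberHom]

lemma fst_dualNumberHom (ψ : B →+* S) (D : Derivation ℤ B B) (b : B) :
    (dualNumberHom ψ D b).fst = ψ b := by
  simp [dualNumberHom]

end DualNumbers

/-- Nullstellensatz: a reduced algebra of finite type has zero Jacobson radical, and over an
algebraically closed field every maximal ideal is the kernel of a K-point. -/
lemma eq_zero_of_forall_algHom {K B : Type*} [Field K] [IsAlgClosed K] [CommRing B] [Algebra K B]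
    [Algebra.FiniteType K B] [_root_.IsReduced B] {b : B} (h : ∀ ψ : B →ₐ[K] K, ψ b = 0) :
    b = 0 := by
  have : IsJacobsonRing B := isJacobsonRing_of_finiteType (A := K)
  have h1 : (⊥ : Ideal B).jacobson = ⊥ :=
    IsJacobsonRing.out this (by
      rw [Ideal.isRadical_iff_quotient_reduced]
      exact isReduced_of_injective (RingEquiv.quotientBot B) (RingEquiv.quotientBot B).injective)
  rw [← Ideal.mem_bot, ← h1, Ideal.jacobson, Ideal.mem_sInf]
  rintro m ⟨-, hm⟩
  let _ := Ideal.Quotient.field m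
  have := finite_of_finite_type_of_isJacobsonRing K (B ⧸ m)
  let e := AlgEquiv.ofBijective (Algebra.ofId K (B ⧸ m))
    (IsAlgClosed.algebraMap_bijective_of_isIntegral (k := K) (K := B ⧸ m))
  have h2 := h (e.symm.toAlgHom.comp (Ideal.Quotient.mkₐ K m))
  rw [← Ideal.Quotient.eq_zero_iff_mem]
  exact e.symm.injective (h2.trans (map_zero _).symm)

section Isotropic

variable {X Y : Scheme.{u}} {f : X ⟶ Y} [Smooth f]

/-- Coordinates on a chart from a frame. -/
def Frame.coordinates {i : Chart f} {n : ℕ} (c : Frame i.A i.B n) : i.Coordinates n where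
  x := c.x
  basis := c.basis
  basis_apply := c.basis_apply

variable {K : Type u} [Field K] {W : Scheme.{u}} {w : W ⟶ Spec (.of K)} {h : W ⟶ cotangent f}

/-- Smooth points have affine neighbourhoods with coordinates, mapping to a chart. -/
lemma IsSmoothPoint.exists_chart {x : W} (hx : IsSmoothPoint w x) {i : Chart f}
    (hi : h x ∈ Set.range (cotangentChart f i)) :
    ∃ (A O : Type u) (_ : CommRing A) (_ : CommRing O) (_ : Algebra A O) (e : K →+* A) (r : ℕ)
      (_ : Frame A O r) (j : Spec (.of O) ⟶ W) (Φ : i.ring →+* O),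
      IsOpenImmersion j ∧ x ∈ Set.range j ∧ (∀ y, IsSmoothPoint w (j y)) ∧
      Function.Surjective e ∧ ((algebraMap A O).comp e).FiniteType ∧
      (IsReduced W → _root_.IsReduced O) ∧
      j ≫ w = Spec.map (CommRingCat.ofHom ((algebraMap A O).comp e)) ∧
      Spec.map (CommRingCat.ofHom Φ) ≫ cotangentChart f i = j ≫ h := by
  obtain ⟨U, hxU, hU⟩ := hx
  obtain ⟨o, r, z, hxo, hoi⟩ : ∃ (o : Chart (U.ι ≫ w)) (r : ℕ) (_ : Frame o.A o.B r),
      (⟨x, hxU⟩ : U) ∈ o.V ∧ ∀ y ∈ o.V, (U.ι ≫ h) y ∈ Set.range (cotangentChart f i) := by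
    obtain ⟨o, r, z, hxo, -⟩ := exists_frame (U.ι ≫ w) ⟨x, hxU⟩
    obtain ⟨o', hxo', hle, hle'⟩ := exists_chart_le (U.ι ≫ w) ⟨x, hxU⟩
      (o.V ⊓ (U.ι ≫ h) ⁻¹ᵁ (cotangentChart f i).opensRange) ⟨hxo, hi⟩ o.U (o.le hxo)
    obtain ⟨z'⟩ := Chart.restrictFrame (i := o') (j := o) ⟨hle.trans inf_le_left, hle'⟩ z
    exact ⟨o', r, z', hxo', fun y hy ↦ (hle hy).2⟩
  obtain ⟨e, he, -, hoj⟩ := o.exists_field_equiv hxo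
  let j : Spec (.of o.B) ⟶ W := o.isAffineOpen_V.fromSpec ≫ U.ι
  obtain ⟨Φ, hΦ⟩ : ∃ Φ : i.ring →+* o.B,
      Spec.map (CommRingCat.ofHom Φ) ≫ cotangentChart f i = j ≫ h := by
    have hr : Set.range (j ≫ h) ⊆ Set.range (cotangentChart f i) := by
      rintro _ ⟨y, rfl⟩
      refine hoi (o.isAffineOpen_V.fromSpec y) ?_
      rw [← SetLike.mem_coe, ← o.isAffineOpen_V.range_fromSpec]
      exact ⟨y, rfl⟩
    refine ⟨(Spec.preimage (IsOpenImmersion.lift (cotangentChart f i) (j ≫ h) hr)).hom, ?_⟩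
    rw [CommRingCat.ofHom_hom, Spec.map_preimage, IsOpenImmersion.lift_fac]
  refine ⟨o.A, o.B, inferInstance, inferInstance, inferInstance, e, r, z, j, Φ, inferInstance, ?_,
    fun y ↦ ⟨U, (o.isAffineOpen_V.fromSpec y).2, hU⟩, he, ?_, fun _ ↦ inferInstance, ?_, hΦ⟩
  · obtain ⟨y, hy⟩ : (⟨x, hxU⟩ : U) ∈ Set.range o.isAffineOpen_V.fromSpec := by
      rw [o.isAffineOpen_V.range_fromSpec]; exact hxo
    exact ⟨y, (congrArg U.ι hy).trans rfl⟩
  · have h1 : (algebraMap o.A o.B).FiniteType :=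
      RingHom.FiniteType.of_finitePresentation
        ((U.ι ≫ w).smooth_appLE o.isAffineOpen_U o.isAffineOpen_V o.le).finitePresentation
    exact h1.comp (RingHom.FiniteType.of_surjective e he)
  · rw [Category.assoc]
    exact hoj

variable [IsAlgClosed K] [IsReduced W]

/-- If the symplectic form vanishes on tangent vectors at closed smooth points, then it vanishes at
all smooth points. -/
lemma symplectic_eq_zero_of_isSmoothPoint (hv : SymplecticFormVanishes f w h) {x : W}
    (hx : IsSmoothPoint w x) {i : Chart f} {n : ℕ} (c : Frame i.A i.B n)
    (hi : h x ∈ Set.range (cotangentChart f i)) {F : Type u} [Field F] (q : Spec (.of F) ⟶ W)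
    (hq : pt q = x) (a : K →+* F) (ha : Spec.map (CommRingCat.ofHom a) = q ≫ w)
    {φ : i.ring →+* F} (hφ : Spec.map (CommRingCat.ofHom φ) ≫ cotangentChart f i = q ≫ h)
    (δ₁ δ₂ : Derivation ℤ F F) (hδ₁ : ∀ y, δ₁ (a y) = 0) (hδ₂ : ∀ y, δ₂ (a y) = 0) :
    c.symplectic φ δ₁ δ₂ = 0 := by
  obtain ⟨A, O, _, _, _, e, r, z, j, Φ, _, hxj, hsm, he, hft, hred, hj, hΦ⟩ := hx.exists_chart hi
  have := hred inferInstance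
  let _ : Algebra K O := ((algebraMap A O).comp e).toAlgebra
  have : Algebra.FiniteType K O := hft
  change j ≫ w = Spec.map (CommRingCat.ofHom (algebraMap K O)) at hj
  let D (l : Fin r) : Derivation ℤ O O :=
    ((z.v l).compDer (KaehlerDifferential.D A O)).restrictScalars ℤ
  have hD (l) (y : K) : D l (algebraMap K O y) = 0 := by
    change z.v l (KaehlerDifferential.D A O (algebraMap A O (e y))) = 0
    simp
  let ξ (s : Fin n) : i.ring := SymmetricAlgebra.ι i.B _ (c.v s)
  let X' (s : Fin n) : i.ring := algebraMap i.B _ (c.x s)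
  -- The function ω(D_l, D_l') vanishes because it does so at every K-point ψ, where ψ + ε ψ ∘ D_l
  -- and ψ + ε ψ ∘ D_l' are tangent vectors to which the hypothesis applies.
  have key (l l' : Fin r) : ∑ s, (D l (Φ (ξ s)) * D l' (Φ (X' s)) -
      D l' (Φ (ξ s)) * D l (Φ (X' s))) = 0 := by
    refine eq_zero_of_forall_algHom (K := K) fun ψ ↦ ?_
    let τ (l) : O →+* DualNumber K := dualNumberHom ψ.toRingHom (D l)
    let v (l) : TangentVector w :=
      { hom := Spec.map (CommRingCat.ofHom (τ l)) ≫ j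
        hom_comp := by
          rw [Category.assoc, hj, ← Spec.map_comp, ← CommRingCat.ofHom_comp]
          congr 2
          ext y
          · refine (fst_dualNumberHom _ _ _).trans ?_
            exact ψ.commutes y
          · refine (snd_dualNumberHom _ _ _).trans ?_
            rw [hD, map_zero]
            rfl }
    have hpt (l) : (v l).point = Spec.map (CommRingCat.ofHom ψ.toRingHom) ≫ j := by
      rw [TangentVector.point, ← Category.assoc, ← Spec.map_comp, ← CommRingCat.ofHom_comp]
      congr 3
      ext y
      exact fst_dualNumberHom _ _ _
    have hs := hv (v l) (v l') ((hpt l).trans (hpt l').symm) (fun t ↦ ?_) i n c.coordinates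
      ((τ l).comp Φ) ((τ l').comp Φ) ?_ ?_
    · simpa [Chart.Coordinates.symplecticForm, Chart.Coordinates.momentum,
        Chart.Coordinates.position, Frame.coordinates, Frame.basis_coord, τ, snd_dualNumberHom,
        ξ, X'] using hs
    · rw [hpt]
      exact hsm _
    · rw [CommRingCat.ofHom_comp, Spec.map_comp, Category.assoc, hΦ, ← Category.assoc]
    · rw [CommRingCat.ofHom_comp, Spec.map_comp, Category.assoc, hΦ, ← Category.assoc]
  obtain ⟨ρ, hρ⟩ : ∃ ρ : O →+* F, Spec.map (CommRingCat.ofHom ρ) ≫ j = q := by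
    refine exists_lift_of_mem_range j q ?_
    rwa [hq]
  have hφΦ : φ = ρ.comp Φ := by
    refine eq_of_chart_hom hφ ?_
    rw [CommRingCat.ofHom_comp, Spec.map_comp, Category.assoc, hΦ, ← Category.assoc, hρ]
  have hρa (y : K) : ρ (algebraMap K O y) = a y := by
    have : CommRingCat.ofHom (algebraMap K O) ≫ CommRingCat.ofHom ρ = CommRingCat.ofHom a := by
      apply Spec.map_injective
      rw [Spec.map_comp, ← hj, ← Category.assoc, hρ, ha]
    exact DFunLike.congr_fun (congrArg CommRingCat.Hom.hom this) y
  have hchain (δ : Derivation ℤ F F) (hδ : ∀ y, δ (a y) = 0) (b : O) :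
      δ (ρ b) = ∑ l, ρ (D l b) * δ (ρ (z.x l)) := by
    refine z.chain_rule ρ δ (fun y ↦ ?_) b
    obtain ⟨y, rfl⟩ := he y
    exact (congrArg δ (hρa y)).trans (hδ y)
  -- By the chain rule in the coordinates z of W, the value of ω on any two derivations over K is a
  -- combination of the functions ω(D_l, D_l').
  have h1 : c.symplectic φ δ₁ δ₂ = ∑ l, ∑ l', ρ (∑ s, (D l (Φ (ξ s)) * D l' (Φ (X' s)) -
      D l' (Φ (ξ s)) * D l (Φ (X' s)))) * (δ₁ (ρ (z.x l)) * δ₂ (ρ (z.x l'))) := by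
    simp only [Frame.symplectic, hφΦ, RingHom.comp_apply, map_sum, Finset.sum_mul]
    refine Eq.trans ?_ ((Finset.sum_congr rfl fun i _ ↦ Finset.sum_comm).trans Finset.sum_comm).symm
    refine Finset.sum_congr rfl fun s _ ↦ ?_
    rw [hchain δ₁ hδ₁ (Φ (SymmetricAlgebra.ι i.B _ (c.v s))), hchain δ₁ hδ₁ (Φ (algebraMap i.B _ (c.x s))),
      hchain δ₂ hδ₂ (Φ (SymmetricAlgebra.ι i.B _ (c.v s))), hchain δ₂ hδ₂ (Φ (algebraMap i.B _ (c.x s))),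
      Finset.sum_mul_sum, mul_comm (∑ l, _) (∑ l, ρ (D l (Φ (algebraMap i.B _ (c.x s)))) * _),
      Finset.sum_mul_sum, ← Finset.sum_sub_distrib]
    refine Finset.sum_congr rfl fun l _ ↦ ?_
    rw [← Finset.sum_sub_distrib]
    refine Finset.sum_congr rfl fun l' _ ↦ ?_
    simp only [map_sub, map_mul, ξ, X']
    ring
  rw [h1]
  exact Finset.sum_eq_zero fun l _ ↦ Finset.sum_eq_zero fun l' _ ↦ by
    rw [key, map_zero, zero_mul]

end Isotropic

end

/-! ### Isotropy at generic points. -/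

noncomputable section

/-- κ(x) embeds into the residue field of the prime ker ψ, compatibly with the maps from B, and the
latter consists of fractions of images of B. The denominator is not claimed to be nonzero. -/
lemma exists_eq_div_κ {X : Scheme.{u}} {B : Type u} [CommRing B] (j : Spec (.of B) ⟶ X)
    [IsOpenImmersion j] {x : X} {ψ : B →+* κ x} (h : Spec.map (CommRingCat.ofHom ψ) ≫ j = κpt x)
    (y : κ x) : ∃ b c, y = ψ b / ψ c := by
  have hp : (RingHom.ker ψ).IsPrime := RingHom.ker_isPrime ψ
  let ρ : B →+* (RingHom.ker ψ).ResidueField := algebraMap _ _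
  obtain ⟨α, hα⟩ := exists_κ_desc (Spec.map (CommRingCat.ofHom ρ) ≫ j) (x := x) (by
    refine Eq.trans ?_ ((congrArg pt h).trans (pt_κpt x))
    rw [pt_comp, pt_comp]
    congr 1
    refine PrimeSpectrum.ext ?_
    rw [pt_specMap, pt_specMap]
    exact Ideal.ker_algebraMap_residueField _)
  have hαψ : α.comp ψ = ρ := by
    rw [← h, ← Category.assoc, cancel_mono, ← Spec.map_comp, ← CommRingCat.ofHom_comp] at hα
    exact congrArg CommRingCat.Hom.hom (Spec.map_injective hα)
  obtain ⟨b, c, hbc⟩ := exists_eq_div_residueField (RingHom.ker ψ) (α y)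
  refine ⟨b, c, α.injective ?_⟩
  rw [map_div₀, hbc]
  exact congrArg₂ (· / ·) (DFunLike.congr_fun hαψ b).symm (DFunLike.congr_fun hαψ c).symm

lemma locallyOfFinitePresentation_of_isLocallyNoetherian {X Y : Scheme.{u}} (f : X ⟶ Y)
    [IsLocallyNoetherian Y] [LocallyOfFiniteType f] : LocallyOfFinitePresentation f := by
  rw [HasRingHomProperty.iff_appLE (P := @LocallyOfFinitePresentation)]
  intro U V e
  have := IsLocallyNoetherian.component_noetherian U
  exact RingHom.FinitePresentation.of_finiteType.mp
    ((HasRingHomProperty.iff_appLE (P := @LocallyOfFiniteType)).mp inferInstance U V e)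

section Isotropic

variable {X Y : Scheme.{u}} {f : X ⟶ Y} [Smooth f]

/-- The generic point z is a smooth point of the reduced scheme Z. Derivations of κ(z) are extended
to the residue field taken in Z, where the previous vanishing result applies. -/
lemma symplectic_eq_zero_of_mem_maxPts {K : Type u} [Field K] [IsAlgClosed K] [CharZero K]
    {T : Scheme.{u}} (w : T ⟶ Spec (.of K)) [LocallyOfFiniteType w] (h : T ⟶ cotangent f)
    {Z : TopologicalSpace.Closeds T} (hv : SymplecticFormVanishes f (reducedι Z ≫ w) (reducedι Z ≫ h))
    {z : T} (hz : z ∈ maxPts (Z : Set T)) {i : Chart f} {n : ℕ} (c : Frame i.A i.B n)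
    {φ : i.ring →+* κ z} (hφ : Spec.map (CommRingCat.ofHom φ) ≫ cotangentChart f i = κpt z ≫ h)
    (a : K →+* κ z) (ha : Spec.map (CommRingCat.ofHom a) = κpt z ≫ w)
    (δ₁ δ₂ : Derivation ℤ (κ z) (κ z)) (hδ₁ : ∀ y, δ₁ (a y) = 0) (hδ₂ : ∀ y, δ₂ (a y) = 0) :
    c.symplectic φ δ₁ δ₂ = 0 := by
  have : LocallyOfFinitePresentation (reducedι Z ≫ w) :=
    locallyOfFinitePresentation_of_isLocallyNoetherian _
  have : CharZero (κ z) := charZero_of_injective_ringHom a.injective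
  obtain ⟨z', hz', hmax⟩ := exists_reduced_maxPt Z hz
  obtain ⟨β, hβ⟩ := exists_κ_desc (κpt z' ≫ reducedι Z) (x := z) (by rw [pt_comp, pt_κpt, hz'])
  obtain ⟨ε₁, hε₁⟩ := exists_derivation_extension_field β δ₁
  obtain ⟨ε₂, hε₂⟩ := exists_derivation_extension_field β δ₂
  have h1 : Spec.map (CommRingCat.ofHom (β.comp φ)) ≫ cotangentChart f i =
      κpt z' ≫ reducedι Z ≫ h := by
    rw [CommRingCat.ofHom_comp, Spec.map_comp, Category.assoc, hφ, ← Category.assoc, hβ,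
      Category.assoc]
  have h2 := symplectic_eq_zero_of_isSmoothPoint hv (isSmoothPoint_of_mem_maxPts _ hmax) c
    (by
      rw [← pt_κpt z', ← pt_comp, ← h1]
      exact ⟨_, (pt_comp _ _).symm⟩) (κpt z') (pt_κpt z') (β.comp a)
    (by rw [CommRingCat.ofHom_comp, Spec.map_comp, ha, ← Category.assoc, hβ, Category.assoc])
    h1 ε₁ ε₂ (fun y ↦ by rw [RingHom.comp_apply, hε₁, hδ₁, map_zero])
    (fun y ↦ by rw [RingHom.comp_apply, hε₂, hδ₂, map_zero])
  rw [c.symplectic_comp β φ δ₁ δ₂ ε₁ ε₂ hε₁ hε₂] at h2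
  exact β.injective (h2.trans (map_zero β).symm)

lemma IsLagrangian.isIsotropic {K : Type u} [Field K] [IsAlgClosed K] [CharZero K]
    {w : X ⟶ Spec (.of K)} [Smooth w] {Z : TopologicalSpace.Closeds (cotangent w)}
    (hZ : IsLagrangian w Z) {z : cotangent w} (hz : z ∈ maxPts (Z : Set (cotangent w))) :
    IsIsotropic (κpt z) := by
  intro i n c φ hφ δ₁ δ₂ hδ₁ hδ₂
  obtain ⟨e, -, he, -⟩ := i.exists_field_equiv (mem_V_of_chart_hom hφ)
  refine symplectic_eq_zero_of_mem_maxPts (cotangentToBase w ≫ w) (𝟙 _) (Z := Z)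
    (by rw [Category.comp_id]; exact hZ.isotropic) hz c (by rw [Category.comp_id, hφ])
    (((φ.comp (algebraMap i.B i.ring)).comp (algebraMap i.A i.B)).comp e) ?_ δ₁ δ₂
    (fun y ↦ hδ₁ _) (fun y ↦ hδ₂ _)
  rw [CommRingCat.ofHom_comp, Spec.map_comp, ← he, chart_hom_toBase_comp hφ]

/-- Isotropy is inherited from a generic point w of the geometric fibre lying over η: derivations of
κ(η) relative to S extend to κ(w), and the form is evaluated there. -/
lemma IsRelativeLagrangian.isIsotropic {Z : TopologicalSpace.Closeds (cotangent f)}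
    (hZ : IsRelativeLagrangian f Z) {η : cotangent f} [CharZero (κ η)]
    (hη : η ∈ maxPts (Z : Set (cotangent f))) : IsIsotropic (κpt η) := by
  intro i n c φ hφ δ₁ δ₂ hδ₁ hδ₂
  obtain ⟨w, hw, hwη⟩ := exists_maxPts_fibre hη rfl
  obtain ⟨b, g, h, hgb, hb, hg, hh⟩ := exists_residueField_square rfl hwη
  have h0 : CharZero (κ (f (cotangentToBase f η))) :=
    ⟨fun m n hmn ↦ by simpa using congrArg b hmn⟩
  have : CharZero (AlgebraicClosure (κ (f (cotangentToBase f η)))) :=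
    charZero_of_injective_algebraMap (algebraMap (κ (f (cotangentToBase f η))) _).injective
  have hx := i.le (mem_V_of_chart_hom hφ)
  rw [pt_κpt] at hx
  obtain ⟨ψ, hψ⟩ := exists_lift_of_mem_range i.isAffineOpen_U.fromSpec
    (κpt (f (cotangentToBase f η))) (by
      rw [pt_κpt, i.isAffineOpen_U.range_fromSpec]; exact hx)
  have hbψ : b.comp ψ = (φ.comp (algebraMap i.B i.ring)).comp (algebraMap i.A i.B) := by
    have h1 := chart_hom_toBase_comp hφ
    rw [← hb, ← hψ, ← Category.assoc, cancel_mono, ← Spec.map_comp, ← CommRingCat.ofHom_comp] at h1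
    exact congrArg CommRingCat.Hom.hom (Spec.map_injective h1)
  have hkill (δ : Derivation ℤ (κ η) (κ η)) (hδ : Chart.Kills φ δ) (y) : δ (b y) = 0 := by
    obtain ⟨p, q, rfl⟩ := exists_eq_div_κ _ hψ y
    have h1 (p) : δ (b (ψ p)) = 0 := (congrArg δ (DFunLike.congr_fun hbψ p)).trans (hδ p)
    rw [map_div₀, Derivation.leibniz_div, h1, h1]
    simp
  -- The extended derivation kills κ(t), hence also its algebraic closure, so it is a derivation
  -- over the base field of the geometric fibre.
  have hkill' (δ : Derivation ℤ (κ η) (κ η)) (hδ : Chart.Kills φ δ) (ε : Derivation ℤ (κ w) (κ w))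
      (hε : ∀ x, ε (g x) = g (δ x)) (y) : ε (h y) = 0 := by
    let _ : Algebra (κ (f (cotangentToBase f η))) (κ w) := (h.comp (algebraMap _ _)).toAlgebra
    refine derivation_eq_zero_of_isAlgebraic (K := κ (f (cotangentToBase f η))) ε (fun x ↦ ?_)
      ((Algebra.IsAlgebraic.isAlgebraic y).algHom ⟨h, fun _ ↦ rfl⟩)
    rw [show algebraMap _ (κ w) x = g (b x) from (DFunLike.congr_fun hgb x).symm, hε,
        hkill δ hδ, map_zero]
  obtain ⟨ε₁, hε₁⟩ := exists_derivation_extension_field g δ₁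
  obtain ⟨ε₂, hε₂⟩ := exists_derivation_extension_field g δ₂
  have h2 := symplectic_eq_zero_of_mem_maxPts _ _ (hZ.fibre_isLagrangian _ _).isotropic hw c
    (φ := g.comp φ)
    (by rw [CommRingCat.ofHom_comp, Spec.map_comp, Category.assoc, hφ, hg]) h hh ε₁ ε₂
    (hkill' δ₁ hδ₁ ε₁ hε₁) (hkill' δ₂ hδ₂ ε₂ hε₂)
  rw [c.symplectic_comp g φ δ₁ δ₂ ε₁ ε₂ hε₁ hε₂] at h2
  exact g.injective (h2.trans (map_zero g).symm)

end Isotropic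

end

/-! ### The scaling action, homogeneity, and vanishing of the Liouville form. -/

noncomputable section

section Scale

open LaurentPolynomial

/-- The variable of the ring of Laurent polynomials, as a unit. -/
def unitT (R : Type*) [CommRing R] : R[T;T⁻¹]ˣ := unitOfInvertible (T 1)

/-- A Laurent polynomial is zero over S exactly when its coefficients lie in ker φ; these then lie
in ker ψ, and every evaluation through ψ vanishes. -/
lemma eval₂_eq_zero_of_eval₂_C {R S S' : Type*} [CommRing R] [CommRing S] [CommRing S']
    (φ : R →+* S) (ψ : R →+* S') (t : S'ˣ) (h : ∀ r, φ r = 0 → ψ r = 0) (x : R[T;T⁻¹])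
    (hx : eval₂ (C.comp φ) (unitT S) x = 0) : eval₂ ψ t x = 0 := by
  obtain ⟨n, p, hp⟩ := exists_T_pow x
  have h1 : Polynomial.toLaurent (p.map φ) = 0 := by
    have h2 := congrArg (eval₂ (C.comp φ) (unitT S)) hp
    rw [map_mul, hx, zero_mul, eval₂_toLaurent] at h2
    rw [← h2, Polynomial.eval₂_eq_sum, Polynomial.map, Polynomial.eval₂_eq_sum, Polynomial.sum,
      Polynomial.sum, map_sum]
    refine Finset.sum_congr rfl fun i _ ↦ ?_
    rw [map_mul, map_pow, Polynomial.toLaurent_X, RingHom.comp_apply, Polynomial.toLaurent_C]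
    rfl
  rw [Polynomial.toLaurent_eq_zero] at h1
  have h3 : p.map ψ = 0 := by
    ext i
    have := congrArg (fun q ↦ q.coeff i) h1
    rw [Polynomial.coeff_map]
    exact h _ (by simpa using this)
  have h4 := congrArg (eval₂ ψ t) hp
  rw [eval₂_toLaurent, ← Polynomial.eval_map, h3, Polynomial.eval_zero, map_mul, eval₂_T] at h4
  exact (Units.mul_left_eq_zero _).mp h4.symm

variable {X Y : Scheme.{u}} {f : X ⟶ Y} {i : Chart f} {R : Type u} [CommRing R]

/-- A point of the cotangent bundle over a chart, with its covector multiplied by a unit. -/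
def Chart.scale (φ : i.ring →+* R) (t : Rˣ) : i.ring →+* R := (eval₂ φ t).comp i.scaling

namespace Chart

variable (φ : i.ring →+* R) (s t : Rˣ)

@[simp]
lemma scale_algebraMap (b : i.B) : scale φ t (algebraMap _ _ b) = φ (algebraMap _ _ b) := by
  rw [scale, RingHom.comp_apply, scaling_algebraMap, eval₂_C]

@[simp]
lemma scale_ι (v : VectorField i.A i.B) :
    scale φ t (SymmetricAlgebra.ι _ _ v) = φ (SymmetricAlgebra.ι _ _ v) * t := by
  rw [scale, RingHom.comp_apply, scaling_ι, eval₂_C_mul_T, zpow_one]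

lemma scale_one : scale φ 1 = φ :=
  CotangentRing.ringHom_ext _ _ (by simp) (by simp)

lemma scale_scale : scale (scale φ s) t = scale φ (s * t) :=
  CotangentRing.ringHom_ext _ _ (by simp) (by simp [mul_assoc])

lemma comp_scale {S : Type u} [CommRing S] (g : R →+* S) :
    g.comp (scale φ t) = scale (g.comp φ) (Units.map g t) :=
  CotangentRing.ringHom_ext _ _ (by simp) (by simp)

lemma scale_unitT : scale C (unitT i.ring) = i.scaling :=
  CotangentRing.ringHom_ext _ _ (by simp [scaling_algebraMap]) (by simp [scaling_ι, unitT])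

/-- A homogeneous ideal vanishing at a point vanishes at its multiples. -/
lemma ker_le_ker_scale {K : Type u} [CommRing K] (ψ : i.ring →+* K)
    (hψ : RingHom.ker ψ ≤ RingHom.ker (scale (C.comp ψ) (unitT K)))
    (h : RingHom.ker ψ ≤ RingHom.ker φ) : RingHom.ker ψ ≤ RingHom.ker (scale φ t) :=
  fun _ ha ↦ eval₂_eq_zero_of_eval₂_C ψ φ t (fun _ hr ↦ h hr) _ (hψ ha)

lemma ker_le_ker_scale_iff {K : Type u} [CommRing K] (ψ : i.ring →+* K)
    (hψ : RingHom.ker ψ ≤ RingHom.ker (scale (C.comp ψ) (unitT K))) :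
    RingHom.ker ψ ≤ RingHom.ker (scale φ t) ↔ RingHom.ker ψ ≤ RingHom.ker φ := by
  refine ⟨fun h ↦ ?_, ker_le_ker_scale φ t ψ hψ⟩
  have := ker_le_ker_scale (scale φ t) t⁻¹ ψ hψ h
  rwa [scale_scale, mul_inv_cancel, scale_one] at this

end Chart

/-- Setting T = 1 in the generic multiple recovers the point. -/
lemma Chart.ker_scale_unitT_le {K : Type u} [Field K] (φ : i.ring →+* K) :
    RingHom.ker (Chart.scale (C.comp φ) (unitT K)) ≤ RingHom.ker φ := by
  intro a ha
  have h1 : (eval₂ (RingHom.id K) 1).comp (Chart.scale (C.comp φ) (unitT K)) = φ :=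
    CotangentRing.ringHom_ext _ _ (by simp) (by simp [unitT])
  rw [RingHom.mem_ker, ← h1, RingHom.comp_apply, (RingHom.mem_ker).mp ha, map_zero]

end Scale

lemma exists_eq_pt_specMap {R : Type u} [CommRing R] (p : Spec (.of R)) :
    ∃ (F : Type u) (_ : Field F) (ρ : R →+* F), p = pt (Spec.map (CommRingCat.ofHom ρ)) := by
  have hprime : (PrimeSpectrum.asIdeal p).IsPrime := PrimeSpectrum.isPrime p
  refine ⟨(PrimeSpectrum.asIdeal p).ResidueField, inferInstance, algebraMap _ _,
    PrimeSpectrum.ext ?_⟩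
  rw [pt_specMap, Ideal.ker_algebraMap_residueField]

section Conic

open LaurentPolynomial

/-- Generic scaling parameter: F is the fraction field of K[T, T⁻¹] and D extends d/dT, the
infinitesimal direction of scaling. -/
lemma exists_laurent_field (K : Type u) [Field K] [CharZero K] :
    ∃ (F : Type u) (_ : Field F) (g : K[T;T⁻¹] →+* F), Function.Injective g ∧
      ∃ D : Derivation ℤ F F, (∀ y, D (g (C y)) = 0) ∧ D (g (T 1)) = 1 := by
  obtain ⟨F, _, _, hF⟩ : ∃ (F : Type u) (_ : Field F) (_ : Algebra K[T;T⁻¹] F),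
      Function.Injective (algebraMap K[T;T⁻¹] F) :=
    ⟨FractionRing K[T;T⁻¹], inferInstance, inferInstance, IsFractionRing.injective _ _⟩
  let _ : Algebra K F := ((algebraMap K[T;T⁻¹] F).comp C).toAlgebra
  have : IsScalarTower K K[T;T⁻¹] F := .of_algebraMap_eq' rfl
  have ht : Transcendental K (algebraMap K[T;T⁻¹] F (T 1)) := by
    rw [transcendental_iff]
    intro p hp
    rw [Polynomial.aeval_algebraMap_apply] at hp
    have h1 : Polynomial.aeval (T 1 : K[T;T⁻¹]) p = Polynomial.toLaurent p := by
      rw [Polynomial.aeval_def, Polynomial.eval₂_eq_sum, Polynomial.sum]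
      conv_rhs => rw [p.as_sum_support_C_mul_X_pow, map_sum]
      simp
    rw [h1] at hp
    exact Polynomial.toLaurent_eq_zero.mp ((injective_iff_map_eq_zero _).mp hF _ hp)
  obtain ⟨D, hD, hD'⟩ := exists_derivation_of_algebraicIndependent
    (v := fun _ : Unit ↦ algebraMap K[T;T⁻¹] F (T 1))
    (algebraicIndependent_unique_type_iff.mpr ht) ()
  exact ⟨F, _, algebraMap _ _, hF, D, hD, by simpa using hD' ()⟩

variable {X Y : Scheme.{u}} {f : X ⟶ Y} [Smooth f] {i : Chart f}
  {Z : TopologicalSpace.Closeds (cotangent f)}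

lemma specializes_of_ker_le {F F' : Type u} [Field F] [Field F'] {ψ : i.ring →+* F}
    {φ : i.ring →+* F'} (h : RingHom.ker ψ ≤ RingHom.ker φ) :
    pt (Spec.map (CommRingCat.ofHom ψ) ≫ cotangentChart f i) ⤳
      pt (Spec.map (CommRingCat.ofHom φ) ≫ cotangentChart f i) := by
  rw [pt_comp, pt_comp]
  refine Specializes.map ?_ (Scheme.Hom.continuous _)
  refine (PrimeSpectrum.le_iff_specializes _ _).mp ?_
  refine (PrimeSpectrum.asIdeal_le_asIdeal _ _).mp ?_
  rw [pt_specMap, pt_specMap]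
  exact h

lemma ker_le_of_specializes {F F' : Type u} [Field F] [Field F'] {ψ : i.ring →+* F}
    {φ : i.ring →+* F'} (h : pt (Spec.map (CommRingCat.ofHom ψ) ≫ cotangentChart f i) ⤳
      pt (Spec.map (CommRingCat.ofHom φ) ≫ cotangentChart f i)) :
    RingHom.ker ψ ≤ RingHom.ker φ := by
  rw [pt_comp, pt_comp, (cotangentChart f i).isOpenEmbedding.isInducing.specializes_iff] at h
  have := (PrimeSpectrum.asIdeal_le_asIdeal _ _).mpr ((PrimeSpectrum.le_iff_specializes _ _).mpr h)
  rwa [pt_specMap, pt_specMap] at this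

/-- Generic multiples of the generic points of a closed conic subset factor through these points. -/
lemma IsConic.exists_comp_eq (hZ : IsConic Z) {η : cotangent f}
    (hη : η ∈ maxPts (Z : Set (cotangent f))) {φ : i.ring →+* κ η}
    (hφ : Spec.map (CommRingCat.ofHom φ) ≫ cotangentChart f i = κpt η) {F : Type u} [Field F]
    (g : (κ η)[T;T⁻¹] →+* F) (hg : Function.Injective g) :
    ∃ α : κ η →+* F, Spec.map (CommRingCat.ofHom α) ≫ κpt η =
      Spec.map (CommRingCat.ofHom (g.comp (Chart.scale (C.comp φ) (unitT _)))) ≫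
        cotangentChart f i ∧ g.comp (Chart.scale (C.comp φ) (unitT _)) = α.comp φ := by
  let χ := g.comp (Chart.scale (C.comp φ) (unitT _))
  let L : i.ring[T;T⁻¹] →+* F := eval₂ (g.comp (C.comp φ)) (Units.map (g : (κ η)[T;T⁻¹] →* F) (unitT _))
  have hL : L.comp i.scaling = χ := (Chart.comp_scale (C.comp φ) (unitT _) g).symm
  have hLC : L.comp C = g.comp (C.comp φ) := by ext; simp [L]
  let q := Spec.map (CommRingCat.ofHom χ) ≫ cotangentChart f i
  -- The unscaled point lies over η ∈ Z, and conicity transports membership from the projection of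
  -- 𝔾ₘ × T^* to the action.
  have hq : pt q ∈ Z := by
    have h1 : pt (Spec.map (CommRingCat.ofHom L)) ∈
        (Spec.map (CommRingCat.ofHom C) ≫ cotangentChart f i) ⁻¹' (Z : Set (cotangent f)) := by
      change (Spec.map (CommRingCat.ofHom C) ≫ cotangentChart f i) _ ∈ (Z : Set (cotangent f))
      rw [← pt_comp, ← Category.assoc, ← Spec.map_comp, ← CommRingCat.ofHom_comp, hLC,
        show g.comp (C.comp φ) = (g.comp C).comp φ from rfl, CommRingCat.ofHom_comp, Spec.map_comp,
        Category.assoc, hφ, pt_comp_map, pt_κpt]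
      exact hη.1
    rw [← hZ i] at h1
    change (Spec.map (CommRingCat.ofHom i.scaling) ≫ cotangentChart f i) _ ∈
      (Z : Set (cotangent f)) at h1
    rwa [← pt_comp, ← Category.assoc, ← Spec.map_comp, ← CommRingCat.ofHom_comp, hL] at h1
  -- The generic multiple specialises to η at T = 1. Since η is maximal in Z, the generic multiple
  -- also sits at η and factors through its residue field.
  have hs : pt q ⤳ η := by
    rw [← pt_κpt η, ← hφ]
    refine specializes_of_ker_le (le_trans ?_ (Chart.ker_scale_unitT_le φ))
    exact fun a ha ↦ hg (ha.trans (map_zero g).symm)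
  obtain ⟨α, hα⟩ := exists_κ_desc q (hη.2 _ hq hs)
  refine ⟨α, hα, eq_of_chart_hom (q := q) rfl ?_⟩
  rw [CommRingCat.ofHom_comp, Spec.map_comp, Category.assoc, hφ, hα]

/-- The Liouville form vanishes at the generic points of closed conic isotropic subsets. -/
lemma IsConic.isNull (hZ : IsConic Z) {η : cotangent f} [CharZero (κ η)]
    (hη : η ∈ maxPts (Z : Set (cotangent f))) (h : IsIsotropic (κpt η)) : IsNull (κpt η) := by
  intro i n c φ hφ δ hδ
  obtain ⟨F, _, g, hg, D, hD, hDT⟩ := exists_laurent_field (κ η)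
  obtain ⟨α, -, hα⟩ := hZ.exists_comp_eq hη hφ g hg
  obtain ⟨ε, hε⟩ := exists_derivation_extension_field (g.comp C) δ
  simp only [RingHom.comp_apply] at hε
  -- The extension of δ is normalised to kill T.
  let ε' : Derivation ℤ F F := ε - ε (g (T 1)) • D
  have hε' (x) : ε' (g (C x)) = g (C (δ x)) := by simp [ε', hD, hε]
  have hεT : ε' (g (T 1)) = 0 := by simp [ε', hDT]
  have hb (b : i.B) : α (φ (algebraMap _ _ b)) = g (C (φ (algebraMap _ _ b))) := by
    rw [← RingHom.comp_apply α, ← hα]; simp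
  have hv (v) : α (φ (SymmetricAlgebra.ι _ _ v)) = g (C (φ (SymmetricAlgebra.ι _ _ v))) * g (T 1) := by
    rw [← RingHom.comp_apply α, ← hα]; simp [unitT]
  have h1 := c.symplectic_comp_eq_zero α φ (h i n c φ hφ) D ε'
    (fun a ↦ by rw [hb, hD]) (fun a ↦ by rw [hb, hε', hδ, map_zero, map_zero])
  -- At the generic multiple the momenta are T ξ_j. As D kills constants with D T = 1, and ε'
  -- restricts to δ and kills T, the form ω(D, ε') reduces to ∑ ξ_j δ(x_j).
  have h2 : c.symplectic (α.comp φ) D ε' = g (C (c.liouville φ δ)) := by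
    simp [Frame.symplectic, Frame.liouville, hb, hv, hD, hε', hεT, hDT]
  rw [h2] at h1
  exact (g.comp C).injective (h1.trans (map_zero _).symm)

/-- A closed subset whose generic points are homogeneous is conic. -/
lemma isConic_of_maxPts (h : ∀ η ∈ maxPts (Z : Set (cotangent f)), ∀ (i : Chart f)
    (φ : i.ring →+* κ η), Spec.map (CommRingCat.ofHom φ) ≫ cotangentChart f i = κpt η →
    RingHom.ker φ ≤ RingHom.ker (Chart.scale (C.comp φ) (unitT _))) : IsConic Z := by
  intro i
  ext p
  obtain ⟨F, _, ρ, rfl⟩ := exists_eq_pt_specMap p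
  let t : Fˣ := Units.map (ρ : i.ring[T;T⁻¹] →* F) (unitT _)
  have hρ : ρ.comp i.scaling = Chart.scale (ρ.comp C) t := by
    rw [← Chart.scale_unitT, Chart.comp_scale]
  -- If homogeneous primes cannot separate ψ from ψ', membership in Z passes from ψ to ψ', as it is
  -- detected by generic points of Z specialising to the point. The action and the projection differ
  -- by a unit scaling, so this applies both ways.
  have key (ψ ψ' : i.ring →+* F)
      (hψ : ∀ {K : Type u} [Field K] (φ : i.ring →+* K),
        RingHom.ker φ ≤ RingHom.ker (Chart.scale (C.comp φ) (unitT K)) →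
        RingHom.ker φ ≤ RingHom.ker ψ → RingHom.ker φ ≤ RingHom.ker ψ')
      (hZ : pt (Spec.map (CommRingCat.ofHom ψ) ≫ cotangentChart f i) ∈ Z) :
      pt (Spec.map (CommRingCat.ofHom ψ') ≫ cotangentChart f i) ∈ Z := by
    obtain ⟨η, hη, hs⟩ := exists_maxPts_specializes Z.isClosed hZ
    have hi : pt (κpt η) ∈ Set.range (cotangentChart f i) := by
      rw [pt_κpt]
      exact hs.mem_open (cotangentChart f i).isOpenEmbedding.isOpen_range
        ⟨_, (pt_comp _ _).symm⟩
    obtain ⟨φ, hφ⟩ := exists_lift_of_mem_range _ _ hi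
    rw [← pt_κpt η, ← hφ] at hs
    have h1 := specializes_of_ker_le (hψ φ (h η hη i φ hφ) (ker_le_of_specializes hs))
    rw [hφ, pt_κpt] at h1
    exact h1.mem_closed Z.isClosed hη.1
  change pt (Spec.map (CommRingCat.ofHom ρ) ≫ Spec.map (CommRingCat.ofHom i.scaling) ≫
    cotangentChart f i) ∈ Z ↔ pt (Spec.map (CommRingCat.ofHom ρ) ≫
    Spec.map (CommRingCat.ofHom C) ≫ cotangentChart f i) ∈ Z
  rw [← Category.assoc, ← Spec.map_comp, ← CommRingCat.ofHom_comp, hρ, ← Category.assoc,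
    ← Spec.map_comp, ← CommRingCat.ofHom_comp]
  exact ⟨key _ _ fun φ hφ ↦ (Chart.ker_le_ker_scale_iff _ t φ hφ).mp,
    key _ _ fun φ hφ ↦ (Chart.ker_le_ker_scale_iff _ t φ hφ).mpr⟩

end Conic

end

/-! ### Null lifts of generic points: existence, uniqueness, homogeneity. -/

noncomputable section

section Tower

open LaurentPolynomial

variable {k : Type u} [Field k] {M S : Scheme.{u}} {π : M ⟶ S} {σ : S ⟶ Spec (.of k)}
  {F : Type u} [Field F]

lemma Chart.exists_lift_liouville {i : Chart π} {n d N : ℕ} (c : Frame i.A i.B n)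
    (cA : Frame (i.base σ).A (i.base σ).B d) (cR : Frame (i.comp σ).A (i.comp σ).B N)
    (φ : i.ring →+* F) (h : ∀ δ, Chart.Kills φ δ → c.liouville φ δ = 0) :
    ∃ φ' : (i.comp σ).ring →+* F, φ'.comp (i.proj σ) = φ ∧
      ∀ δ, Chart.Kills φ' δ → cR.liouville φ' δ = 0 := by
  let a₁ : Algebra Γ(Spec (.of k), ⊤) i.A := (σ.appLE ⊤ i.U le_top).hom.toAlgebra
  let a₂ : Algebra Γ(Spec (.of k), ⊤) i.B := inferInstanceAs (Algebra (i.comp σ).A (i.comp σ).B)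
  have a₃ : IsScalarTower Γ(Spec (.of k), ⊤) i.A i.B := .of_algebraMap_eq' (congrArg
    CommRingCat.Hom.hom (Scheme.Hom.appLE_comp_appLE π σ ⊤ i.U i.V le_top i.le).symm)
  exact @RelCotangent.exists_lift_liouville i.A i.B _ _ _ F _ n c Γ(Spec (.of k), ⊤) _ a₁ a₂ a₃ d N cA cR
    φ h

lemma Chart.eq_of_liouville [Smooth π] {i : Chart π} {d N : ℕ}
    (cA : Frame (i.base σ).A (i.base σ).B d) (cR : Frame (i.comp σ).A (i.comp σ).B N)
    (φ₁ φ₂ : (i.comp σ).ring →+* F) (h : φ₁.comp (i.proj σ) = φ₂.comp (i.proj σ))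
    (h₁ : ∀ δ, Chart.Kills φ₁ δ → cR.liouville φ₁ δ = 0)
    (h₂ : ∀ δ, Chart.Kills φ₂ δ → cR.liouville φ₂ δ = 0)
    (δ : Fin d → Derivation ℤ F F)
    (hδ : ∀ l (r : (i.comp σ).A), δ l (φ₁ (algebraMap (i.comp σ).B (i.comp σ).ring
      (algebraMap (i.comp σ).A (i.comp σ).B r))) = 0)
    (hδy : ∀ l j, δ l (φ₁ (algebraMap (i.comp σ).B (i.comp σ).ring
      (algebraMap i.A i.B (cA.x j)))) = if l = j then 1 else 0) : φ₁ = φ₂ := by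
  let a₁ : Algebra Γ(Spec (.of k), ⊤) i.A := (σ.appLE ⊤ i.U le_top).hom.toAlgebra
  let a₂ : Algebra Γ(Spec (.of k), ⊤) i.B := inferInstanceAs (Algebra (i.comp σ).A (i.comp σ).B)
  have a₃ : IsScalarTower Γ(Spec (.of k), ⊤) i.A i.B := .of_algebraMap_eq' (congrArg
    CommRingCat.Hom.hom (Scheme.Hom.appLE_comp_appLE π σ ⊤ i.U i.V le_top i.le).symm)
  have : Algebra.Smooth i.A i.B := π.smooth_appLE i.isAffineOpen_U i.isAffineOpen_V i.le
  refine @RelCotangent.eq_of_liouville i.A i.B _ _ _ F _ Γ(Spec (.of k), ⊤) _ a₁ a₂ a₃ d N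
    inferInstance cA cR φ₁ φ₂ (fun b ↦ ?_) h h₁ h₂ δ hδ hδy
  have := DFunLike.congr_fun h (algebraMap i.B i.ring b)
  rwa [RingHom.comp_apply, RingHom.comp_apply, proj_algebraMap] at this

lemma Chart.scale_comp_restrict {i j : Chart π} (h : i ≤ j) {R : Type u} [CommRing R]
    (φ : i.ring →+* R) (t : Rˣ) :
    (Chart.scale φ t).comp (Chart.restrict h) = Chart.scale (φ.comp (Chart.restrict h)) t :=
  CotangentRing.ringHom_ext _ _ (by simp [restrict_algebraMap]) (by simp [restrict_ι])

lemma Chart.scale_comp_proj {i : Chart π} {R : Type u} [CommRing R]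
    (φ : (i.comp σ).ring →+* R) (t : Rˣ) :
    (Chart.scale φ t).comp (i.proj σ) = Chart.scale (φ.comp (i.proj σ)) t :=
  CotangentRing.ringHom_ext _ _ (fun b ↦ by
    rw [scale_algebraMap, RingHom.comp_apply, RingHom.comp_apply, proj_algebraMap]
    exact scale_algebraMap φ t (i := i.comp σ) b) fun v ↦ by
    obtain ⟨w, hw, -⟩ := exists_proj_ι σ i v
    rw [RingHom.comp_apply, hw, scale_ι, scale_ι, RingHom.comp_apply, hw]

variable [Smooth π] [Smooth σ]

lemma cotangentProj_toBase :
    cotangentProj π σ ≫ cotangentToBase π = cotangentToBase (π ≫ σ) := by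
  refine (projCover π σ).hom_ext _ _ fun i ↦ ?_
  change cotangentChart (π ≫ σ) (i.comp σ) ≫ _ = cotangentChart (π ≫ σ) (i.comp σ) ≫ _
  rw [← Category.assoc, cotangentChart_proj, Category.assoc, cotangentChart_toBase,
    cotangentChart_toBase, ← Category.assoc, ← Spec.map_comp, ← CommRingCat.ofHom_comp]
  congr 3
  ext b
  exact i.proj_algebraMap σ b

lemma IsNull.comp {X Y : Scheme.{u}} {f : X ⟶ Y} [Smooth f] {q : Spec (.of F) ⟶ cotangent f}
    (hq : IsNull q) {F' : Type u} [Field F'] (α : F →+* F') :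
    IsNull (Spec.map (CommRingCat.ofHom α) ≫ q) := by
  obtain ⟨i, n, c, hi, -⟩ := exists_frame f (cotangentToBase f (pt q))
  obtain ⟨φ, hφ⟩ := exists_chart_hom q i hi
  refine isNull_of_chart (φ := α.comp φ) ?_ c fun δ hδ ↦
    c.liouville_comp_eq_zero α φ (hq i n c φ hφ) δ hδ
  rw [CommRingCat.ofHom_comp, Spec.map_comp, Category.assoc, hφ]

/-- A null point of the relative cotangent bundle lifts to a null point of the cotangent bundle. -/
lemma IsNull.exists_lift {d : ℕ} (hS : SmoothOfRelativeDimension d σ)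
    {q : Spec (.of F) ⟶ cotangent π} (hq : IsNull q) :
    ∃ q' : Spec (.of F) ⟶ cotangent (π ≫ σ), q' ≫ cotangentProj π σ = q ∧ IsNull q' := by
  obtain ⟨i, n, c, cA, cR, hi, -⟩ := exists_tower_frames (π := π) hS (cotangentToBase π (pt q)) ⊤
    trivial
  obtain ⟨φ, hφ⟩ := exists_chart_hom q i hi
  obtain ⟨φ', hφ', h⟩ := Chart.exists_lift_liouville c cA cR φ (hq i n c φ hφ)
  refine ⟨Spec.map (CommRingCat.ofHom φ') ≫ cotangentChart (π ≫ σ) (i.comp σ), ?_,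
    isNull_of_chart rfl cR h⟩
  rw [Category.assoc, cotangentChart_proj, ← Category.assoc, ← Spec.map_comp,
    ← CommRingCat.ofHom_comp, hφ', hφ]

lemma exists_tower_chart_hom {d : ℕ} (hS : SmoothOfRelativeDimension d σ)
    (q' : Spec (.of F) ⟶ cotangent (π ≫ σ)) (V : M.Opens)
    (hV : cotangentToBase (π ≫ σ) (pt q') ∈ V) :
    ∃ (i : Chart π) (n : ℕ) (_ : Frame i.A i.B n) (_ : Frame (i.base σ).A (i.base σ).B d)
      (_ : Frame (i.comp σ).A (i.comp σ).B (n + d)) (φ' : (i.comp σ).ring →+* F), i.V ≤ V ∧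
      Spec.map (CommRingCat.ofHom φ') ≫ cotangentChart (π ≫ σ) (i.comp σ) = q' ∧
      Spec.map (CommRingCat.ofHom (φ'.comp (i.proj σ))) ≫ cotangentChart π i =
        q' ≫ cotangentProj π σ := by
  obtain ⟨i, n, c, cA, cR, hi, hiV⟩ := exists_tower_frames (π := π) hS (cotangentToBase (π ≫ σ) (pt q')) V hV
  obtain ⟨φ', hφ'⟩ := exists_chart_hom q' (i.comp σ) hi
  refine ⟨i, n, c, cA, cR, φ', hiV, hφ', ?_⟩
  rw [← hφ', Category.assoc, cotangentChart_proj, ← Category.assoc, ← Spec.map_comp,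
    ← CommRingCat.ofHom_comp]

variable [CharZero k] {m d : ℕ} {Lrel : TopologicalSpace.Closeds (cotangent π)}

/-- Null lifts of the generic points of a relative Lagrangian are unique. -/
lemma eq_of_isNull (hM : SmoothOfRelativeDimension m (π ≫ σ))
    (hS : SmoothOfRelativeDimension d σ) (hlag : IsRelativeLagrangian π Lrel)
    {q₁ q₂ : Spec (.of F) ⟶ cotangent (π ≫ σ)}
    (hη : pt (q₁ ≫ cotangentProj π σ) ∈ maxPts (Lrel : Set (cotangent π)))
    (h : q₁ ≫ cotangentProj π σ = q₂ ≫ cotangentProj π σ) (h₁ : IsNull q₁) (h₂ : IsNull q₂) :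
    q₁ = q₂ := by
  obtain ⟨i, n, c, cA, cR, φ₁, -, hφ₁, hφ⟩ := exists_tower_chart_hom hS q₁ ⊤ trivial
  have hi : cotangentToBase (π ≫ σ) (pt q₂) ∈ (i.comp σ).V := by
    have hi := mem_V_of_chart_hom hφ
    rw [h, pt_comp, ← Scheme.Hom.comp_apply, cotangentProj_toBase] at hi
    exact hi
  obtain ⟨φ₂, hφ₂⟩ := exists_chart_hom q₂ (i.comp σ) hi
  -- This is where the dimension count enters: without derivations dual to the y_i the coefficients
  -- of the dy_i would not be determined.
  obtain ⟨δ, hδ, hδy⟩ := exists_dual_derivation_of_mem_maxPts hM hS hlag hη _ rfl _ hφ cA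
  have hb (b : i.B) : φ₁.comp (i.proj σ) (algebraMap i.B i.ring b) =
      φ₁ (algebraMap (i.comp σ).B _ b) := by rw [RingHom.comp_apply, Chart.proj_algebraMap]
  have he : φ₁ = φ₂ := by
    refine Chart.eq_of_liouville cA cR φ₁ φ₂ (eq_of_chart_hom hφ ?_) (h₁ _ _ cR φ₁ hφ₁)
      (h₂ _ _ cR φ₂ hφ₂) δ (fun l r ↦ ?_) fun l j ↦ ?_
    · rw [h, ← hφ₂, Category.assoc, cotangentChart_proj, ← Category.assoc, ← Spec.map_comp,
        ← CommRingCat.ofHom_comp]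
    · exact (congrArg (δ l) (hb _)).symm.trans (hδ l r)
    · exact (congrArg (δ l) (hb _)).symm.trans (hδy l j)
  rw [← hφ₁, ← hφ₂, he]

/-- The generic multiple of the null lift lies over the generic multiple of η, which by conicity is
a point of η through some α. It is null again, so uniqueness identifies it with the null lift
composed with α, and the two have the same kernel. -/
lemma ker_le_ker_scale_of_isNull (hM : SmoothOfRelativeDimension m (π ≫ σ))
    (hS : SmoothOfRelativeDimension d σ) (hlag : IsRelativeLagrangian π Lrel) (hc : IsConic Lrel)
    {η : cotangent π} (hη : η ∈ maxPts (Lrel : Set (cotangent π)))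
    {q : Spec (.of (κ η)) ⟶ cotangent (π ≫ σ)} (hq : q ≫ cotangentProj π σ = κpt η)
    (hn : IsNull q) (j : Chart (π ≫ σ)) (φ' : j.ring →+* κ η)
    (hφ' : Spec.map (CommRingCat.ofHom φ') ≫ cotangentChart (π ≫ σ) j = q) :
    RingHom.ker φ' ≤ RingHom.ker (Chart.scale (C.comp φ') (unitT _)) := by
  have : CharZero (κ η) := charZero_κ (cotangentToBase π ≫ π ≫ σ) η
  obtain ⟨F, _, g, hg, -⟩ := exists_laurent_field (κ η)
  obtain ⟨i, n, c, cA, cR, ψ', hij, hψ', hψ⟩ :=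
    exists_tower_chart_hom hS q j.V (mem_V_of_chart_hom hφ')
  have hij' : i.comp σ ≤ j := ⟨hij, (opens_eq_top_of_mem (j.le (mem_V_of_chart_hom hφ'))).symm.le⟩
  obtain rfl := chart_hom_restrict hij' hψ' hφ'
  rw [hq] at hψ
  obtain ⟨α, hα, hα'⟩ := hc.exists_comp_eq hη hψ g hg
  let χ : (i.comp σ).ring →+* F := g.comp (Chart.scale (C.comp ψ') (unitT _))
  have hχ : Spec.map (CommRingCat.ofHom χ) ≫ cotangentChart (π ≫ σ) (i.comp σ) =
      Spec.map (CommRingCat.ofHom α) ≫ q := by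
    have e : (Spec.map (CommRingCat.ofHom α) ≫ q) ≫ cotangentProj π σ =
        Spec.map (CommRingCat.ofHom α) ≫ κpt η := by rw [Category.assoc, hq]
    refine (eq_of_isNull hM hS hlag (q₁ := Spec.map (CommRingCat.ofHom α) ≫ q) ?_ ?_
      (hn.comp α) ?_).symm
    · rw [e, pt_comp_map, pt_κpt]
      exact hη
    · rw [e, hα, Category.assoc, cotangentChart_proj, ← Category.assoc, ← Spec.map_comp,
        ← CommRingCat.ofHom_comp, RingHom.comp_assoc, Chart.scale_comp_proj]
    · refine isNull_of_chart rfl cR fun δ hδ ↦ ?_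
      have h1 := cR.liouville_comp_eq_zero (g.comp C) ψ' (hn _ _ cR ψ' hψ') δ fun a ↦ by
        have := hδ a
        simpa [χ] using this
      -- The Liouville form is homogeneous of degree one and contains no derivative of T, so scaling
      -- preserves nullity.
      have h2 : cR.liouville χ δ = g (T 1) * cR.liouville ((g.comp C).comp ψ') δ := by
        simp only [Frame.liouville, χ, RingHom.comp_apply, Chart.scale_ι, Chart.scale_algebraMap,
          Finset.mul_sum, map_mul]
        refine Finset.sum_congr rfl fun l _ ↦ ?_
        rw [show ((unitT (κ η) : (κ η)[T;T⁻¹]ˣ) : (κ η)[T;T⁻¹]) = T 1 from rfl]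
        ring
      rw [h2, h1, mul_zero]
  have hχ' : χ = α.comp ψ' := eq_of_chart_hom hχ (by
    rw [CommRingCat.ofHom_comp, Spec.map_comp, Category.assoc, hψ'])
  intro a ha
  have h1 : χ (Chart.restrict hij' a) = 0 := by
    rw [hχ', RingHom.comp_apply]
    exact (congrArg α ha).trans (map_zero α)
  rw [RingHom.mem_ker, ← RingHom.comp_assoc, ← Chart.scale_comp_restrict]
  exact hg (h1.trans (map_zero g).symm)

end Tower

end

/-! ### The lifting as the closure of the null lifts; its components and its uniqueness. -/

noncomputable section

lemma mem_shadow_iff {X Y : Scheme.{u}} {f : X ⟶ Y} [Smooth f]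
    {Z : TopologicalSpace.Closeds (cotangent f)} {x : X} :
    x ∈ shadow f Z ↔ ∃ η ∈ maxPts (Z : Set (cotangent f)), cotangentToBase f η = x := by
  constructor
  · rintro ⟨C, hC, η, hη, rfl⟩
    obtain ⟨ξ, hξ, rfl⟩ := (mem_components_iff Z.isClosed C).mp hC
    obtain rfl := hη.eq (isGenericPoint_closure (x := ξ))
    exact ⟨η, hξ, rfl⟩
  · rintro ⟨η, hη, rfl⟩
    exact ⟨_, (mem_components_iff Z.isClosed _).mpr ⟨η, hη, rfl⟩, η, isGenericPoint_closure, rfl⟩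

lemma mem_maxPts_of_closure_mem_components {X : Scheme.{u}} {Z : Set X} (hZ : IsClosed Z) {x : X}
    (h : closure {x} ∈ components Z) : x ∈ maxPts Z := by
  obtain ⟨ξ, hξ, he⟩ := (mem_components_iff hZ _).mp h
  obtain rfl := (show IsGenericPoint x (closure {ξ}) from he).eq isGenericPoint_closure
  exact hξ

section Lifting

variable {k : Type u} [Field k] {M S : Scheme.{u}} {π : M ⟶ S} {σ : S ⟶ Spec (.of k)}
  [Smooth π] [Smooth σ] {m d : ℕ} {Lrel : TopologicalSpace.Closeds (cotangent π)}

lemma isNull_of_mem_maxPts [CharZero k] (σ : S ⟶ Spec (.of k)) (hlag : IsRelativeLagrangian π Lrel)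
    (hc : IsConic Lrel) {η : cotangent π} (hη : η ∈ maxPts (Lrel : Set (cotangent π))) :
    IsNull (κpt η) := by
  have : CharZero (κ η) := charZero_κ (cotangentToBase π ≫ π ≫ σ) η
  exact hc.isNull hη (hlag.isIsotropic hη)

variable (σ Lrel) in
/-- The null lifts of the generic points of a closed subset of the relative cotangent bundle. -/
def liftPts : Set (cotangent (π ≫ σ)) :=
  {e | ∃ η ∈ maxPts (Lrel : Set (cotangent π)), ∃ q : Spec (.of (κ η)) ⟶ cotangent (π ≫ σ),
    q ≫ cotangentProj π σ = κpt η ∧ IsNull q ∧ pt q = e}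

variable (σ Lrel) in
/-- The closure of the null lifts of the generic points. -/
def lifting : TopologicalSpace.Closeds (cotangent (π ≫ σ)) :=
  ⟨closure (liftPts σ Lrel), isClosed_closure⟩

lemma proj_mem_maxPts {e : cotangent (π ≫ σ)} (he : e ∈ liftPts σ Lrel) :
    cotangentProj π σ e ∈ maxPts (Lrel : Set (cotangent π)) := by
  obtain ⟨η, hη, q, hq, -, rfl⟩ := he
  rwa [← pt_comp, hq, pt_κpt]

/-- A null point over a generic point of a relative Lagrangian lies over the null lift. -/
lemma mem_liftPts_of_isNull [CharZero k] (hM : SmoothOfRelativeDimension m (π ≫ σ))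
    (hS : SmoothOfRelativeDimension d σ) (hlag : IsRelativeLagrangian π Lrel) (hc : IsConic Lrel)
    {F : Type u} [Field F] {q : Spec (.of F) ⟶ cotangent (π ≫ σ)} (hq : IsNull q)
    {η : cotangent π} (hη : η ∈ maxPts (Lrel : Set (cotangent π)))
    (h : pt (q ≫ cotangentProj π σ) = η) : pt q ∈ liftPts σ Lrel := by
  obtain ⟨q', hq', hn⟩ := (isNull_of_mem_maxPts σ hlag hc hη).exists_lift hS
  refine ⟨η, hη, q', hq', hn, ?_⟩
  obtain ⟨β, hβ⟩ := exists_κ_desc (q ≫ cotangentProj π σ) h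
  have he : q = Spec.map (CommRingCat.ofHom β) ≫ q' :=
    eq_of_isNull hM hS hlag (by rw [h]; exact hη) (by rw [Category.assoc, hq', hβ]) hq (hn.comp β)
  rw [he, pt_comp_map]

lemma liftPts_injOn [CharZero k] (hM : SmoothOfRelativeDimension m (π ≫ σ))
    (hS : SmoothOfRelativeDimension d σ) (hlag : IsRelativeLagrangian π Lrel) :
    Set.InjOn (cotangentProj π σ) (liftPts σ Lrel) := by
  rintro _ ⟨η, hη, q, hq, hn, rfl⟩ _ ⟨η', hη', q', hq', hn', rfl⟩ h
  rw [← pt_comp, ← pt_comp, hq, hq', pt_κpt, pt_κpt] at h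
  subst h
  rw [eq_of_isNull hM hS hlag (by rw [hq, pt_κpt]; exact hη) (hq.trans hq'.symm) hn hn']

lemma surjOn_liftPts [CharZero k] (hS : SmoothOfRelativeDimension d σ) (hlag : IsRelativeLagrangian π Lrel)
    (hc : IsConic Lrel) {η : cotangent π} (hη : η ∈ maxPts (Lrel : Set (cotangent π))) :
    ∃ e ∈ liftPts σ Lrel, cotangentProj π σ e = η := by
  obtain ⟨q', hq', hn⟩ := (isNull_of_mem_maxPts σ hlag hc hη).exists_lift hS
  exact ⟨pt q', ⟨η, hη, q', hq', hn, rfl⟩, by rw [← pt_comp, hq', pt_κpt]⟩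

lemma exists_chart_finite_inter (σ : S ⟶ Spec (.of k)) [Smooth σ]
    (Lrel : TopologicalSpace.Closeds (cotangent π)) (η : cotangent π) :
    ∃ U : Set (cotangent π), IsOpen U ∧ η ∈ U ∧ (U ∩ maxPts (Lrel : Set (cotangent π))).Finite := by
  obtain ⟨i, n, c, hi, -⟩ := exists_frame π (cotangentToBase π η)
  have : IsLocallyNoetherian M := LocallyOfFiniteType.isLocallyNoetherian (π ≫ σ)
  have : IsNoetherianRing i.ring := isNoetherianRing_chart π i
  refine ⟨Set.range (cotangentChart π i), (cotangentChart π i).isOpenEmbedding.isOpen_range, ?_,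
    finite_maxPts_inter_range _ Lrel.isClosed⟩
  rw [range_cotangentChart]
  exact hi

/-- The null lifts inject into the generic points of Λ^rel and so inherit their local finiteness;
the closure therefore adds only specialisations. -/
lemma exists_specializes_of_mem_lifting [CharZero k] (hM : SmoothOfRelativeDimension m (π ≫ σ))
    (hS : SmoothOfRelativeDimension d σ) (hlag : IsRelativeLagrangian π Lrel)
    {y : cotangent (π ≫ σ)} (hy : y ∈ lifting σ Lrel) : ∃ e ∈ liftPts σ Lrel, e ⤳ y := by
  obtain ⟨U, hU, hyU, hf⟩ := exists_chart_finite_inter σ Lrel (cotangentProj π σ y)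
  have hf' : (cotangentProj π σ ⁻¹' U ∩ liftPts σ Lrel).Finite :=
    Set.Finite.of_injOn (t := U ∩ maxPts (Lrel : Set (cotangent π)))
      (fun e he ↦ ⟨he.1, proj_mem_maxPts he.2⟩)
      ((liftPts_injOn hM hS hlag).mono Set.inter_subset_right) hf
  exact exists_specializes_of_mem_closure (hU.preimage (cotangentProj π σ).continuous) hf' hyU hy

/-- There are no specialisations between distinct null lifts: their images are maximal in Λ^rel,
hence equal, and the projection is injective on null lifts. -/
lemma maxPts_lifting [CharZero k] (hM : SmoothOfRelativeDimension m (π ≫ σ))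
    (hS : SmoothOfRelativeDimension d σ) (hlag : IsRelativeLagrangian π Lrel) :
    maxPts (lifting σ Lrel : Set (cotangent (π ≫ σ))) = liftPts σ Lrel := by
  ext y
  constructor
  · intro hy
    obtain ⟨e, he, hey⟩ := exists_specializes_of_mem_lifting hM hS hlag hy.1
    rwa [← hy.2 e (subset_closure he) hey]
  · intro hy
    refine ⟨subset_closure hy, fun z hz hzy ↦ ?_⟩
    obtain ⟨e, he, hez⟩ := exists_specializes_of_mem_lifting hM hS hlag hz
    have h1 := (proj_mem_maxPts hy).2 _ (proj_mem_maxPts he).1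
      ((hez.trans hzy).map (cotangentProj π σ).continuous)
    obtain rfl := liftPts_injOn hM hS hlag he hy h1
    exact (hzy.antisymm hez).eq

open LaurentPolynomial in
lemma isConic_lifting [CharZero k] (hM : SmoothOfRelativeDimension m (π ≫ σ))
    (hS : SmoothOfRelativeDimension d σ) (hlag : IsRelativeLagrangian π Lrel) (hc : IsConic Lrel) :
    IsConic (lifting σ Lrel) := by
  refine isConic_of_maxPts fun e he j φ hφ ↦ ?_
  rw [maxPts_lifting hM hS hlag] at he
  obtain ⟨η, hη, q, hq, hn, rfl⟩ := he
  obtain ⟨α, hα⟩ := exists_κ_desc q rfl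
  have h1 := ker_le_ker_scale_of_isNull hM hS hlag hc hη hq hn j (α.comp φ) (by
    rw [CommRingCat.ofHom_comp, Spec.map_comp, Category.assoc, hφ, hα])
  intro a ha
  -- Homogeneity was proved with values in κ(η); as α is injective, it descends to the residue field
  -- of the lifted point.
  exact eval₂_eq_zero_of_eval₂_C (α.comp φ) (C.comp φ) (unitT _)
    (fun r hr ↦ by
      have : φ r = 0 := α.injective (hr.trans (map_zero α).symm)
      rw [RingHom.comp_apply, this, map_zero])
    (j.scaling a) (h1 ((congrArg α ha).trans (map_zero α)))

/-- The lift is defined over κ(η), which bounds its degree from above; projecting it back to η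
bounds it from below. -/
lemma ptDim_lift {η : cotangent π} {q : Spec (.of (κ η)) ⟶ cotangent (π ≫ σ)}
    (hq : q ≫ cotangentProj π σ = κpt η) :
    ptDim (cotangentToBase (π ≫ σ) ≫ π ≫ σ) (pt q) = ptDim (cotangentToBase π ≫ π ≫ σ) η := by
  have hw : cotangentToBase (π ≫ σ) ≫ π ≫ σ =
      cotangentProj π σ ≫ cotangentToBase π ≫ π ≫ σ := by
    rw [← cotangentProj_toBase, Category.assoc]
  obtain ⟨a, ha⟩ : ∃ a : CommRingCat.of k ⟶ CommRingCat.of (κ η),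
    Spec.map a = κpt η ≫ cotangentToBase π ≫ π ≫ σ := ⟨_, Spec.map_preimage _⟩
  apply le_antisymm
  · rw [ptDim_eq_trdegHom (f := a.hom) _ η ha]
    refine ptDim_le_trdegHom _ q a.hom ?_
    rw [hw, ← Category.assoc, hq, ← ha, CommRingCat.ofHom_hom]
  · rw [hw]
    refine le_trans (le_of_eq ?_) (comp_ptDim (cotangentProj π σ) _ (pt q))
    rw [← pt_comp, hq, pt_κpt]

lemma topologicalKrullDim_of_mem_components [CharZero k] (hM : SmoothOfRelativeDimension m (π ≫ σ))
    (hS : SmoothOfRelativeDimension d σ) (hlag : IsRelativeLagrangian π Lrel)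
    {C : Set (cotangent (π ≫ σ))}
    (hC : C ∈ components (lifting σ Lrel : Set (cotangent (π ≫ σ)))) :
    topologicalKrullDim C = topologicalKrullDim M := by
  obtain ⟨e, he, rfl⟩ := (mem_components_iff (lifting σ Lrel).isClosed C).mp hC
  rw [maxPts_lifting hM hS hlag] at he
  obtain ⟨η, hη, q, hq, hn, rfl⟩ := he
  rw [topologicalKrullDim_closure (cotangentToBase (π ≫ σ) ≫ π ≫ σ), ptDim_lift hq,
    ← topologicalKrullDim_closure (cotangentToBase π ≫ π ≫ σ)]
  exact hlag.dim_eq _ ((mem_components_iff Lrel.isClosed _).mpr ⟨η, hη, rfl⟩)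

lemma image_lifting_subset :
    cotangentProj π σ '' (lifting σ Lrel : Set (cotangent (π ≫ σ))) ⊆ Lrel :=
  (image_closure_subset_closure_image (cotangentProj π σ).continuous).trans
    (closure_minimal (by rintro _ ⟨e, he, rfl⟩; exact (proj_mem_maxPts he).1) Lrel.isClosed)

lemma subset_closure_image_lifting [CharZero k] (hS : SmoothOfRelativeDimension d σ)
    (hlag : IsRelativeLagrangian π Lrel) (hc : IsConic Lrel) : (Lrel : Set (cotangent π)) ⊆
    closure (cotangentProj π σ '' (lifting σ Lrel : Set (cotangent (π ≫ σ)))) := by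
  rw [← closure_maxPts Lrel.isClosed]
  refine closure_mono fun η hη ↦ ?_
  obtain ⟨e, he, rfl⟩ := surjOn_liftPts hS hlag hc hη
  exact ⟨e, subset_closure he, rfl⟩

lemma closure_image_closure_singleton {X Y : Scheme.{u}} (f : X ⟶ Y) (x : X) :
    closure (f '' closure {x}) = closure {f x} := by
  rw [closure_image_closure f.continuous, Set.image_singleton]

lemma closure_image_mem_components [CharZero k] (hM : SmoothOfRelativeDimension m (π ≫ σ))
    (hS : SmoothOfRelativeDimension d σ) (hlag : IsRelativeLagrangian π Lrel)
    {C : Set (cotangent (π ≫ σ))}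
    (hC : C ∈ components (lifting σ Lrel : Set (cotangent (π ≫ σ)))) :
    closure (cotangentProj π σ '' C) ∈ components (Lrel : Set (cotangent π)) := by
  obtain ⟨e, he, rfl⟩ := (mem_components_iff (lifting σ Lrel).isClosed C).mp hC
  rw [maxPts_lifting hM hS hlag] at he
  rw [closure_image_closure_singleton]
  exact (mem_components_iff Lrel.isClosed _).mpr ⟨_, proj_mem_maxPts he, rfl⟩

lemma shadow_lifting [CharZero k] (hM : SmoothOfRelativeDimension m (π ≫ σ))
    (hS : SmoothOfRelativeDimension d σ) (hlag : IsRelativeLagrangian π Lrel) (hc : IsConic Lrel) :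
    shadow (π ≫ σ) (lifting σ Lrel) = shadow π Lrel := by
  ext x
  rw [mem_shadow_iff, mem_shadow_iff, maxPts_lifting hM hS hlag, ← cotangentProj_toBase]
  constructor
  · rintro ⟨e, he, rfl⟩
    exact ⟨_, proj_mem_maxPts he, rfl⟩
  · rintro ⟨η, hη, rfl⟩
    obtain ⟨e, he, rfl⟩ := surjOn_liftPts hS hlag hc hη
    exact ⟨e, he, rfl⟩

/-- A closed set is determined by its generic points. Those of L are null and lie over generic
points of Λ^rel, so they are null lifts; all null lifts occur by density of the image. -/
lemma IsLifting.eq_lifting [IsAlgClosed k] [CharZero k] (hM : SmoothOfRelativeDimension m (π ≫ σ))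
    (hS : SmoothOfRelativeDimension d σ) (hlag : IsRelativeLagrangian π Lrel) (hc : IsConic Lrel)
    {L : TopologicalSpace.Closeds (cotangent (π ≫ σ))} (hL : IsLifting π σ Lrel L) :
    L = lifting σ Lrel := by
  have h1 {e : cotangent (π ≫ σ)} (he : e ∈ maxPts (L : Set (cotangent (π ≫ σ)))) :
      cotangentProj π σ e ∈ maxPts (Lrel : Set (cotangent π)) := by
    have := hL.dominates _ ((mem_components_iff L.isClosed _).mpr ⟨e, he, rfl⟩)
    rw [closure_image_closure_singleton] at this
    exact mem_maxPts_of_closure_mem_components Lrel.isClosed this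
  have h2 {e : cotangent (π ≫ σ)} (he : e ∈ maxPts (L : Set (cotangent (π ≫ σ)))) :
      e ∈ liftPts σ Lrel := by
    have : CharZero (κ e) := charZero_κ (cotangentToBase (π ≫ σ) ≫ π ≫ σ) e
    have hn := hL.isConic.isNull he (hL.isLagrangian.isIsotropic he)
    have := mem_liftPts_of_isNull hM hS hlag hc hn (h1 he)
      (by rw [pt_comp, pt_κpt])
    rwa [pt_κpt] at this
  have h3 : (Lrel : Set (cotangent π)) ⊆
      closure (cotangentProj π σ '' maxPts (L : Set (cotangent (π ≫ σ)))) := by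
    refine hL.dense.trans ?_
    have := closure_image_closure (s := maxPts (L : Set (cotangent (π ≫ σ))))
      (cotangentProj π σ).continuous
    rw [closure_maxPts L.isClosed] at this
    rw [this]
  have h4 {e : cotangent (π ≫ σ)} (he : e ∈ liftPts σ Lrel) :
      e ∈ maxPts (L : Set (cotangent (π ≫ σ))) := by
    have hη := proj_mem_maxPts he
    -- Density alone puts the generic point only in a closure; local finiteness makes it a
    -- specialisation of an actual image, and maximality makes it equal to that image.
    obtain ⟨U, hU, hηU, hf⟩ := exists_chart_finite_inter σ Lrel (cotangentProj π σ e)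
    obtain ⟨_, ⟨e', he', rfl⟩, hs⟩ := exists_specializes_of_mem_closure hU (hf.subset
      (Set.inter_subset_inter_right _ (by rintro _ ⟨e', he', rfl⟩; exact h1 he'))) hηU (h3 hη.1)
    have := hη.2 _ (h1 he').1 hs
    rwa [← liftPts_injOn hM hS hlag (h2 he') he this]
  refine SetLike.coe_injective ?_
  rw [← closure_maxPts L.isClosed]
  exact congrArg closure (Set.Subset.antisymm (fun _ h ↦ h2 h) fun _ h ↦ h4 h)

end Lifting

end

/-! ### From vanishing of the Liouville form to isotropy on the smooth locus. -/

noncomputable section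

open KaehlerDifferential in
lemma Frame.snd_chain_rule {A B : Type u} [CommRing A] [CommRing B] [Algebra A B] {n : ℕ}
    (c : Frame A B n) {K : Type u} [Field K] (τ : B →+* DualNumber K)
    (hτ : ∀ a, (τ (algebraMap A B a)).snd = 0) (b : B) :
    (τ b).snd = ∑ j, (τ (c.v j (D A B b))).fst * (τ (c.x j)).snd := by
  let ψ : B →+* K := (TrivSqZeroExt.fstHom K K K).toRingHom.comp τ
  let _ : Algebra B K := ψ.toAlgebra
  let _ : Algebra A K := (ψ.comp (algebraMap A B)).toAlgebra
  have : IsScalarTower A B K := .of_algebraMap_eq' rfl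
  let δ : Derivation A B K := Derivation.mk'
    { toFun := fun b ↦ (τ b).snd
      map_add' := fun x y ↦ by rw [map_add, TrivSqZeroExt.snd_add]
      map_smul' := fun a x ↦ by
        rw [Algebra.smul_def, map_mul, TrivSqZeroExt.snd_mul, hτ]
        simp only [smul_zero, add_zero, RingHom.id_apply, Algebra.smul_def]
        rfl } fun x y ↦ by
    change (τ (x * y)).snd = x • (τ y).snd + y • (τ x).snd
    rw [map_mul, TrivSqZeroExt.snd_mul, op_smul_eq_smul]
    rfl
  have h := congrArg δ.liftKaehlerDifferential (c.sum (D A B b))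
  simp only [map_sum, map_smul, Derivation.liftKaehlerDifferential_comp_D] at h
  exact h

/-- The ideal (ε) has square zero and is maximal, so Spec K[ε] has a single point and lies in the
open chart as soon as that point does. -/
lemma exists_lift_of_dualNumber {K B : Type u} [Field K] [CommRing B] {W : Scheme.{u}}
    (j : Spec (.of B) ⟶ W) [IsOpenImmersion j] (v : Spec (.of (DualNumber K)) ⟶ W)
    (hv : pt (Spec.map (CommRingCat.ofHom (TrivSqZeroExt.fstHom K K K).toRingHom) ≫ v) ∈
      Set.range j) :
    ∃ τ : B →+* DualNumber K, Spec.map (CommRingCat.ofHom τ) ≫ j = v := by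
  have h : Set.range v ⊆ Set.range j := by
    rintro _ ⟨t, rfl⟩
    have ht : t = pt (Spec.map (CommRingCat.ofHom (TrivSqZeroExt.fstHom K K K).toRingHom)) := by
      refine PrimeSpectrum.ext ?_
      rw [pt_specMap]
      have ht' : (PrimeSpectrum.asIdeal t).IsPrime := PrimeSpectrum.isPrime t
      have hle : RingHom.ker (TrivSqZeroExt.fstHom K K K).toRingHom ≤ PrimeSpectrum.asIdeal t := by
        intro x hx
        refine ht'.mem_of_pow_mem 2 ?_
        have : x ^ 2 = 0 := by
          have hx' : x.fst = 0 := hx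
          refine TrivSqZeroExt.ext ?_ ?_ <;> simp [pow_two, hx']
        rw [this]
        exact Ideal.zero_mem _
      have hmax : (RingHom.ker (TrivSqZeroExt.fstHom K K K).toRingHom).IsMaximal :=
        RingHom.ker_isMaximal_of_surjective _ TrivSqZeroExt.fst_surjective
      exact (hmax.eq_of_le ht'.ne_top hle).symm
    rw [ht, ← pt_comp]
    exact hv
  refine ⟨(Spec.preimage (IsOpenImmersion.lift j v h)).hom, ?_⟩
  rw [CommRingCat.ofHom_hom, Spec.map_preimage, IsOpenImmersion.lift_fac]

variable {K : Type u} [Field K] {X : Scheme.{u}} {f : X ⟶ Spec (.of K)} [Smooth f]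

/-- The frame defined by coordinates. -/
def Chart.Coordinates.frame {Y : Scheme.{u}} {f : X ⟶ Y} {i : Chart f} {n : ℕ}
    (c : i.Coordinates n) : Frame i.A i.B n where
  x := c.x
  v := c.basis.coord
  dual l j := by
    rw [← c.basis_apply, Module.Basis.coord_apply, Module.Basis.repr_self, Finsupp.single_apply]
    simp [eq_comm]
  sum ω := by
    conv_lhs => rw [← c.basis.sum_repr ω]
    simp [c.basis_apply]

lemma IsNull.symplectic_eq_zero {Y : Scheme.{u}} {f : X ⟶ Y} [Smooth f] {F : Type u} [Field F]
    {q : Spec (.of F) ⟶ cotangent f} (hq : IsNull q) {i : Chart f} {n : ℕ} (c : Frame i.A i.B n)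
    {φ : i.ring →+* F} (hφ : Spec.map (CommRingCat.ofHom φ) ≫ cotangentChart f i = q)
    {δ₁ δ₂ : Derivation ℤ F F} (h₁ : Chart.Kills φ δ₁) (h₂ : Chart.Kills φ δ₂) :
    c.symplectic φ δ₁ δ₂ = 0 := by
  rw [c.symplectic_eq_liouville, hq i n c φ hφ _ h₁, hq i n c φ hφ _ h₂,
    hq i n c φ hφ ⁅δ₁, δ₂⁆ fun a ↦ by
      rw [Derivation.commutator_apply, h₁ a, h₂ a, map_zero, map_zero, sub_zero]]
  simp

lemma eq_of_chart_hom' {Y : Scheme.{u}} {f : X ⟶ Y} [Smooth f] {R : Type u} [CommRing R]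
    {q : Spec (.of R) ⟶ cotangent f} {i : Chart f} {φ φ' : i.ring →+* R}
    (h : Spec.map (CommRingCat.ofHom φ) ≫ cotangentChart f i = q)
    (h' : Spec.map (CommRingCat.ofHom φ') ≫ cotangentChart f i = q) : φ = φ' := by
  rw [← h', cancel_mono] at h
  exact congrArg CommRingCat.Hom.hom (Spec.map_injective h)

/-- If the Liouville form vanishes at the generic points of a reduced scheme, then the symplectic
form vanishes on its smooth locus. -/
lemma symplecticFormVanishes_of_isNull [CharZero K] {W : Scheme.{u}} [IsReduced W]
    {h : W ⟶ cotangent f}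
    (hn : ∀ z ∈ maxPts (Set.univ : Set W), IsNull (κpt z ≫ h)) :
    SymplecticFormVanishes f (h ≫ cotangentToBase f ≫ f) h := by
  intro v₁ v₂ hv hsm i n cc φ₁ φ₂ hφ₁ hφ₂
  have hpt : pt v₁.point = pt v₂.point := by rw [hv]
  have hi : h (pt v₁.point) ∈ Set.range (cotangentChart f i) := by
    rw [TangentVector.point, ← pt_comp, Category.assoc, ← hφ₁, ← Category.assoc]
    exact ⟨_, (pt_comp _ _).symm⟩
  obtain ⟨A, O, _, _, _, e, r, z, j, Φ, _, hxj, -, he, -, hred, hj, hΦ⟩ :=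
    (hsm (IsLocalRing.closedPoint K)).exists_chart hi
  have := hred inferInstance
  let c := cc.frame
  obtain ⟨τ₁, hτ₁⟩ := exists_lift_of_dualNumber j v₁.hom hxj
  obtain ⟨τ₂, hτ₂⟩ := exists_lift_of_dualNumber j v₂.hom (hpt ▸ hxj)
  obtain rfl : φ₁ = τ₁.comp Φ := eq_of_chart_hom' hφ₁ (by
    rw [CommRingCat.ofHom_comp, Spec.map_comp, Category.assoc, hΦ, ← Category.assoc, hτ₁])
  obtain rfl : φ₂ = τ₂.comp Φ := eq_of_chart_hom' hφ₂ (by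
    rw [CommRingCat.ofHom_comp, Spec.map_comp, Category.assoc, hΦ, ← Category.assoc, hτ₂])
  -- the values of the symplectic form on vector fields
  let D (l : Fin r) : Derivation ℤ O O :=
    ((z.v l).compDer (KaehlerDifferential.D A O)).restrictScalars ℤ
  have hD (l) (a : A) : D l (algebraMap A O a) = 0 := by
    change z.v l (KaehlerDifferential.D A O (algebraMap A O a)) = 0
    simp
  let ξ (s : Fin n) : i.ring := SymmetricAlgebra.ι i.B _ (c.v s)
  let X' (s : Fin n) : i.ring := algebraMap i.B _ (c.x s)
  -- The base rings of nonempty charts over a field are both that field; constants map to constants,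
  -- which the fields D_l kill.
  have hbase (a : i.A) : ∃ a' : A, Φ (algebraMap i.B _ (algebraMap i.A i.B a)) =
      algebraMap A O a' := by
    obtain ⟨ei, hei, hei', -⟩ := i.exists_field_equiv (mem_V_of_chart_hom
      (q := κpt (h (pt v₁.point))) (exists_lift_of_mem_range _ _ (by rwa [pt_κpt])).choose_spec)
    obtain ⟨y, rfl⟩ := hei a
    refine ⟨e y, ?_⟩
    have h1 := chart_hom_toBase_comp hΦ
    rw [hei', Category.assoc, hj, ← Spec.map_comp, ← CommRingCat.ofHom_comp] at h1
    exact (DFunLike.congr_fun (congrArg CommRingCat.Hom.hom (Spec.map_injective h1)) y).symm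
  -- The function ω(D_l, D_l') lies in every minimal prime, hence is nilpotent, hence zero since O
  -- is reduced. At a minimal prime the D_l pass to the residue field of a generic point of W, where
  -- λ vanishes and so does ω.
  have key (l l' : Fin r) : ∑ s, (D l (Φ (ξ s)) * D l' (Φ (X' s)) -
      D l' (Φ (ξ s)) * D l (Φ (X' s))) = 0 := by
    have h1 : ∑ s, (D l (Φ (ξ s)) * D l' (Φ (X' s)) - D l' (Φ (ξ s)) * D l (Φ (X' s))) ∈
        (⊥ : Ideal O).radical := by
      rw [← Ideal.sInf_minimalPrimes, Ideal.mem_sInf]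
      intro P hP
      have : P.IsPrime := hP.1.1
      let ρ : O →+* P.ResidueField := algebraMap _ _
      have hker : RingHom.ker ρ = P := Ideal.ker_algebraMap_residueField P
      let q := Spec.map (CommRingCat.ofHom ρ) ≫ j
      have hmax : pt q ∈ maxPts (Set.univ : Set W) := by
        refine ⟨trivial, fun y _ hy ↦ ?_⟩
        obtain ⟨(P' : PrimeSpectrum O), rfl⟩ := hy.mem_open j.isOpenEmbedding.isOpen_range
          ⟨_, (pt_comp _ _).symm⟩
        have hle : P'.asIdeal ≤ P := le_of_le_of_eq ((PrimeSpectrum.asIdeal_le_asIdeal _ _).mpr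
          ((PrimeSpectrum.le_iff_specializes _ _).mpr
            (j.isOpenEmbedding.isInducing.specializes_iff.mp hy))) ((pt_specMap ρ).trans hker)
        rw [pt_comp]
        refine congrArg j (PrimeSpectrum.ext ?_)
        rw [pt_specMap, hker]
        exact le_antisymm hle (hP.2 ⟨P'.2, bot_le⟩ hle)
      obtain ⟨α, hα⟩ := exists_κ_desc q rfl
      have hφ : Spec.map (CommRingCat.ofHom (ρ.comp Φ)) ≫ cotangentChart f i =
          Spec.map (CommRingCat.ofHom α) ≫ κpt (pt q) ≫ h := by
        rw [CommRingCat.ofHom_comp, Spec.map_comp, Category.assoc, hΦ, ← Category.assoc,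
          ← Category.assoc, hα]
      let _ : Algebra K O := ((algebraMap A O).comp e).toAlgebra
      have : CharZero P.ResidueField :=
        charZero_of_injective_algebraMap (algebraMap K P.ResidueField).injective
      have hext (l) := exists_derivation_field ρ (D l) fun b hb ↦ by
        have hb' : b ∈ P := by rw [← hker]; exact hb
        have := derivation_mem_minimalPrimes (k := K) (D l) hP hb'
        rw [← hker] at this
        exact this
      choose ε hε using hext
      have hkills (l) : Chart.Kills (ρ.comp Φ) (ε l) := fun a ↦ by
        obtain ⟨a', ha'⟩ := hbase a
        rw [RingHom.comp_apply, ha', hε, hD, map_zero]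
      have h2 := ((hn _ hmax).comp α).symplectic_eq_zero c hφ (hkills l) (hkills l')
      rw [← hker, RingHom.mem_ker, ← h2]
      simp only [Frame.symplectic, RingHom.comp_apply, hε, map_sum, map_sub, map_mul]
      rfl
    change _ ∈ nilradical O at h1
    rw [nilradical_eq_zero] at h1
    exact h1
  have hchain (τ : O →+* DualNumber K) (v : TangentVector (h ≫ cotangentToBase f ≫ f))
      (hτ : Spec.map (CommRingCat.ofHom τ) ≫ j = v.hom) (b : O) :
      (τ b).snd = ∑ l, (τ (D l b)).fst * (τ (z.x l)).snd := by
    refine z.snd_chain_rule τ (fun a ↦ ?_) b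
    obtain ⟨y, rfl⟩ := he a
    have h1 := v.hom_comp
    rw [← hτ, Category.assoc, hj, ← Spec.map_comp, ← CommRingCat.ofHom_comp] at h1
    have h2 := DFunLike.congr_fun (congrArg CommRingCat.Hom.hom (Spec.map_injective h1)) y
    exact (congrArg TrivSqZeroExt.snd h2).trans (TrivSqZeroExt.snd_inl _ _)
  have hfst (b : O) : (τ₁ b).fst = (τ₂ b).fst := by
    have h1 := hv
    rw [TangentVector.point, TangentVector.point, ← hτ₁, ← hτ₂, ← Category.assoc,
      ← Category.assoc, cancel_mono, ← Spec.map_comp, ← Spec.map_comp, ← CommRingCat.ofHom_comp,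
      ← CommRingCat.ofHom_comp] at h1
    exact DFunLike.congr_fun (congrArg CommRingCat.Hom.hom (Spec.map_injective h1)) b
  -- The two tangent vectors share their K-point, so both chain rules have coefficients at the same
  -- point and ω is bilinear in the ω(D_l, D_l').
  have h1 : cc.symplecticForm (τ₁.comp Φ) (τ₂.comp Φ) =
      ∑ l, ∑ l', (τ₁ (∑ s, (D l (Φ (ξ s)) * D l' (Φ (X' s)) -
      D l' (Φ (ξ s)) * D l (Φ (X' s))))).fst * ((τ₁ (z.x l)).snd * (τ₂ (z.x l')).snd) := by
    have h2 (b : O) := hchain τ₁ v₁ hτ₁ b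
    have h3 (b : O) : (τ₂ b).snd = ∑ l, (τ₁ (D l b)).fst * (τ₂ (z.x l)).snd := by
      rw [hchain τ₂ v₂ hτ₂ b]
      simp only [hfst]
    change ∑ s, ((τ₁ (Φ (ξ s))).snd * (τ₂ (Φ (X' s))).snd -
      (τ₂ (Φ (ξ s))).snd * (τ₁ (Φ (X' s))).snd) = _
    simp only [map_sum, TrivSqZeroExt.fst_sum, Finset.sum_mul]
    refine Eq.trans ?_ ((Finset.sum_congr rfl fun i _ ↦ Finset.sum_comm).trans Finset.sum_comm).symm
    refine Finset.sum_congr rfl fun s _ ↦ ?_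
    rw [h2 (Φ (ξ s)), h3 (Φ (X' s)), h3 (Φ (ξ s)), h2 (Φ (X' s)), Finset.sum_mul_sum,
      mul_comm (∑ l, _) (∑ l, (τ₁ (D l (Φ (X' s)))).fst * _), Finset.sum_mul_sum,
      ← Finset.sum_sub_distrib]
    refine Finset.sum_congr rfl fun l _ ↦ ?_
    rw [← Finset.sum_sub_distrib]
    refine Finset.sum_congr rfl fun l' _ ↦ ?_
    simp only [map_sub, map_mul, TrivSqZeroExt.fst_sub, TrivSqZeroExt.fst_mul]
    ring
  rw [h1]
  exact Finset.sum_eq_zero fun l _ ↦ Finset.sum_eq_zero fun l' _ ↦ by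
    rw [key, map_zero, TrivSqZeroExt.fst_zero, zero_mul]

end

/-! ### Spreading out the isomorphism, and the properties of the lifting. -/

noncomputable section

section SpreadingOut

variable {W W' : Scheme.{u}}

/-- The pulled-back vanishing ideal has full support, hence lies in the nilradical, which is zero on
a reduced source. -/
lemma exists_lift_reduced (Z : TopologicalSpace.Closeds W) (g : W' ⟶ W) [IsReduced W']
    (h : Set.range g ⊆ Z) : ∃ g' : W' ⟶ reduced Z, g' ≫ reducedι Z = g := by
  have hker : (reducedι Z).ker ≤ g.ker := by
    rw [Scheme.IdealSheafData.ker_subschemeι, ← Scheme.IdealSheafData.map_bot,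
      Scheme.IdealSheafData.le_map_iff_comap_le]
    rw [← Scheme.nilradical_eq_bot, ← Scheme.IdealSheafData.vanishingIdeal_top,
      ← Scheme.IdealSheafData.le_support_iff_le_vanishingIdeal]
    rw [Scheme.IdealSheafData.support_comap]
    intro x _
    have : g x ∈ Z := h ⟨x, rfl⟩
    change x ∈ ((Scheme.IdealSheafData.vanishingIdeal Z).support.preimage g.continuous :
      Set W')
    rw [TopologicalSpace.Closeds.coe_preimage, Scheme.IdealSheafData.coe_support_vanishingIdeal]
    exact this
  exact ⟨IsClosedImmersion.lift _ _ hker, IsClosedImmersion.lift_fac _ _ hker⟩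

/-- A function vanishing at the unique generic point of an open subset vanishes. -/
lemma eq_zero_of_notMem_basicOpen [IsReduced W] {V : W.Opens} {η : W}
    (h : ∀ y ∈ maxPts (Set.univ : Set W), y ∈ V → y = η) (x : Γ(W, V))
    (hx : η ∉ W.basicOpen x) : x = 0 := by
  rw [← basicOpen_eq_bot_iff, eq_bot_iff]
  intro z hz
  obtain ⟨y, hy, hyz⟩ := exists_maxPts_specializes isClosed_univ (Set.mem_univ z)
  have hy' := hyz.mem_open (W.basicOpen x).2 hz
  exact (hx (h y hy (W.basicOpen_le x hy') ▸ hy')).elim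

lemma mem_basicOpen_iff {V : W.Opens} (hV : IsAffineOpen V) {F : Type u} [Field F]
    {q : Spec (.of F) ⟶ W} {χ : Γ(W, V) →+* F}
    (h : Spec.map (CommRingCat.ofHom χ) ≫ hV.fromSpec = q) (x : Γ(W, V)) :
    pt q ∈ W.basicOpen x ↔ χ x ≠ 0 := by
  have h1 : pt q ∈ W.basicOpen x ↔
      pt (Spec.map (CommRingCat.ofHom χ)) ∈ hV.fromSpec ⁻¹ᵁ W.basicOpen x := by
    rw [← h, pt_comp]
    rfl
  rw [h1, hV.fromSpec_preimage_basicOpen]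
  change x ∉ (pt (Spec.map (CommRingCat.ofHom χ))).asIdeal ↔ _
  rw [pt_specMap, RingHom.mem_ker]

/-- An affine morphism of finite type between reduced schemes is an isomorphism near a generic
point over which it is bijective with trivial residue field extension. -/
lemma exists_isIso_morphismRestrict [IsReduced W] [IsReduced W'] (r : W' ⟶ W) [IsAffineHom r]
    [LocallyOfFiniteType r] {η : W} (q : Spec (.of (κ η)) ⟶ W') (hq : q ≫ r = κpt η)
    {V : W.Opens} (hV : IsAffineOpen V) (hη : η ∈ V)
    (h : ∀ y ∈ maxPts (Set.univ : Set W), y ∈ V → y = η)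
    (h' : ∀ y ∈ maxPts (Set.univ : Set W'), r y ∈ V → y = pt q) :
    ∃ U : W.Opens, η ∈ U ∧ IsIso (r ∣_ U) := by
  classical
  have hV' : IsAffineOpen (r ⁻¹ᵁ V) := hV.preimage r
  have hrq : r (pt q) = η := by rw [← pt_comp, hq, pt_κpt]
  obtain ⟨χ, hχ⟩ := exists_lift_of_mem_range hV.fromSpec (κpt η) (by
    rw [pt_κpt, hV.range_fromSpec]; exact hη)
  obtain ⟨χ', hχ'⟩ := exists_lift_of_mem_range hV'.fromSpec q (by
    rw [hV'.range_fromSpec]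
    change r (pt q) ∈ V
    rwa [hrq])
  let ρ : Γ(W, V) →+* Γ(W', r ⁻¹ᵁ V) := (r.app V).hom
  have hρ : χ'.comp ρ = χ := by
    have h1 := hV.SpecMap_appLE_fromSpec r hV' le_rfl
    rw [← Scheme.Hom.app_eq_appLE] at h1
    have h2 : Spec.map (CommRingCat.ofHom (χ'.comp ρ)) ≫ hV.fromSpec = κpt η := by
      rw [CommRingCat.ofHom_comp, Spec.map_comp, Category.assoc, CommRingCat.ofHom_hom, h1,
        ← Category.assoc, hχ', hq]
    rw [← hχ, cancel_mono] at h2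
    exact congrArg CommRingCat.Hom.hom (Spec.map_injective h2)
  have hfrac (g : Γ(W', r ⁻¹ᵁ V)) : ∃ a f : Γ(W, V), χ f ≠ 0 ∧ ρ f * g = ρ a := by
    obtain ⟨b, c, hbc⟩ := exists_eq_div_κ hV.fromSpec hχ (χ' g)
    -- A fraction with zero denominator is 0 by convention and is rewritten as 0 / 1.
    have h1 : ∃ b c, χ c ≠ 0 ∧ χ' g = χ b / χ c := by
      by_cases hc : χ c = 0
      · exact ⟨0, 1, by rw [map_one]; exact one_ne_zero, by rw [hbc, hc]; simp⟩
      · exact ⟨b, c, hc, hbc⟩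
    obtain ⟨b, c, hc, hbc⟩ := h1
    -- The residue field extension being trivial, ρ(c) g - ρ(b) vanishes at the only generic point
    -- of the preimage of V; as W' is reduced, it is zero.
    refine ⟨b, c, hc, sub_eq_zero.mp (eq_zero_of_notMem_basicOpen h' _ fun hmem ↦ ?_)⟩
    rw [mem_basicOpen_iff hV' hχ'] at hmem
    refine hmem ?_
    rw [map_sub, map_mul, ← RingHom.comp_apply, ← RingHom.comp_apply, hρ, hbc,
      mul_div_cancel₀ _ hc, sub_self]
  have hft : ρ.FiniteType := by
    have := r.finiteType_appLE hV hV' le_rfl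
    rwa [← Scheme.Hom.app_eq_appLE] at this
  let _ := ρ.toAlgebra
  obtain ⟨s, hs⟩ : (⊤ : Subalgebra Γ(W, V) Γ(W', r ⁻¹ᵁ V)).FG := hft.out
  choose a f hf hfa using hfrac
  -- Common denominator of finitely many algebra generators. After inverting it every function
  -- upstairs comes from below, while F stays nonzero at η.
  let F := ∏ g ∈ s, f g
  have hF : χ F ≠ 0 := by
    rw [map_prod]
    exact Finset.prod_ne_zero_iff.mpr fun g _ ↦ hf g
  have key (g : Γ(W', r ⁻¹ᵁ V)) : ∃ n b, ρ F ^ n * g = ρ b := by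
    have hg : g ∈ Algebra.adjoin Γ(W, V) (s : Set Γ(W', r ⁻¹ᵁ V)) := hs ▸ Algebra.mem_top
    induction hg using Algebra.adjoin_induction with
    | mem g hg =>
      refine ⟨1, (∏ g' ∈ s.erase g, f g') * a g, ?_⟩
      rw [map_mul, ← hfa g, pow_one, ← mul_assoc, ← map_mul, Finset.prod_erase_mul _ _ hg]
    | algebraMap b => exact ⟨0, b, by rw [pow_zero, one_mul]; rfl⟩
    | add x y _ _ hx hy =>
      obtain ⟨n, b, hx⟩ := hx
      obtain ⟨m, c, hy⟩ := hy
      refine ⟨n + m, F ^ m * b + F ^ n * c, ?_⟩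
      rw [map_add, map_mul, map_mul, ← hx, ← hy, map_pow, map_pow]
      ring
    | mul x y _ _ hx hy =>
      obtain ⟨n, b, hx⟩ := hx
      obtain ⟨m, c, hy⟩ := hy
      refine ⟨n + m, b * c, ?_⟩
      rw [map_mul, ← hx, ← hy]
      ring
  refine ⟨W.basicOpen F, ?_, ?_⟩
  · rw [← pt_κpt η, mem_basicOpen_iff hV hχ]
    exact hF
  rw [isIso_morphismRestrict_iff_isIso_app _ (hV.basicOpen F), ConcreteCategory.isIso_iff_bijective]
  have hle : W.basicOpen F ≤ V := W.basicOpen_le F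
  have hle' : r ⁻¹ᵁ W.basicOpen F ≤ r ⁻¹ᵁ V := fun _ hx ↦ hle hx
  let res := (W.presheaf.map (homOfLE hle).op).hom
  let res' := (W'.presheaf.map (homOfLE hle').op).hom
  have hres (b) : (r.app (W.basicOpen F)).hom (res b) = res' (ρ b) :=
    DFunLike.congr_fun (congrArg CommRingCat.Hom.hom (r.naturality (homOfLE hle).op)) b
  constructor
  · rw [injective_iff_map_eq_zero]
    intro y hy
    refine eq_zero_of_notMem_basicOpen (fun z hz hzV ↦ h z hz (hle hzV)) y fun hmem ↦ ?_
    have h1 : pt q ∈ r ⁻¹ᵁ W.basicOpen y := by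
      change r (pt q) ∈ W.basicOpen y
      rwa [hrq]
    rw [Scheme.preimage_basicOpen, hy, Scheme.basicOpen_zero] at h1
    exact h1
  · intro z
    let _ := res'.toAlgebra
    have h1 : IsLocalization.Away (ρ F) Γ(W', r ⁻¹ᵁ W.basicOpen F) :=
      hV'.isLocalization_of_eq_basicOpen (r.app V F) (homOfLE hle') (Scheme.preimage_basicOpen _ _)
    obtain ⟨n, x, hx⟩ := IsLocalization.Away.surj (ρ F) z
    obtain ⟨m, b, hb⟩ := key x
    have hu : IsUnit (res F) := RingedSpace.isUnit_res_basicOpen _ F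
    obtain ⟨u, hu⟩ := hu
    refine ⟨res b * (↑u⁻¹ : _) ^ (n + m), ?_⟩
    have hv : IsUnit ((res' (ρ F)) ^ (n + m)) := by
      rw [← hres, ← hu]
      exact (u.isUnit.map _).pow _
    rw [← hv.mul_left_inj]
    change (r.app (W.basicOpen F)).hom _ * _ = _
    rw [map_mul, map_pow, hres, ← hres F, ← hu, mul_assoc, ← mul_pow, ← map_mul, Units.inv_mul,
      map_one, one_pow, mul_one, hu, hres, ← hb, map_mul, map_pow, pow_add, ← mul_assoc]
    change z * res' (ρ F) ^ n = res' x at hx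
    rw [hx, mul_comm]

lemma isIso_morphismRestrict_iSup (r : W' ⟶ W) {ι : Type*} (U : ι → W.Opens)
    (h : ∀ i, IsIso (r ∣_ U i)) : IsIso (r ∣_ ⨆ i, U i) := by
  refine IsZariskiLocalAtTarget.of_forall_exists_morphismRestrict
    (P := MorphismProperty.isomorphisms Scheme.{u}) fun x ↦ ?_
  obtain ⟨i, hi⟩ := TopologicalSpace.Opens.mem_iSup.mp x.2
  refine ⟨(⨆ i, U i).ι ⁻¹ᵁ U i, hi, ?_⟩
  refine (MorphismProperty.arrow_mk_iso_iff (MorphismProperty.isomorphisms Scheme.{u})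
    (morphismRestrictRestrict r (⨆ i, U i) ((⨆ i, U i).ι ⁻¹ᵁ U i))).mpr ?_
  have he : (⨆ i, U i).ι ''ᵁ (⨆ i, U i).ι ⁻¹ᵁ U i = U i := by
    rw [Scheme.Hom.image_preimage_eq_opensRange_inf, Scheme.Opens.opensRange_ι]
    exact inf_eq_right.mpr (le_iSup U i)
  rw [he]
  exact h i

end SpreadingOut

lemma mem_maxPts_of_reduced {W : Scheme.{u}} {Z : TopologicalSpace.Closeds W} {z : reduced Z}
    (hz : z ∈ maxPts (Set.univ : Set (reduced Z))) : reducedι Z z ∈ maxPts (Z : Set W) := by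
  refine ⟨by rw [← range_reducedι]; exact ⟨z, rfl⟩, fun y hy hyz ↦ ?_⟩
  rw [← range_reducedι] at hy
  obtain ⟨y, rfl⟩ := hy
  rw [hz.2 y trivial ((reducedι Z).isClosedEmbedding.isInducing.specializes_iff.mp hyz)]

section Lifting

variable {k : Type u} [Field k] {M S : Scheme.{u}} {π : M ⟶ S} {σ : S ⟶ Spec (.of k)}
  [Smooth π] [Smooth σ]

instance : IsAffineHom (cotangentProj π σ) := by
  refine isAffineHom_of_forall_exists_isAffineOpen _ fun x ↦ ?_
  obtain ⟨i, n, c, hi, -⟩ := exists_frame π (cotangentToBase π x)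
  refine ⟨(cotangentChart π i).opensRange, ?_, isAffineOpen_opensRange _, ?_⟩
  · change x ∈ Set.range (cotangentChart π i)
    rw [range_cotangentChart]
    exact hi
  · have : cotangentProj π σ ⁻¹ᵁ (cotangentChart π i).opensRange =
        (cotangentChart (π ≫ σ) (i.comp σ)).opensRange := by
      ext x
      change cotangentProj π σ x ∈ Set.range (cotangentChart π i) ↔
        x ∈ Set.range (cotangentChart (π ≫ σ) (i.comp σ))
      rw [range_cotangentChart, range_cotangentChart, ← cotangentProj_toBase]
      rfl
    rw [this]
    exact isAffineOpen_opensRange _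

instance : LocallyOfFiniteType (cotangentProj π σ) := by
  have : LocallyOfFiniteType (cotangentProj π σ ≫ cotangentToBase π) := by
    rw [cotangentProj_toBase]
    infer_instance
  exact locallyOfFiniteType_of_comp _ (cotangentToBase π)

/-- Converse to `IsNull.comp`: in characteristic zero derivations extend along α, and α is
injective. -/
lemma IsNull.of_comp {X Y : Scheme.{u}} {f : X ⟶ Y} [Smooth f] {F F' : Type u} [Field F]
    [Field F'] [CharZero F] {q : Spec (.of F) ⟶ cotangent f} (α : F →+* F')
    (h : IsNull (Spec.map (CommRingCat.ofHom α) ≫ q)) : IsNull q := by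
  intro i n c φ hφ δ hδ
  obtain ⟨ε, hε⟩ := exists_derivation_extension_field α δ
  have h1 := h i n c (α.comp φ) (by
    rw [CommRingCat.ofHom_comp, Spec.map_comp, Category.assoc, hφ]) ε fun a ↦ by
      rw [RingHom.comp_apply, hε, hδ, map_zero]
  rw [c.liouville_comp α φ δ ε hε] at h1
  exact α.injective (h1.trans (map_zero α).symm)

variable {m d : ℕ} {Lrel : TopologicalSpace.Closeds (cotangent π)}

/-- Near z only finitely many other generic points occur; the union of their closures is closed and
misses z, so it can be removed. -/
lemma exists_affine_maxPts (σ : S ⟶ Spec (.of k)) [Smooth σ] {z : reduced Lrel}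
    (hz : z ∈ maxPts (Set.univ : Set (reduced Lrel))) :
    ∃ V : (reduced Lrel).Opens, IsAffineOpen V ∧ z ∈ V ∧
      ∀ y ∈ maxPts (Set.univ : Set (reduced Lrel)), y ∈ V → y = z := by
  obtain ⟨U, hU, hzU, hf⟩ := exists_chart_finite_inter σ Lrel (reducedι Lrel z)
  let T : Set (reduced Lrel) := reducedι Lrel ⁻¹' U ∩ maxPts Set.univ
  have hT : T.Finite := Set.Finite.of_injOn (f := reducedι Lrel)
    (t := U ∩ maxPts (Lrel : Set (cotangent π))) (fun y hy ↦
    ⟨hy.1, mem_maxPts_of_reduced hy.2⟩) (reducedι Lrel).isClosedEmbedding.injective.injOn hf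
  let O : Set (reduced Lrel) := reducedι Lrel ⁻¹' U ∩ (⋃ y ∈ T \ {z}, closure {y})ᶜ
  have hO : IsOpen O := (hU.preimage (reducedι Lrel).continuous).inter
    (hT.sdiff.isClosed_biUnion fun _ _ ↦ isClosed_closure).isOpen_compl
  have hzO : z ∈ O := by
    refine ⟨hzU, ?_⟩
    simp only [Set.mem_compl_iff, Set.mem_iUnion, not_exists]
    exact fun y hy hyz ↦ hy.2 (hz.2 y trivial (specializes_iff_mem_closure.mpr hyz))
  obtain ⟨_, ⟨V, hV, rfl⟩, hzV, hVO⟩ :=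
    (reduced Lrel).isBasis_affineOpens.exists_subset_of_mem_open hzO hO
  refine ⟨V, hV, hzV, fun y hy hyV ↦ by_contra fun hne ↦ (hVO hyV).2 ?_⟩
  have hyT : y ∈ T \ {z} := ⟨⟨(hVO hyV).1, hy⟩, hne⟩
  exact Set.mem_biUnion hyT (subset_closure rfl)

variable [CharZero k]

lemma isNull_of_mem_liftPts {e : cotangent (π ≫ σ)} (he : e ∈ liftPts σ Lrel) :
    IsNull (κpt e) := by
  obtain ⟨η, -, q, -, hn, rfl⟩ := he
  obtain ⟨α, hα⟩ := exists_κ_desc q rfl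
  have : CharZero (κ (pt q)) := charZero_κ (cotangentToBase (π ≫ σ) ≫ π ≫ σ) _
  exact IsNull.of_comp α (by rwa [hα])

lemma isLagrangian_lifting (hM : SmoothOfRelativeDimension m (π ≫ σ))
    (hS : SmoothOfRelativeDimension d σ) (hlag : IsRelativeLagrangian π Lrel) :
    IsLagrangian (π ≫ σ) (lifting σ Lrel) where
  isotropic := by
    refine symplecticFormVanishes_of_isNull fun z hz ↦ ?_
    have he := mem_maxPts_of_reduced hz
    rw [maxPts_lifting hM hS hlag] at he
    obtain ⟨α, hα⟩ := exists_κ_desc (κpt z ≫ reducedι (lifting σ Lrel)) (by rw [pt_comp, pt_κpt])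
    rw [← hα]
    exact (isNull_of_mem_liftPts he).comp α
  dim_eq _ hC := topologicalKrullDim_of_mem_components hM hS hlag hC

lemma isLifting_lifting (hM : SmoothOfRelativeDimension m (π ≫ σ))
    (hS : SmoothOfRelativeDimension d σ) (hlag : IsRelativeLagrangian π Lrel) (hc : IsConic Lrel) :
    IsLifting π σ Lrel (lifting σ Lrel) where
  isConic := isConic_lifting hM hS hlag hc
  isLagrangian := isLagrangian_lifting hM hS hlag
  image_subset := image_lifting_subset
  dense := subset_closure_image_lifting hS hlag hc
  dominates _ hC := closure_image_mem_components hM hS hlag hC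

lemma isIsoOverDenseOpen_lifting (hM : SmoothOfRelativeDimension m (π ≫ σ))
    (hS : SmoothOfRelativeDimension d σ) (hlag : IsRelativeLagrangian π Lrel) (hc : IsConic Lrel) :
    IsIsoOverDenseOpen π σ Lrel (lifting σ Lrel) := by
  obtain ⟨r, hr⟩ := exists_lift_reduced Lrel (reducedι (lifting σ Lrel) ≫ cotangentProj π σ) (by
    rintro _ ⟨x, rfl⟩
    refine image_lifting_subset (σ := σ) ⟨_, ?_, rfl⟩
    rw [← range_reducedι]
    exact ⟨x, rfl⟩)
  have hr' (y) : reducedι Lrel (r y) = cotangentProj π σ (reducedι (lifting σ Lrel) y) := by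
    rw [← Scheme.Hom.comp_apply, hr]
    rfl
  have h1 : IsAffineHom (r ≫ reducedι Lrel) := by rw [hr]; infer_instance
  have h2 : LocallyOfFiniteType (r ≫ reducedι Lrel) := by rw [hr]; infer_instance
  have : IsAffineHom r := .of_comp _ (reducedι Lrel)
  have : LocallyOfFiniteType r := locallyOfFiniteType_of_comp _ (reducedι Lrel)
  have hiso (z : maxPts (Set.univ : Set (reduced Lrel))) :
      ∃ U : (reduced Lrel).Opens, z.1 ∈ U ∧ IsIso (r ∣_ U) := by
    obtain ⟨z, hz⟩ := z
    obtain ⟨V, hV, hzV, hVz⟩ := exists_affine_maxPts σ hz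
    have hη := mem_maxPts_of_reduced hz
    obtain ⟨q, hq, hn⟩ := (isNull_of_mem_maxPts σ hlag hc hη).exists_lift hS
    have he : pt q ∈ liftPts σ Lrel := ⟨_, hη, q, hq, hn, rfl⟩
    obtain ⟨q', hq'⟩ := exists_lift_reduced (lifting σ Lrel) q (by
      rintro _ ⟨s, rfl⟩
      rw [eq_pt]
      exact subset_closure he)
    -- The lift has values in the residue field taken in T^*(π); α moves it to the residue field of
    -- z in the reduced scheme.
    obtain ⟨α, hα⟩ := exists_κ_desc (κpt z ≫ reducedι Lrel) (by rw [pt_comp, pt_κpt])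
    refine exists_isIso_morphismRestrict r (Spec.map (CommRingCat.ofHom α) ≫ q') ?_ hV hzV hVz
      fun y hy hyV ↦ ?_
    · rw [← cancel_mono (reducedι Lrel), Category.assoc, Category.assoc, hr, ← Category.assoc q',
        hq', hq, hα]
    · rw [pt_comp_map]
      refine (reducedι (lifting σ Lrel)).isClosedEmbedding.injective ?_
      have hy' := mem_maxPts_of_reduced hy
      rw [maxPts_lifting hM hS hlag] at hy'
      rw [← pt_comp, hq']
      refine liftPts_injOn hM hS hlag hy' he ?_
      -- A generic point of Λ maps to a generic point of Λ^rel, so inside V it can only map to z;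
      -- injectivity on null lifts then identifies y.
      have hry : r y ∈ maxPts (Set.univ : Set (reduced Lrel)) := by
        refine ⟨trivial, fun w _ hw ↦ (reducedι Lrel).isClosedEmbedding.injective ?_⟩
        rw [hr']
        refine (proj_mem_maxPts hy').2 _ (by rw [← range_reducedι]; exact ⟨w, rfl⟩) ?_
        rw [← hr']
        exact hw.map (reducedι Lrel).continuous
      rw [← hr', hVz _ hry hyV, ← pt_comp, hq, pt_κpt]
  choose U hU hUr using hiso
  refine ⟨r, hr, ⨆ z, U z, ?_, isIso_morphismRestrict_iSup r U hUr⟩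
  intro z
  obtain ⟨y, hy, hyz⟩ := exists_maxPts_specializes isClosed_univ (Set.mem_univ z)
  exact hyz.mem_closed isClosed_closure
    (subset_closure (TopologicalSpace.Opens.mem_iSup.mpr ⟨⟨y, hy⟩, hU _⟩))

end Lifting

end

end RelCotangent

open RelCotangent in
theorem propositionp {k : Type u} [Field k] [IsAlgClosed k] [CharZero k] {M S : Scheme.{u}}
    (π : M ⟶ S) (σ : S ⟶ Spec (.of k)) [Smooth π] [Smooth σ] (m d : ℕ)
    (hM : SmoothOfRelativeDimension m (π ≫ σ)) (hS : SmoothOfRelativeDimension d σ)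
    (Lrel : TopologicalSpace.Closeds (cotangent π))
    (hconic : IsConic Lrel) (hlag : IsRelativeLagrangian π Lrel) :
    ∃ L : TopologicalSpace.Closeds (cotangent (π ≫ σ)),
      IsLifting π σ Lrel L ∧
      (∀ L' : TopologicalSpace.Closeds (cotangent (π ≫ σ)), IsLifting π σ Lrel L' → L' = L) ∧
      IsIsoOverDenseOpen π σ Lrel L ∧
      shadow (π ≫ σ) L = shadow π Lrel ∧
      ∀ x ∈ shadow π Lrel, closure {π x} ∈ irreducibleComponents S := by
  refine ⟨lifting σ Lrel, isLifting_lifting hM hS hlag hconic,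
    fun L' hL' ↦ hL'.eq_lifting hM hS hlag hconic,
    isIsoOverDenseOpen_lifting hM hS hlag hconic, shadow_lifting hM hS hlag hconic,
    fun x hx ↦ ?_⟩
  obtain ⟨η, hη, rfl⟩ := mem_shadow_iff.mp hx
  exact closure_mem_irreducibleComponents hM hS hlag hη
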